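/- **Setting.** Let $h$ be a conjugate mirror filter with taps $h[0],\dots,h[2q-1]$, that is, $\sum_k h[k]h[k+2m]=\delta_{m,0}$ for all $m\in\mathbb Z$ and $\sum_k h[k]=\sqrt2$, and let $g[k]=(-1)^k h[1-k]$. A compactly supported wavelet with filter $h$ is given by a compactly supported scaling function $\varphi\in L^2(\mathbb R)$ with orthonormal integer translates and $\varphi(x)=\sqrt2\sum_k h[k]\varphi(2x-k)$, whose mother wavelet $\psi(x)=\sqrt2\sum_k g[k]\varphi(2x-k)$ is bounded. For $n=2^L$, $L\ge1$, the associated wavelet basis $\{\psi_i\}_{i=1}^n$ of $\mathbb R^n$ is produced by the cascade algorithm: $\varphi_{0,t}$ is the $t$-th unit vector, $\varphi_{j+1,t}=\sum_s h[s-2t]\varphi_{j,s}$ and $\psi_{j+1,t}=\sum_s g[s-2t]\varphi_{j,s}$, where positions at scale $j$ are taken modulo $n/2^j$; the basis consists of the vectors $\psi_{j,t}$, $1\le j\le L$, $0\le t<n/2^j$, and of $\varphi_{L,0}$. Let $$K=\sup\{\,2^{j/2}\|\psi_{j,t}\|_\infty : n=2^L,\ 1\le j\le L,\ t\in\mathbb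 Z\,\},$$ a number that depends on the wavelet only, and not on $n$. **Theorem.** There is an absolute constant $C$ such that the following holds for every $q$ and every compactly supported wavelet whose filter has $2q$ taps. 1. $K<\infty$. 2. For all $n=2^L\ge2$, all $p,p'\in[1,\infty]$ with $\frac1p+\frac1{p'}=1$, all integers $B\ge0$ and all $f\in\mathbb R^n$: if $S$ consists of $\min(B,n)$ indices $i$ for which $|\langle f,\psi_i\rangle|/\|\psi_i\|_{p'}$ is largest (ties broken arbitrarily), then for every $z\in\mathbb R^n$ with at most $B$ non-zero entries $$\Big\|f-\sum_{i\in S}\langle f,\psi_i\rangle\psi_i\Big\|_p\ \le\ C\,K\,q^{3/2}\,\log_2 n\ \Big\|f-\sum_{i=1}^n z_i\psi_i\Big\|_p .$$ Thus keeping the greedily selected coefficients is an $O(q^{3/2}\log n)$ approximation to the best unrestricted $B$-term representation in $\ell_p$. 3. Such a selection can be made by a one-pass streaming algorithm in $O(B+\log n)$ space. Precisely, there is a fixed program (depending on the wavelet, but not on $n,p,B,f$) for a real RAM with a read-once input and a write-only output which, given $n$, $B$ and $1/p$ and reading $f(1),\dots,f(n)$ once in this order, outputs the indices $i\in S$ together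 with the coefficients $\langle f,\psi_i\rangle$ for some $S$ as in 2. It uses $c\,(B+\log_2 n)$ memory cells for real numbers (with arithmetic, comparison and powers) and as many for integer words of at most $c\,(\log_2 n+\beta)$ bits, where $\beta$ is the number of binary digits of $B$ and $c$ depends only on $q$. -/

import Mathlib

open MeasureTheory

noncomputable section

namespace GreedyWavelet

/-- `h` is a (real) conjugate mirror filter with taps in `{0, …, 2q-1}`: it is orthogonal to its
even translates, has unit energy, and its taps add up to `√2`. -/
structure IsConjugateMirrorFilter (q : ℕ) (h : ℤ → ℝ) : Prop where
  support : ∀ k : ℤ, h k ≠ 0 → 0 ≤ k ∧ k ≤ 2 * (q : ℤ) - 1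
  orthonormal : ∀ m : ℤ,
    ∑ k ∈ Finset.Icc (0 : ℤ) (2 * q - 1), h k * h (k + 2 * m) = if m = 0 then 1 else 0
  sum_eq : ∑ k ∈ Finset.Icc (0 : ℤ) (2 * q - 1), h k = √2

/-- The mirror (high-pass) filter `g[k] = (-1)^k h[1-k]`, with taps in `{2-2q, …, 1}`. -/
def mirror (h : ℤ → ℝ) (k : ℤ) : ℝ := (-1 : ℝ) ^ k * h (1 - k)

/-- The mother wavelet `ψ(x) = √2 ∑ₖ g[k] φ(2x - k)`. -/
def mother (q : ℕ) (h : ℤ → ℝ) (φ : ℝ → ℝ) (x : ℝ) : ℝ :=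
  √2 * ∑ k ∈ Finset.Icc (2 - 2 * (q : ℤ)) 1, mirror h k * φ (2 * x - k)

/-- A compactly supported orthonormal wavelet whose filter has `2q` taps: a conjugate mirror filter
together with a compactly supported square integrable scaling function which satisfies the
refinement equation and has orthonormal integer translates, such that the mother wavelet is
(essentially) bounded. -/
structure CompactWavelet (q : ℕ) where
  h : ℤ → ℝ
  filter : IsConjugateMirrorFilter q h
  φ : ℝ → ℝ
  memLp_scaling : MemLp φ 2 volume
  compact_scaling : HasCompactSupport φ
  refinement : ∀ᵐ x : ℝ,
    φ x = √2 * ∑ k ∈ Finset.Icc (0 : ℤ) (2 * q - 1), h k * φ (2 * x - k)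
  orthonormal : ∀ k : ℤ, ∫ x : ℝ, φ x * φ (x - k) = if k = 0 then 1 else 0
  bounded_mother : ∃ M : ℝ, ∀ᵐ x : ℝ, |mother q h φ x| ≤ M

/-! ### The wavelet basis of `ℝⁿ`, `n = 2 ^ L` -/

/-- Indices of the basis of `ℝⁿ`, `n = 2 ^ L`: `some ⟨j, t⟩` stands for `ψ_{j+1,t}`
(scales `1, …, L`, positions `0 ≤ t < n / 2^(j+1)`), and `none` for the coarsest scaling vector. -/
abbrev Idx (L : ℕ) : Type := Option (Σ j : Fin L, Fin (2 ^ (L - 1 - (j : ℕ))))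

variable {q : ℕ}

namespace CompactWavelet

/-- The scaling vectors `φ_{j,t}` in `ℝⁿ`, `n = 2 ^ L`, produced by the cascade algorithm:
`φ_{0,t}` is the unit vector at `t` and `φ_{j+1,t} = ∑ₛ h[s - 2t] φ_{j,s}`, positions being wrapped
around (at scale `j ≤ L`, the vector only depends on `t` modulo `n / 2^j`). -/
def scalingVec (W : CompactWavelet q) (L : ℕ) : ℕ → ℤ → (Fin (2 ^ L) → ℝ)
  | 0, t => fun i => if ((i : ℕ) : ℤ) = t % (2 ^ L : ℤ) then 1 else 0
  | j + 1, t => ∑ m ∈ Finset.Icc (0 : ℤ) (2 * q - 1), W.h m • W.scalingVec L j (2 * t + m)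

/-- The wavelet vector `ψ_{j+1,t} = ∑ₛ g[s - 2t] φ_{j,s}` of scale `j + 1`, wrapped around. -/
def waveletVec (W : CompactWavelet q) (L j : ℕ) (t : ℤ) : Fin (2 ^ L) → ℝ :=
  ∑ m ∈ Finset.Icc (2 - 2 * (q : ℤ)) 1, mirror W.h m • W.scalingVec L j (2 * t + m)

/-- The wavelet basis `{ψ_i}` of `ℝⁿ`, `n = 2 ^ L`. -/
def basis (W : CompactWavelet q) (L : ℕ) : Idx L → (Fin (2 ^ L) → ℝ)
  | none => W.scalingVec L L 0
  | some ⟨j, t⟩ => W.waveletVec L j ((t : ℕ) : ℤ)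

/-- The wavelet coefficient `⟨f, ψ_i⟩`. -/
def coeff (W : CompactWavelet q) {L : ℕ} (f : Fin (2 ^ L) → ℝ) (i : Idx L) : ℝ :=
  f ⬝ᵥ W.basis L i

/-- The numbers `2^(j/2) |ψ_{j,t}[k]|`, over all lengths `n = 2 ^ L`, scales `1 ≤ j ≤ L`,
positions `t` and points `k`. -/
def scaledValues (W : CompactWavelet q) : Set ℝ :=
  {x | ∃ (L j : ℕ) (t : ℤ) (k : Fin (2 ^ L)), j < L ∧ x = √2 ^ (j + 1) * |W.waveletVec L j t k|}

/-- The scale-invariant bound on the wavelet vectors, `sup 2^(j/2) ‖ψ_{j,t}‖_∞`. It does not depend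
on the length `n` of the signal. -/
def supConst (W : CompactWavelet q) : ℝ := sSup W.scaledValues

end CompactWavelet

/-- The `ℓ_p` norm on `ℝⁿ`. -/
def pNorm (p : ENNReal) {n : ℕ} (v : Fin n → ℝ) : ℝ := ‖WithLp.toLp p v‖

/-- `S` consists of `B` (or all, if there are fewer than `B`) indices that are largest under the
ordering `|⟨f, ψ_i⟩| / ‖ψ_i‖_{p'}`; ties may be broken arbitrarily. -/
def IsGreedySelection (W : CompactWavelet q) {L : ℕ} (p' : ENNReal) (B : ℕ) (f : Fin (2 ^ L) → ℝ)
    (S : Finset (Idx L)) : Prop :=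
  S.card = min B (2 ^ L) ∧
    ∀ i ∈ S, ∀ k ∉ S,
      |W.coeff f k| / pNorm p' (W.basis L k) ≤ |W.coeff f i| / pNorm p' (W.basis L i)

/-! ### One-pass streaming programs

A real RAM with a read-once input. Its memory consists of `S` cells for integer words of `w` bits
and `S` cells for real numbers; a program is a fixed finite text. -/

/-- Integer expressions; `cell a` is the content of the integer cell with address `a`. -/
inductive NatExpr : Type
  | lit (c : ℕ)
  | cell (a : NatExpr)
  | add (a b : NatExpr)
  | sub (a b : NatExpr)
  | mul (a b : NatExpr)
  | div (a b : NatExpr)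
  | mod (a b : NatExpr)

/-- Real expressions; `cell a` is the content of the real cell with address `a`. -/
inductive RealExpr : Type
  | lit (c : ℝ)
  | cell (a : NatExpr)
  | add (x y : RealExpr)
  | sub (x y : RealExpr)
  | mul (x y : RealExpr)
  | div (x y : RealExpr)
  | pow (x y : RealExpr)

/-- Programs. `ifNat x y P Q` runs `P` if `x ≤ y` and `Q` otherwise, and so does `ifReal`;
`loop k P` runs `P` as many times as the value of `k` on entry; `read a` consumes the next item of
the stream; `emit a b x` writes a triple on the write-only output. -/
inductive Program : Type
  | skip
  | seq (P Q : Program)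
  | setNat (a v : NatExpr)
  | setReal (a : NatExpr) (v : RealExpr)
  | read (a : NatExpr)
  | emit (a b : NatExpr) (x : RealExpr)
  | ifNat (x y : NatExpr) (P Q : Program)
  | ifReal (x y : RealExpr) (P Q : Program)
  | loop (k : NatExpr) (P : Program)

/-- A configuration: integer memory, real memory, the unread part of the stream, the output. -/
structure Config where
  nat : ℕ → ℕ
  real : ℕ → ℝ
  input : List ℝ
  output : List ((ℕ × ℕ) × ℝ)

def NatExpr.eval (σ : Config) : NatExpr → ℕ
  | lit c => c
  | cell a => σ.nat (a.eval σ)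
  | add a b => a.eval σ + b.eval σ
  | sub a b => a.eval σ - b.eval σ
  | mul a b => a.eval σ * b.eval σ
  | div a b => a.eval σ / b.eval σ
  | mod a b => a.eval σ % b.eval σ

def RealExpr.eval (σ : Config) : RealExpr → ℝ
  | lit c => c
  | cell a => σ.real (a.eval σ)
  | add x y => x.eval σ + y.eval σ
  | sub x y => x.eval σ - y.eval σ
  | mul x y => x.eval σ * y.eval σ
  | div x y => x.eval σ / y.eval σ
  | pow x y => x.eval σ ^ y.eval σ

/-- Store an integer: only the lowest `w` bits are kept, and only the addresses below `S` exist
(a store to any other address has no effect). -/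
def Config.storeNat (S w : ℕ) (σ : Config) (a v : ℕ) : Config :=
  if a < S then { σ with nat := Function.update σ.nat a (v % 2 ^ w) } else σ

/-- Store a real number; only the addresses below `S` exist. -/
def Config.storeReal (S : ℕ) (σ : Config) (a : ℕ) (v : ℝ) : Config :=
  if a < S then { σ with real := Function.update σ.real a v } else σ

/-- The effect of a program on a machine with `S` integer cells of `w` bits and `S` real cells. -/
def Program.exec (S w : ℕ) : Program → Config → Config
  | skip, σ => σ
  | seq P Q, σ => Q.exec S w (P.exec S w σ)
  | setNat a v, σ => σ.storeNat S w (a.eval σ) (v.eval σ)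
  | setReal a v, σ => σ.storeReal S (a.eval σ) (v.eval σ)
  | read a, σ => { σ.storeReal S (a.eval σ) (σ.input.headD 0) with input := σ.input.tail }
  | emit a b x, σ => { σ with output := σ.output ++ [((a.eval σ, b.eval σ), x.eval σ)] }
  | ifNat x y P Q, σ => if x.eval σ ≤ y.eval σ then P.exec S w σ else Q.exec S w σ
  | ifReal x y P Q, σ => if x.eval σ ≤ y.eval σ then P.exec S w σ else Q.exec S w σ
  | loop k P, σ => (P.exec S w)^[k.eval σ] σ

/-- The start: the length of the stream and the number `B` of terms are in the integer cells `0`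
and `1`, the number `1 / p` is in the real cell `0`, all other cells are `0`. -/
def Config.start (B : ℕ) (p : ENNReal) {n : ℕ} (f : Fin n → ℝ) : Config where
  nat a := if a = 0 then n else if a = 1 then B else 0
  real a := if a = 0 then (p⁻¹).toReal else 0
  input := List.ofFn f
  output := []

/-- The name of a basis vector on the output: `(j, t)` for `ψ_{j,t}`, where `j ≥ 1`, and `(0, 0)`
for the coarsest scaling vector. -/
def code {L : ℕ} : Idx L → ℕ × ℕ
  | none => (0, 0)
  | some ⟨j, t⟩ => (j + 1, t)

end GreedyWavelet

end

/-!
# Greedy wavelet coefficients in `ℓ_p`, in one pass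

**The constant is finite.** Without the wrap-around, the entries of `ψ_{j,t}` are combinations,
with the taps of the mirror filter, of inner products of `φ` with its dilates
(`lineVec_eq_integral`). Hence they are inner products of `φ` with dilates of the bounded function
`ψ`, which are `O(2^(-j/2) ‖ψ‖_∞ ‖φ‖_1)`; wrapping around adds at most `2q + 1` of them
(`bddAbove_scaledValues`).

**Approximation.** The basis is orthonormal, so `f` is the sum of the vectors `⟨f, ψ_i⟩ ψ_i`. Let
`u` be the residual of a representation `z`, and `T` the support of `z`. Outside `T`, the
coefficients of `f` and of `u` agree, and each point lies in the support of only `O(q log n)` basis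
vectors. By Hölder's inequality, the `ℓ_p` norm of the numbers `|⟨f, ψ_i⟩| / ‖ψ_i‖_{p'}`, `i ∉ T`,
is therefore controlled by `‖u‖_p` (`sum_abs_dotProduct_div_rpow_le`). The greedy choice minimizes
the norm of the numbers that are left out among all sets of at most `B` indices
(`sum_compl_le_sum_compl`). As `‖ψ_i‖_p ‖ψ_i‖_{p'} ≤ ‖ψ_i‖_1 ‖ψ_i‖_∞ = O(K √q)`, the limited
overlap turns this back into a bound for the residual of the greedy representation
(`pNorm_sum_compl_le`, `greedy_approximation`).

**Streaming.** The program never stores a basis vector: an entry of `ψ_{j+1,t}` is a sum over all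
paths of the cascade, and these are numbered by the integers below `(2q)^(j+1)`, so that a counter
of `O(log n)` bits suffices to compute it (`sum_pathTerm`). In the same way, the support and the
norm `‖ψ_i‖_{p'}` are recomputed whenever they are needed (`exec_scanProg`). The memory holds the
partial coefficients of the indices in a set `K`. After each item of the stream, the vectors that
have just begun enter `K`. Then, as long as `K` contains more than `B` vectors whose support has
been read completely, so that their coefficients are final, the one with the least score leaves. An
index that has left remains beaten by `B` others for good (`Candidates`). At any time, only
`O(q log n)` vectors have begun but not ended (`card_active_le`), whence the bound on the space. At
the end of the stream, `K` is a greedy selection (`Candidates.isGreedySelection`).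
-/

noncomputable section
namespace GreedyWavelet

/-! ### Supports and periodicity -/

theorem CompactWavelet.one_le {q : ℕ} (W : CompactWavelet q) : 1 ≤ q := by
  rcases Nat.eq_zero_or_pos q with rfl | h
  · have h := W.filter.sum_eq
    simp at h
    exact absurd h.symm (by positivity)
  · exact h

open Classical in
/-- The points of the cycle `ℤ / 2^L` covered by the interval `[a, a + (2q-1)(2^J-1)]`; this is
where a vector of scale `J` can be non-zero. -/
def arc (q L J : ℕ) (a : ℤ) : Finset (Fin (2 ^ L)) :=
  {k | ∃ r : ℤ, a ≤ (k : ℕ) + r * 2 ^ L ∧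
    ((k : ℕ) : ℤ) + r * 2 ^ L ≤ a + (2 * q - 1) * (2 ^ J - 1)}

theorem mem_arc {q L J : ℕ} {a : ℤ} {k : Fin (2 ^ L)} : k ∈ arc q L J a ↔
    ∃ r : ℤ, a ≤ (k : ℕ) + r * 2 ^ L ∧
      ((k : ℕ) : ℤ) + r * 2 ^ L ≤ a + (2 * q - 1) * (2 ^ J - 1) := by
  simp [arc]

namespace CompactWavelet

variable {q : ℕ} (W : CompactWavelet q)

theorem mem_arc_of_scalingVec_ne_zero {L j : ℕ} {t : ℤ} {k : Fin (2 ^ L)}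
    (hk : W.scalingVec L j t k ≠ 0) : k ∈ arc q L j (2 ^ j * t) := by
  induction j generalizing t with
  | zero =>
    rw [mem_arc]
    simp only [scalingVec, ne_eq, ite_eq_right_iff, one_ne_zero, imp_false, not_not] at hk
    refine ⟨t / 2 ^ L, ?_, ?_⟩ <;>
    · have := Int.emod_add_mul_ediv t (2 ^ L)
      rw [hk]; linarith
  | succ j ih =>
    simp only [scalingVec, Finset.sum_apply, Pi.smul_apply, smul_eq_mul] at hk
    obtain ⟨m, hm, h⟩ := Finset.exists_ne_zero_of_sum_ne_zero hk
    obtain ⟨r, h1, h2⟩ := mem_arc.1 (ih (right_ne_zero_of_mul h))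
    rw [Finset.mem_Icc] at hm
    have hP : (0 : ℤ) < 2 ^ j := by positivity
    refine mem_arc.2 ⟨r, ?_, ?_⟩
    · rw [pow_succ]; nlinarith
    · rw [pow_succ]; nlinarith

/-- Each step of the cascade lengthens the support by the `2q` taps of a filter; by induction the
support of a vector of scale `J` is an arc of length `O(q 2^J)`. -/
theorem mem_arc_of_waveletVec_ne_zero {L j : ℕ} {t : ℤ} {k : Fin (2 ^ L)}
    (hk : W.waveletVec L j t k ≠ 0) :
    k ∈ arc q L (j + 1) (2 ^ (j + 1) * t + 2 ^ j * (2 - 2 * q)) := by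
  simp only [waveletVec, Finset.sum_apply, Pi.smul_apply, smul_eq_mul] at hk
  obtain ⟨m, hm, h⟩ := Finset.exists_ne_zero_of_sum_ne_zero hk
  obtain ⟨r, h1, h2⟩ := mem_arc.1 (W.mem_arc_of_scalingVec_ne_zero (right_ne_zero_of_mul h))
  rw [Finset.mem_Icc] at hm
  have hP : (0 : ℤ) < 2 ^ j := by positivity
  refine mem_arc.2 ⟨r, ?_, ?_⟩
  · rw [pow_succ]; nlinarith
  · rw [pow_succ]; nlinarith

/-- At scale `j` the positions only matter modulo `n / 2^j`. -/
theorem scalingVec_congr {L j : ℕ} (hj : j ≤ L) {s t : ℤ} (h : s ≡ t [ZMOD 2 ^ (L - j)]) :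
    W.scalingVec L j s = W.scalingVec L j t := by
  induction j generalizing s t with
  | zero =>
    funext i
    simp only [scalingVec]
    rw [show s % 2 ^ L = t % 2 ^ L from h]
  | succ j ih =>
    simp only [scalingVec]
    refine Finset.sum_congr rfl fun m _ => ?_
    rw [ih (by omega)]
    have h2 : (2 : ℤ) * s ≡ 2 * t [ZMOD 2 * 2 ^ (L - (j + 1))] := h.mul_left' 
    rw [← pow_succ', show L - (j + 1) + 1 = L - j by omega] at h2
    exact h2.add_right m

end CompactWavelet

theorem card_arc_le {q L J : ℕ} (hq : 1 ≤ q) (a : ℤ) : (arc q L J a).card ≤ 2 * q * 2 ^ J := by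
  have hP : (1 : ℤ) ≤ 2 ^ J := one_le_pow₀ (by norm_num)
  have hq' : (1 : ℤ) ≤ q := by exact_mod_cast hq
  have hlen : (0 : ℤ) ≤ (2 * q - 1) * (2 ^ J - 1) := by nlinarith
  have h : (arc q L J a).image (fun k : Fin (2 ^ L) => ((k : ℕ) : ℤ)) ⊆
      (Finset.Icc a (a + (2 * q - 1) * (2 ^ J - 1))).image (· % 2 ^ L) := by
    intro x hx
    obtain ⟨k, hk, rfl⟩ := Finset.mem_image.1 hx
    obtain ⟨r, h1, h2⟩ := mem_arc.1 hk
    refine Finset.mem_image.2 ⟨_, Finset.mem_Icc.2 ⟨h1, h2⟩, ?_⟩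
    have hk2 : ((k : ℕ) : ℤ) < 2 ^ L := by exact_mod_cast k.2
    simp only [Int.add_mul_emod_self_right]
    exact Int.emod_eq_of_lt (by positivity) hk2
  have h1 := Finset.card_le_card h
  rw [Finset.card_image_of_injective _ (fun x y hxy => Fin.ext (by exact_mod_cast hxy))] at h1
  refine h1.trans (Finset.card_image_le.trans ?_)
  rw [Int.card_Icc]
  zify
  rw [Int.toNat_of_nonneg (by linarith)]
  nlinarith

/-- At most `2q` of the intervals of one scale cover a given point. -/
theorem card_overlap_le {q L J : ℕ} (hq : 1 ≤ q) (hJ : J ≤ L) (b : ℤ) (k : Fin (2 ^ L)) :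
    ({t : Fin (2 ^ (L - J)) | k ∈ arc q L J (2 ^ J * ((t : ℕ) : ℤ) + b)} : Finset _).card
      ≤ 2 * q := by
  have hP : (0 : ℤ) < 2 ^ J := by positivity
  have hq' : (1 : ℤ) ≤ q := by exact_mod_cast hq
  set s₀ : ℤ := ((k : ℕ) - b) / 2 ^ J
  have h : (({t : Fin (2 ^ (L - J)) | k ∈ arc q L J (2 ^ J * ((t : ℕ) : ℤ) + b)} :
      Finset _).image (fun t : Fin (2 ^ (L - J)) => ((t : ℕ) : ℤ))) ⊆
      (Finset.Icc (s₀ - 2 * q + 1) s₀).image (· % 2 ^ (L - J)) := by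
    intro x hx
    obtain ⟨t, ht, rfl⟩ := Finset.mem_image.1 hx
    obtain ⟨r, h1, h2⟩ := mem_arc.1 (Finset.mem_filter.1 ht).2
    have hL : (2 : ℤ) ^ L = 2 ^ J * 2 ^ (L - J) := by rw [← pow_add]; congr 1; omega
    rw [hL] at h1 h2
    have e1 := Int.emod_add_mul_ediv ((k : ℕ) - b) (2 ^ J)
    have e2 := Int.emod_nonneg ((k : ℕ) - b) hP.ne'
    have e3 := Int.emod_lt_of_pos ((k : ℕ) - b) hP
    change _ + 2 ^ J * s₀ = _ at e1
    refine Finset.mem_image.2 ⟨(t : ℕ) + (-r) * 2 ^ (L - J), Finset.mem_Icc.2 ⟨?_, ?_⟩, ?_⟩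
    · by_contra hc
      have h3 : 2 * (q : ℤ) + ((t : ℕ) + -r * 2 ^ (L - J)) - s₀ ≤ 0 := by linarith
      nlinarith [mul_nonpos_of_nonneg_of_nonpos hP.le h3]
    · by_contra hc
      have h3 : s₀ + 1 - ((t : ℕ) + -r * 2 ^ (L - J)) ≤ 0 := by linarith
      nlinarith [mul_nonpos_of_nonneg_of_nonpos hP.le h3]
    · have ht2 : ((t : ℕ) : ℤ) < 2 ^ (L - J) := by exact_mod_cast t.2
      simp only [Int.add_mul_emod_self_right]
      exact Int.emod_eq_of_lt (by positivity) ht2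
  have h1 := Finset.card_le_card h
  rw [Finset.card_image_of_injective _ (fun x y hxy => Fin.ext (by exact_mod_cast hxy))] at h1
  refine h1.trans (Finset.card_image_le.trans ?_)
  rw [Int.card_Icc]
  omega

/-- An arc that meets both sides of the cut after `k` contains `k` or the first point of the
cycle. -/
theorem mem_arc_or_zero_mem_arc {q L J : ℕ} {a : ℤ} {k i i' : Fin (2 ^ L)} (hi : i ≤ k)
    (hi' : k ≤ i') (h : i ∈ arc q L J a) (h' : i' ∈ arc q L J a) :
    k ∈ arc q L J a ∨ ⟨0, by positivity⟩ ∈ arc q L J a := by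
  obtain ⟨r, h1, h2⟩ := mem_arc.1 h
  obtain ⟨r', h1', h2'⟩ := mem_arc.1 h'
  have b1 : ((i : ℕ) : ℤ) < 2 ^ L := by exact_mod_cast i.2
  have b2 : ((i' : ℕ) : ℤ) < 2 ^ L := by exact_mod_cast i'.2
  have b3 : ((i : ℕ) : ℤ) ≤ (k : ℕ) := by exact_mod_cast hi
  have b4 : ((k : ℕ) : ℤ) ≤ (i' : ℕ) := by exact_mod_cast hi'
  have hP : (0 : ℤ) < 2 ^ L := by positivity
  have b5 : (0 : ℤ) ≤ (i : ℕ) := by positivity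
  have b6 : (0 : ℤ) ≤ (i' : ℕ) := by positivity
  rcases lt_trichotomy r r' with hr | rfl | hr
  · refine Or.inr (mem_arc.2 ⟨r + 1, ?_, ?_⟩) <;> push_cast <;> nlinarith
  · exact Or.inl (mem_arc.2 ⟨r, by linarith, by linarith⟩)
  · refine Or.inr (mem_arc.2 ⟨r' + 1, ?_, ?_⟩) <;> push_cast <;> nlinarith

/-! ### Orthonormality of the basis -/

/-- A double sum over two filters, weighted by a function of the difference of the positions which
vanishes at odd differences, only involves the correlations of the filters at even shifts. -/
theorem sum_mul_sum_eq_sum_correlation {a b : ℤ → ℝ} {F : ℤ → ℝ} {A B V : Finset ℤ}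
    (hb : ∀ m, b m ≠ 0 → m ∈ B) (hF : ∀ d, F d ≠ 0 → Even d)
    (hV : ∀ m ∈ A, ∀ m' ∈ B, ∀ v, m' = m + 2 * v → v ∈ V) :
    ∑ m ∈ A, ∑ m' ∈ B, a m * b m' * F (m - m') =
      ∑ v ∈ V, F (-(2 * v)) * ∑ m ∈ A, a m * b (m + 2 * v) := by
  simp_rw [Finset.mul_sum]
  rw [Finset.sum_comm (s := V)]
  refine Finset.sum_congr rfl fun m hm => ?_
  have hinj : Function.Injective fun v : ℤ => m + 2 * v := fun x y h => by
    simp only at h; omega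
  rw [← Finset.sum_filter_ne_zero]
  rw [← Finset.sum_filter_ne_zero (s := V)]
  symm
  refine Finset.sum_of_injOn (fun v : ℤ => m + 2 * v) hinj.injOn ?_ ?_ ?_
  · intro v hv
    simp only [Finset.coe_filter, Set.mem_ofPred_eq] at hv ⊢
    have h2 := right_ne_zero_of_mul (right_ne_zero_of_mul hv.2)
    refine ⟨hb _ h2, ?_⟩
    rw [show m - (m + 2 * v) = -(2 * v) by ring, mul_comm]
    exact hv.2
  · intro m' hm' hn
    simp only [Finset.mem_filter] at hm'
    exfalso
    obtain ⟨u, hu⟩ := hF _ (right_ne_zero_of_mul hm'.2)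
    refine hn ⟨-u, ?_, by simp only; omega⟩
    simp only [Finset.coe_filter, Set.mem_ofPred_eq]
    refine ⟨hV m hm m' hm'.1 _ (by omega), ?_⟩
    rw [show m + 2 * -u = m' by omega, show -(2 * -u) = m - m' by omega, mul_comm]
    exact hm'.2
  · intro v _
    rw [show m - (m + 2 * v) = -(2 * v) by ring, mul_comm]

variable {q : ℕ} {h : ℤ → ℝ}

theorem mirror_support (hh : IsConjugateMirrorFilter q h) {k : ℤ} (hk : mirror h k ≠ 0) :
    2 - 2 * (q : ℤ) ≤ k ∧ k ≤ 1 := by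
  have := hh.support _ (right_ne_zero_of_mul hk)
  omega

/-- The mirror filter is orthonormal to its even translates, since it is the reflected filter `h` up
to signs that are equal at even distance. -/
theorem correlation_mirror (hh : IsConjugateMirrorFilter q h) (v : ℤ) :
    ∑ k ∈ Finset.Icc (2 - 2 * (q : ℤ)) 1, mirror h k * mirror h (k + 2 * v) =
      if v = 0 then 1 else 0 := by
  have h1 := hh.orthonormal (-v)
  simp only [neg_eq_zero] at h1
  rw [← h1]
  refine Finset.sum_nbij' (fun k => 1 - k) (fun k => 1 - k) ?_ ?_ ?_ ?_ ?_
  · intro k hk; rw [Finset.mem_Icc] at hk ⊢; omega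
  · intro k hk; rw [Finset.mem_Icc] at hk ⊢; omega
  · intro k _; ring
  · intro k _; ring
  · intro k _
    have h2 : ((-1 : ℝ) ^ k) * (-1) ^ (k + 2 * v) = 1 := by
      rw [← zpow_add₀ (by norm_num), show k + (k + 2 * v) = 2 * (k + v) by ring]
      exact (even_two_mul _).neg_one_zpow
    simp only [mirror]
    rw [show 1 - (k + 2 * v) = 1 - k + 2 * -v by ring]
    linear_combination h (1 - k) * h (1 - k + 2 * -v) * h2

/-- The two filters are orthogonal at all even shifts: the substitution `k ↦ 1 - 2v - k` turns the
correlation into its negative. -/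
theorem correlation_filter_mirror (hh : IsConjugateMirrorFilter q h) (v : ℤ) :
    ∑ k ∈ Finset.Icc (0 : ℤ) (2 * q - 1), h k * mirror h (k + 2 * v) = 0 := by
  have h0 : ∑ k ∈ Finset.Icc (0 : ℤ) (2 * q - 1), h k * mirror h (k + 2 * v) =
      ∑' k : ℤ, h k * mirror h (k + 2 * v) := by
    refine (tsum_eq_sum fun k hk => ?_).symm
    have : h k = 0 := by
      by_contra hc
      exact hk (Finset.mem_Icc.2 (hh.support k hc))
    rw [this, zero_mul]
  have h1 : ∑' k : ℤ, h k * mirror h (k + 2 * v) = -∑' k : ℤ, h k * mirror h (k + 2 * v) := by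
    rw [← tsum_neg]
    conv_lhs => rw [← (Equiv.subLeft (1 - 2 * v)).tsum_eq]
    refine tsum_congr fun k => ?_
    simp only [Equiv.subLeft_apply, mirror]
    rw [show 1 - 2 * v - k + 2 * v = 1 - k by ring, show 1 - (1 - k) = k by ring,
      show 1 - (k + 2 * v) = 1 - 2 * v - k by ring]
    have h2 : ((-1 : ℝ) ^ (1 - k)) = -(-1) ^ (k + 2 * v) := by
      have h3 : (-1 : ℝ) ^ (1 - k) * (-1) ^ (k + 2 * v) = -1 := by
        rw [← zpow_add₀ (by norm_num), show 1 - k + (k + 2 * v) = 2 * v + 1 by ring]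
        exact (odd_two_mul_add_one _).neg_one_zpow
      have h4 : ((-1 : ℝ) ^ (k + 2 * v)) * (-1) ^ (k + 2 * v) = 1 := by
        rw [← zpow_add₀ (by norm_num)]
        exact (Even.add_self _).neg_one_zpow
      linear_combination (-1 : ℝ) ^ (k + 2 * v) * h3 - (-1 : ℝ) ^ (1 - k) * h4
    rw [h2]; ring
  rw [h0]; linarith

namespace CompactWavelet

variable (W : CompactWavelet q)

theorem sum_smul_dotProduct_sum_smul {ι κ n : Type*} [Fintype n] (s : Finset ι) (t : Finset κ)
    (a : ι → ℝ) (b : κ → ℝ) (u : ι → n → ℝ) (v : κ → n → ℝ) :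
    (∑ i ∈ s, a i • u i) ⬝ᵥ (∑ k ∈ t, b k • v k) =
      ∑ i ∈ s, ∑ k ∈ t, a i * b k * (u i ⬝ᵥ v k) := by
  rw [sum_dotProduct]
  refine Finset.sum_congr rfl fun i _ => ?_
  rw [dotProduct_sum]
  refine Finset.sum_congr rfl fun k _ => ?_
  rw [smul_dotProduct, dotProduct_smul]
  simp [mul_assoc]

/-- If the vectors of scale `j` are orthonormal, then the inner products of two filtered families at
the next scale are given by the correlation of the filters. -/
theorem filtered_dotProduct {L j : ℕ} (hj : j < L)
    (ho : ∀ s t : ℤ, W.scalingVec L j s ⬝ᵥ W.scalingVec L j t =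
      if (2 ^ (L - j) : ℤ) ∣ s - t then 1 else 0)
    {a b : ℤ → ℝ} {α α' β β' : ℤ}
    (hb : ∀ m, b m ≠ 0 → β ≤ m ∧ m ≤ β') {c : ℝ}
    (hab : ∀ v, ∑ m ∈ Finset.Icc α α', a m * b (m + 2 * v) = if v = 0 then c else 0) (s t : ℤ) :
    (∑ m ∈ Finset.Icc α α', a m • W.scalingVec L j (2 * s + m)) ⬝ᵥ
      (∑ m ∈ Finset.Icc β β', b m • W.scalingVec L j (2 * t + m)) =
      if (2 ^ (L - (j + 1)) : ℤ) ∣ s - t then c else 0 := by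
  rw [sum_smul_dotProduct_sum_smul]
  simp_rw [ho]
  have hpow : (2 : ℤ) ^ (L - j) = 2 * 2 ^ (L - (j + 1)) := by
    rw [← pow_succ']; congr 1; omega
  set F : ℤ → ℝ := fun d => if (2 ^ (L - j) : ℤ) ∣ 2 * (s - t) + d then 1 else 0 with hFdef
  have e : ∀ m m' : ℤ, (if (2 ^ (L - j) : ℤ) ∣ 2 * s + m - (2 * t + m') then (1 : ℝ) else 0) =
      F (m - m') := by
    intro m m'
    simp only [hFdef]
    rw [show 2 * s + m - (2 * t + m') = 2 * (s - t) + (m - m') by ring]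
  simp_rw [e]
  rw [sum_mul_sum_eq_sum_correlation (V := Finset.Icc (min (β - α') 0) (max (β' - α) 0))
    (fun m hm => Finset.mem_Icc.2 (hb m hm))]
  · simp_rw [hab]
    rw [Finset.sum_eq_single 0]
    · simp only [hFdef, hpow]
      simp only [mul_zero, neg_zero, add_zero, if_true]
      simp only [mul_dvd_mul_iff_left (two_ne_zero : (2 : ℤ) ≠ 0)]
      split_ifs <;> simp
    · intro v _ hv; rw [if_neg hv, mul_zero]
    · intro hc; exact absurd (Finset.mem_Icc.2 ⟨min_le_right _ _, le_max_right _ _⟩) hc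
  · intro d hd
    simp only [hFdef, ne_eq, ite_eq_right_iff, one_ne_zero, imp_false, not_not] at hd
    rw [hpow] at hd
    have := (Dvd.intro _ rfl : (2 : ℤ) ∣ 2 * 2 ^ (L - (j + 1))).trans hd
    rw [even_iff_two_dvd]; omega
  · intro m hm m' hm' v hv
    rw [Finset.mem_Icc] at hm hm'
    rw [Finset.mem_Icc]; omega

theorem scalingVec_dotProduct {L j : ℕ} (hj : j ≤ L) (s t : ℤ) :
    W.scalingVec L j s ⬝ᵥ W.scalingVec L j t =
      if (2 ^ (L - j) : ℤ) ∣ s - t then 1 else 0 := by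
  induction j generalizing s t with
  | zero =>
    have hs0 := Int.emod_nonneg s (b := 2 ^ L) (by positivity)
    have hs1 := Int.emod_lt_of_pos s (b := 2 ^ L) (by positivity)
    set k : Fin (2 ^ L) := ⟨(s % 2 ^ L).toNat, by zify; rwa [Int.toNat_of_nonneg hs0]⟩ with hk
    have hk' : ((k : ℕ) : ℤ) = s % 2 ^ L := by simp [hk, Int.toNat_of_nonneg hs0]
    simp only [dotProduct, scalingVec]
    rw [Finset.sum_eq_single k]
    · rw [hk', if_pos rfl, one_mul]
      simp only [Nat.sub_zero]
      refine if_congr ?_ rfl rfl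
      exact Int.emod_eq_emod_iff_emod_sub_eq_zero.trans Int.dvd_iff_emod_eq_zero.symm
    · intro i _ hi
      rw [if_neg, zero_mul]
      intro hc
      exact hi (Fin.ext (by rw [← hk'] at hc; exact_mod_cast hc))
    · intro hc; exact absurd (Finset.mem_univ _) hc
  | succ j ih =>
    exact W.filtered_dotProduct (by omega) (fun s t => ih (by omega) s t) (c := 1)
      (fun m hm => W.filter.support m hm) (fun v => W.filter.orthonormal v) s t

theorem waveletVec_dotProduct {L j : ℕ} (hj : j < L) (s t : ℤ) :
    W.waveletVec L j s ⬝ᵥ W.waveletVec L j t =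
      if (2 ^ (L - (j + 1)) : ℤ) ∣ s - t then 1 else 0 :=
  W.filtered_dotProduct hj (W.scalingVec_dotProduct hj.le) (c := 1)
    (fun _ hm => mirror_support W.filter hm) (correlation_mirror W.filter) s t

theorem scalingVec_dotProduct_waveletVec {L j i : ℕ} (hj : j < i) (hi : i ≤ L) (s t : ℤ) :
    W.scalingVec L i s ⬝ᵥ W.waveletVec L j t = 0 := by
  induction i, hj using Nat.le_induction generalizing s with
  | base =>
    refine (W.filtered_dotProduct (by omega) (W.scalingVec_dotProduct (by omega)) (c := 0)
      (fun _ hm => mirror_support W.filter hm) (fun v => ?_) s t).trans (by simp)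
    rw [correlation_filter_mirror W.filter]; simp
  | succ i _ ih =>
    rw [scalingVec, sum_dotProduct]
    refine Finset.sum_eq_zero fun m _ => ?_
    rw [smul_dotProduct, ih (by omega), smul_zero]

theorem waveletVec_dotProduct_of_lt {L j i : ℕ} (hj : j < i) (hi : i ≤ L) (s t : ℤ) :
    W.waveletVec L i s ⬝ᵥ W.waveletVec L j t = 0 := by
  rw [waveletVec, sum_dotProduct]
  refine Finset.sum_eq_zero fun m _ => ?_
  rw [smul_dotProduct, W.scalingVec_dotProduct_waveletVec hj hi, smul_zero]

theorem basis_dotProduct {L : ℕ} (i k : Idx L) :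
    W.basis L i ⬝ᵥ W.basis L k = if i = k then 1 else 0 := by
  match i, k with
  | none, none => simp [basis, W.scalingVec_dotProduct le_rfl]
  | none, some ⟨j, t⟩ => simp [basis, W.scalingVec_dotProduct_waveletVec j.2 le_rfl]
  | some ⟨j, t⟩, none =>
    simp [basis, dotProduct_comm, W.scalingVec_dotProduct_waveletVec j.2 le_rfl]
  | some ⟨j, t⟩, some ⟨j', t'⟩ =>
    rcases lt_trichotomy j j' with hlt | rfl | hlt
    · simp only [basis]
      rw [dotProduct_comm, W.waveletVec_dotProduct_of_lt hlt (by omega), if_neg]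
      intro hc
      simp only [Option.some.injEq, Sigma.mk.injEq] at hc
      exact absurd hc.1 hlt.ne
    · simp only [basis]
      rw [W.waveletVec_dotProduct j.2]
      refine if_congr ?_ rfl rfl
      simp only [Option.some.injEq, Sigma.mk.injEq, heq_eq_eq, true_and]
      rw [show L - ((j : ℕ) + 1) = L - 1 - (j : ℕ) by omega]
      have h1 := t.2
      have h2 := t'.2
      constructor
      · intro hd
        obtain ⟨x, hx⟩ := hd
        have hP : (0 : ℤ) < 2 ^ (L - 1 - (j : ℕ)) := by positivity
        zify at h1 h2
        have : x = 0 := by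
          have hx1 : x < 1 := by by_contra hc; nlinarith
          have hx2 : -1 < x := by by_contra hc; nlinarith
          omega
        subst this
        exact Fin.ext (by zify; linarith)
      · rintro rfl; simp
    · simp only [basis]
      rw [W.waveletVec_dotProduct_of_lt hlt (by omega), if_neg]
      intro hc
      simp only [Option.some.injEq, Sigma.mk.injEq] at hc
      exact absurd hc.1 hlt.ne'

end CompactWavelet

theorem card_idx (L : ℕ) : Fintype.card (Idx L) = 2 ^ L := by
  rw [Fintype.card_option, Fintype.card_sigma]
  simp only [Fintype.card_fin]
  rw [Fin.sum_univ_eq_sum_range (fun j => 2 ^ (L - 1 - j)) L, Finset.sum_range_reflect (2 ^ ·) L,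
    Nat.geomSum_eq le_rfl]
  have : 0 < 2 ^ L := by positivity
  omega

namespace CompactWavelet

variable (W : CompactWavelet q)

theorem sum_coeff_smul_basis {L : ℕ} (f : Fin (2 ^ L) → ℝ) :
    ∑ i, W.coeff f i • W.basis L i = f := by
  let M : Matrix (Idx L) (Fin (2 ^ L)) ℝ := Matrix.of fun i k => W.basis L i k
  have h1 : M * M.transpose = 1 := by
    ext i k
    rw [Matrix.mul_apply', Matrix.one_apply]
    exact W.basis_dotProduct i k
  have h2 : M.transpose * M = 1 :=
    (Matrix.mul_eq_one_comm_of_card_eq _ _ _ (by rw [card_idx, Fintype.card_fin])).1 h1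
  funext k
  have h3 : (M.transpose * M).mulVec f k = f k := by rw [h2, Matrix.one_mulVec]
  rw [← Matrix.mulVec_mulVec] at h3
  rw [← h3]
  simp only [Finset.sum_apply, Pi.smul_apply, smul_eq_mul, Matrix.mulVec, dotProduct,
    Matrix.transpose_apply, coeff, M, Matrix.of_apply]
  refine Finset.sum_congr rfl fun i _ => ?_
  rw [mul_comm]
  simp_rw [mul_comm (f _)]

theorem coeff_sum_smul {L : ℕ} (z : Idx L → ℝ) (i : Idx L) :
    W.coeff (∑ k, z k • W.basis L k) i = z i := by
  rw [coeff, sum_dotProduct, Finset.sum_eq_single i]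
  · rw [smul_dotProduct, W.basis_dotProduct, if_pos rfl, smul_eq_mul, mul_one]
  · intro k _ hk
    rw [smul_dotProduct, W.basis_dotProduct, if_neg hk, smul_zero]
  · intro hc; exact absurd (Finset.mem_univ _) hc

end CompactWavelet

variable {q : ℕ}

/-! ### The coarsest scaling vector -/

theorem sum_mirror {h : ℤ → ℝ} (hh : IsConjugateMirrorFilter q h) :
    ∑ m ∈ Finset.Icc (2 - 2 * (q : ℤ)) 1, mirror h m = 0 := by
  set I := Finset.Icc (0 : ℤ) (2 * q - 1)
  set A := ∑ m ∈ I, (-1 : ℝ) ^ m * h m with hA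
  have h1 : ∑ m ∈ Finset.Icc (2 - 2 * (q : ℤ)) 1, mirror h m = -A := by
    rw [hA, ← Finset.sum_neg_distrib]
    refine Finset.sum_nbij' (fun k => 1 - k) (fun k => 1 - k) ?_ ?_ ?_ ?_ ?_
    · intro k hk; rw [Finset.mem_Icc] at *; omega
    · intro k hk; rw [Finset.mem_Icc] at *; omega
    · intro k _; ring
    · intro k _; ring
    · intro k _
      simp only [mirror]
      rw [zpow_sub₀ (by norm_num), zpow_one, div_eq_mul_inv, ← inv_zpow, inv_neg_one]
      ring
  -- `(∑ (-1)^m h[m])² + (∑ h[m])²` is twice the sum of all correlations at even shifts, that is, 2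
  have h2 := sum_mul_sum_eq_sum_correlation (a := h) (b := h) (F := fun d => 1 + (-1 : ℝ) ^ d)
    (A := I) (B := I) (V := Finset.Icc (-(2 * q : ℤ)) (2 * q))
    (fun m hm => Finset.mem_Icc.2 (hh.support m hm))
    (fun d hd => by
      by_contra hc
      rw [Int.not_even_iff_odd] at hc
      exact hd (by rw [hc.neg_one_zpow]; ring))
    (fun m hm m' hm' v hv => by simp only [I, Finset.mem_Icc] at *; omega)
  simp_rw [I, hh.orthonormal] at h2
  have h3 : ∑ v ∈ Finset.Icc (-(2 * q : ℤ)) (2 * q),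
      (1 + (-1 : ℝ) ^ (-(2 * v))) * (if v = 0 then 1 else 0) = 2 := by
    rw [Finset.sum_eq_single 0]
    · norm_num
    · intro v _ hv; rw [if_neg hv, mul_zero]
    · intro hc; exact absurd (Finset.mem_Icc.2 (by omega)) hc
  rw [h3] at h2
  have h4 : A * A + (∑ m ∈ I, h m) * (∑ m ∈ I, h m) = 2 := by
    rw [← h2, hA, Finset.sum_mul_sum, Finset.sum_mul_sum, ← Finset.sum_add_distrib]
    refine Finset.sum_congr rfl fun m _ => ?_
    rw [← Finset.sum_add_distrib]
    refine Finset.sum_congr rfl fun m' _ => ?_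
    rw [zpow_sub₀ (by norm_num), div_eq_mul_inv, ← inv_zpow, inv_neg_one]
    ring
  rw [hh.sum_eq, Real.mul_self_sqrt (by norm_num)] at h4
  rw [h1, neg_eq_zero]
  exact mul_self_eq_zero.1 (by linarith)

namespace CompactWavelet

variable (W : CompactWavelet q)

theorem sum_scalingVec (L j : ℕ) (t : ℤ) : ∑ k, W.scalingVec L j t k = √2 ^ j := by
  induction j generalizing t with
  | zero =>
    have := W.scalingVec_dotProduct (Nat.zero_le L) t t
    rw [sub_self, if_pos (dvd_zero _)] at this
    rw [pow_zero, ← this]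
    refine Finset.sum_congr rfl fun k _ => ?_
    simp [scalingVec]
  | succ j ih =>
    simp only [scalingVec, Finset.sum_apply, Pi.smul_apply, smul_eq_mul]
    rw [Finset.sum_comm]
    simp_rw [← Finset.mul_sum, ih, ← Finset.sum_mul]
    rw [W.filter.sum_eq, pow_succ']

/-- The coarsest scaling vector is constant. Indeed the sum of its entries is `√2 ^ L`, and all
wavelet vectors have sum zero, so the constant vectors, being orthogonal to the wavelets, are its
multiples. -/
theorem scalingVec_top (L : ℕ) (k : Fin (2 ^ L)) : W.scalingVec L L 0 k = (√2)⁻¹ ^ L := by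
  have h1 := congrFun (W.sum_coeff_smul_basis (fun _ : Fin (2 ^ L) => (1 : ℝ))) k
  rw [Fintype.sum_option, Finset.sum_eq_zero] at h1
  · have h2 : W.coeff (fun _ : Fin (2 ^ L) => (1 : ℝ)) none = √2 ^ L := by
      rw [← W.sum_scalingVec L L 0]
      simp [coeff, basis, dotProduct]
    rw [h2, add_zero, Pi.smul_apply, smul_eq_mul] at h1
    rw [inv_pow]
    exact eq_inv_of_mul_eq_one_right h1
  · rintro ⟨j, t⟩ _
    have h2 : W.coeff (fun _ : Fin (2 ^ L) => (1 : ℝ)) (some ⟨j, t⟩) = 0 := by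
      simp only [coeff, basis, dotProduct, one_mul, waveletVec, Finset.sum_apply, Pi.smul_apply,
        smul_eq_mul]
      rw [Finset.sum_comm]
      simp_rw [← Finset.mul_sum, sum_scalingVec, ← Finset.sum_mul]
      rw [sum_mirror W.filter, zero_mul]
    rw [h2, zero_smul]

/-! ### Uniform boundedness of the wavelet vectors -/

/-- The scaling sequences on the line: the cascade algorithm without wrapping around. -/
def lineVec : ℕ → ℤ → ℤ → ℝ
  | 0, t => fun s => if s = t then 1 else 0
  | j + 1, t => fun s => ∑ m ∈ Finset.Icc (0 : ℤ) (2 * q - 1), W.h m * lineVec j (2 * t + m) s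

/-- The scaling vectors are obtained by wrapping the sequences on the line around the cycle; it
suffices to sum over the turns `r` for which the support on the line is met. -/
theorem scalingVec_eq_sum_lineVec {L j : ℕ} {t : ℤ} {k : Fin (2 ^ L)} {R : Finset ℤ}
    (hR : ∀ r : ℤ, 2 ^ j * t ≤ (k : ℕ) + r * 2 ^ L →
      ((k : ℕ) : ℤ) + r * 2 ^ L ≤ 2 ^ j * t + (2 * q - 1) * (2 ^ j - 1) → r ∈ R) :
    W.scalingVec L j t k = ∑ r ∈ R, W.lineVec j t ((k : ℕ) + r * 2 ^ L) := by
  induction j generalizing t with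
  | zero =>
    simp only [scalingVec, lineVec]
    have hk0 : ((k : ℕ) : ℤ) < 2 ^ L := by exact_mod_cast k.2
    have hP : (0 : ℤ) < 2 ^ L := by positivity
    by_cases hk : ((k : ℕ) : ℤ) = t % 2 ^ L
    · have h1 := Int.emod_add_mul_ediv t (2 ^ L)
      rw [if_pos hk, Finset.sum_eq_single (t / 2 ^ L), if_pos (by rw [hk]; linarith)]
      · intro r _ hr
        refine if_neg fun hc => hr ?_
        rw [hk] at hc
        have : (r - t / 2 ^ L) * 2 ^ L = 0 := by linarith
        rcases mul_eq_zero.1 this with h | h <;> omega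
      · intro hc
        refine absurd (hR _ ?_ ?_) hc <;>
        · rw [hk]; simp only [pow_zero]; linarith
    · rw [if_neg hk, Finset.sum_eq_zero]
      intro r _
      refine if_neg fun hc => hk ?_
      rw [← hc, Int.add_mul_emod_self_right]
      exact (Int.emod_eq_of_lt (by positivity) hk0).symm
  | succ j ih =>
    simp only [scalingVec, lineVec, Finset.sum_apply, Pi.smul_apply, smul_eq_mul]
    rw [Finset.sum_comm]
    refine Finset.sum_congr rfl fun m hm => ?_
    rw [← Finset.mul_sum, ih]
    intro r h1 h2
    rw [Finset.mem_Icc] at hm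
    have hP : (0 : ℤ) < 2 ^ j := by positivity
    refine hR r ?_ ?_
    · rw [pow_succ]; nlinarith
    · rw [pow_succ]; nlinarith

theorem quasiMeasurePreserving_affine {a : ℝ} (ha : a ≠ 0) (t : ℝ) :
    Measure.QuasiMeasurePreserving (fun x : ℝ => a * x - t) volume volume := by
  have h1 : Measure.QuasiMeasurePreserving (fun x : ℝ => a * x) volume volume := by
    refine ⟨measurable_const_mul a, ?_⟩
    rw [Real.map_volume_mul_left ha]
    exact Measure.smul_absolutelyContinuous
  exact (measurePreserving_sub_right volume t).quasiMeasurePreserving.comp h1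

theorem memLp_affine {f : ℝ → ℝ} (hf : MemLp f 2 volume) {a : ℝ} (ha : a ≠ 0) (t : ℝ) :
    MemLp (fun x => f (a * x - t)) 2 volume := by
  have hm : AEStronglyMeasurable (fun x => f (a * x - t)) volume :=
    hf.1.comp_quasiMeasurePreserving (quasiMeasurePreserving_affine ha t)
  rw [memLp_two_iff_integrable_sq hm]
  have h1 := (memLp_two_iff_integrable_sq hf.1).1 hf
  exact (h1.comp_sub_right t).comp_mul_left' ha

theorem integrable_scaling_mul (a : ℝ) (ha : a ≠ 0) (t s : ℝ) :
    Integrable (fun x => W.φ (a * x - t) * W.φ (x - s)) volume := by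
  have h2 := memLp_affine W.memLp_scaling one_ne_zero s
  simp only [one_mul] at h2
  exact (memLp_affine W.memLp_scaling ha t).integrable_mul h2

/-- The scaling sequences are inner products of `φ` with its dilates: both sides satisfy the same
recursion, by the refinement equation. -/
theorem lineVec_eq_integral (j : ℕ) (t s : ℤ) :
    W.lineVec j t s = (√2)⁻¹ ^ j * ∫ x : ℝ, W.φ ((2 : ℝ)⁻¹ ^ j * x - t) * W.φ (x - s) := by
  induction j generalizing t with
  | zero =>
    have h1 := integral_sub_right_eq_self (fun x : ℝ => W.φ x * W.φ (x - ((s - t : ℤ) : ℝ))) (t : ℝ)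
      (μ := volume)
    rw [W.orthonormal] at h1
    simp only [lineVec, pow_zero, one_mul]
    rw [show (if s = t then (1 : ℝ) else 0) = if s - t = 0 then 1 else 0 by
      simp only [sub_eq_zero], ← h1]
    congr 1
    funext x
    push_cast
    ring_nf
  | succ j ih =>
    have hae := (quasiMeasurePreserving_affine (a := (2 : ℝ)⁻¹ ^ (j + 1)) (by positivity) t).ae
      W.refinement
    have h1 : (∫ x : ℝ, W.φ ((2 : ℝ)⁻¹ ^ (j + 1) * x - t) * W.φ (x - s)) =
        ∫ x : ℝ, √2 * ∑ m ∈ Finset.Icc (0 : ℤ) (2 * q - 1),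
          W.h m * (W.φ ((2 : ℝ)⁻¹ ^ j * x - (2 * t + m : ℤ)) * W.φ (x - s)) := by
      refine integral_congr_ae ?_
      filter_upwards [hae] with x hx
      rw [hx, mul_assoc, Finset.sum_mul]
      congr 1
      refine Finset.sum_congr rfl fun m _ => ?_
      rw [mul_assoc]
      congr 3
      push_cast
      ring
    rw [h1, integral_const_mul, integral_finsetSum]
    · simp only [lineVec]
      have h2 : (√2)⁻¹ ^ (j + 1) * √2 = (√2)⁻¹ ^ j := by
        rw [pow_succ, mul_assoc, inv_mul_cancel₀ (by positivity), mul_one]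
      rw [← mul_assoc, h2, Finset.mul_sum]
      refine Finset.sum_congr rfl fun m _ => ?_
      rw [ih, integral_const_mul]
      ring
    · intro m _
      exact (W.integrable_scaling_mul _ (by positivity) _ _).const_mul _

theorem integrable_scaling : Integrable W.φ volume := by
  have h1 : MemLp W.φ 2 (volume.restrict (tsupport W.φ)) := W.memLp_scaling.restrict _
  have : IsFiniteMeasure (volume.restrict (tsupport W.φ)) :=
    isFiniteMeasure_restrict.2 W.compact_scaling.isCompact.measure_lt_top.ne
  have h2 : IntegrableOn W.φ (tsupport W.φ) volume := h1.integrable (by norm_num)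
  exact (integrableOn_iff_integrable_of_support_subset (subset_tsupport _)).1 h2

/-- On the line, the wavelets are inner products of `φ` with dilates of the bounded function `ψ`, so
`2^(j/2) |ψ_{j,t}|` is at most `‖ψ‖_∞ ‖φ‖_1`. -/
theorem abs_sum_mirror_lineVec_le {M : ℝ} (hM : ∀ᵐ x : ℝ, |mother q W.h W.φ x| ≤ M) (j : ℕ)
    (t s : ℤ) :
    |∑ m ∈ Finset.Icc (2 - 2 * (q : ℤ)) 1, mirror W.h m * W.lineVec j (2 * t + m) s| ≤
      (√2)⁻¹ ^ (j + 1) * (M * ∫ x, |W.φ x|) := by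
  have h1 : ∑ m ∈ Finset.Icc (2 - 2 * (q : ℤ)) 1, mirror W.h m * W.lineVec j (2 * t + m) s =
      (√2)⁻¹ ^ (j + 1) *
        ∫ x : ℝ, mother q W.h W.φ ((2 : ℝ)⁻¹ ^ (j + 1) * x - t) * W.φ (x - s) := by
    have h2 : ∀ x : ℝ, mother q W.h W.φ ((2 : ℝ)⁻¹ ^ (j + 1) * x - t) * W.φ (x - s) =
        √2 * ∑ m ∈ Finset.Icc (2 - 2 * (q : ℤ)) 1,
          mirror W.h m * (W.φ ((2 : ℝ)⁻¹ ^ j * x - (2 * t + m : ℤ)) * W.φ (x - s)) := by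
      intro x
      rw [mother, mul_assoc, Finset.sum_mul]
      congr 1
      refine Finset.sum_congr rfl fun m _ => ?_
      rw [mul_assoc]
      congr 3
      push_cast
      ring
    simp_rw [h2]
    rw [integral_const_mul, integral_finsetSum]
    · have h2 : (√2)⁻¹ ^ (j + 1) * √2 = (√2)⁻¹ ^ j := by
        rw [pow_succ, mul_assoc, inv_mul_cancel₀ (by positivity), mul_one]
      rw [← mul_assoc, h2, Finset.mul_sum]
      refine Finset.sum_congr rfl fun m _ => ?_
      rw [lineVec_eq_integral, integral_const_mul]
      ring
    · intro m _
      exact (W.integrable_scaling_mul _ (by positivity) _ _).const_mul _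
  rw [h1, abs_mul, abs_of_nonneg (by positivity)]
  refine mul_le_mul_of_nonneg_left ?_ (by positivity)
  rw [← integral_const_mul, ← integral_sub_right_eq_self (fun x => M * |W.φ x|) (s : ℝ),
    ← Real.norm_eq_abs]
  refine norm_integral_le_of_norm_le ((W.integrable_scaling.abs.const_mul M).comp_sub_right _) ?_
  have hq := quasiMeasurePreserving_affine (a := (2 : ℝ)⁻¹ ^ (j + 1)) (by positivity) t
  filter_upwards [hq.ae hM]
    with x hx
  rw [norm_mul, Real.norm_eq_abs, Real.norm_eq_abs]
  exact mul_le_mul_of_nonneg_right hx (abs_nonneg _)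

theorem bddAbove_scaledValues : BddAbove W.scaledValues := by
  obtain ⟨M, hM⟩ := W.bounded_mother
  refine ⟨(2 * q + 1) * (M * ∫ x, |W.φ x|), ?_⟩
  rintro x ⟨L, j, t, k, hj, rfl⟩
  set a : ℤ := 2 ^ (j + 1) * t + 2 ^ j * (2 - 2 * q) with ha
  set r₀ : ℤ := (a - (k : ℕ)) / 2 ^ L with hr₀
  have hq : (1 : ℤ) ≤ q := by exact_mod_cast W.one_le
  have hP : (0 : ℤ) < 2 ^ L := by positivity
  have hPj : (0 : ℤ) < 2 ^ j := by positivity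
  have hPP : (2 : ℤ) ^ (j + 1) ≤ 2 ^ L := pow_le_pow_right₀ (by norm_num) hj
  have e1 := Int.emod_add_mul_ediv (a - (k : ℕ)) (2 ^ L)
  have e2 := Int.emod_nonneg (a - (k : ℕ)) hP.ne'
  have e3 := Int.emod_lt_of_pos (a - (k : ℕ)) hP
  rw [← hr₀] at e1
  have h1 : W.waveletVec L j t k = ∑ r ∈ Finset.Icc r₀ (r₀ + 2 * q),
      ∑ m ∈ Finset.Icc (2 - 2 * (q : ℤ)) 1,
        mirror W.h m * W.lineVec j (2 * t + m) ((k : ℕ) + r * 2 ^ L) := by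
    rw [Finset.sum_comm]
    simp only [waveletVec, Finset.sum_apply, Pi.smul_apply, smul_eq_mul]
    refine Finset.sum_congr rfl fun m hm => ?_
    rw [← Finset.mul_sum, scalingVec_eq_sum_lineVec]
    intro r h1 h2
    rw [Finset.mem_Icc] at hm
    have h3 : a ≤ (k : ℕ) + r * 2 ^ L := by rw [ha, pow_succ]; nlinarith
    have h4 : ((k : ℕ) : ℤ) + r * 2 ^ L ≤ a + (2 * q - 1) * 2 ^ L := by
      have : 2 ^ j * (2 * t + m) + (2 * q - 1) * (2 ^ j - 1) ≤ a + (2 * q - 1) * 2 ^ (j + 1) := by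
        rw [ha, pow_succ]; nlinarith
      nlinarith
    refine Finset.mem_Icc.2 ⟨?_, ?_⟩
    · by_contra hc
      have h5 : r + 1 - r₀ ≤ 0 := by linarith
      nlinarith [mul_nonpos_of_nonneg_of_nonpos hP.le h5]
    · by_contra hc
      have h5 : r₀ + 2 * q + 1 - r ≤ 0 := by linarith
      nlinarith [mul_nonpos_of_nonneg_of_nonpos hP.le h5]
  have h2 : |W.waveletVec L j t k| ≤ (2 * q + 1) * ((√2)⁻¹ ^ (j + 1) * (M * ∫ x, |W.φ x|)) := by
    rw [h1]
    refine (Finset.abs_sum_le_sum_abs _ _).trans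
      ((Finset.sum_le_sum fun r _ => W.abs_sum_mirror_lineVec_le hM j t _).trans (le_of_eq ?_))
    rw [Finset.sum_const, nsmul_eq_mul, Int.card_Icc,
      show (r₀ + 2 * (q : ℤ) + 1 - r₀).toNat = 2 * q + 1 by omega]
    push_cast
    ring
  calc √2 ^ (j + 1) * |W.waveletVec L j t k|
      ≤ √2 ^ (j + 1) * ((2 * q + 1) * ((√2)⁻¹ ^ (j + 1) * (M * ∫ x, |W.φ x|))) :=
        mul_le_mul_of_nonneg_left h2 (by positivity)
    _ = (√2 * (√2)⁻¹) ^ (j + 1) * ((2 * q + 1) * (M * ∫ x, |W.φ x|)) := by rw [mul_pow]; ring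
    _ = _ := by rw [mul_inv_cancel₀ (by positivity), one_pow, one_mul]

end CompactWavelet

/-! ### The `ℓ_p` norms -/

section Norms

variable {n : ℕ}

theorem pNorm_one (v : Fin n → ℝ) : pNorm 1 v = ∑ k, |v k| := by
  rw [pNorm, PiLp.norm_eq_sum (by simp)]
  simp

theorem pNorm_eq_rpow {p : ENNReal} (hp : 0 < p.toReal) (v : Fin n → ℝ) :
    pNorm p v = (∑ k, |v k| ^ p.toReal) ^ (1 / p.toReal) := by
  rw [pNorm, PiLp.norm_eq_sum hp]; rfl

theorem pNorm_nonneg {p : ENNReal} (hp : 1 ≤ p) (v : Fin n → ℝ) : 0 ≤ pNorm p v := by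
  have : Fact (1 ≤ p) := ⟨hp⟩
  exact norm_nonneg _

theorem pNorm_pos {p : ENNReal} (hp : 1 ≤ p) {v : Fin n → ℝ} (hv : v ≠ 0) : 0 < pNorm p v := by
  have : Fact (1 ≤ p) := ⟨hp⟩
  exact norm_pos_iff.2 (by simpa using hv)

theorem abs_le_pNorm_top (v : Fin n → ℝ) (k : Fin n) : |v k| ≤ pNorm ⊤ v :=
  le_ciSup (f := fun k => |v k|) (Set.finite_range _).bddAbove k

theorem pNorm_top_le {v : Fin n → ℝ} {a : ℝ} (ha : 0 ≤ a) (h : ∀ k, |v k| ≤ a) :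
    pNorm ⊤ v ≤ a := Real.iSup_le h ha

theorem pNorm_rpow {p : ENNReal} (hp : 0 < p.toReal) (v : Fin n → ℝ) :
    pNorm p v ^ p.toReal = ∑ k, |v k| ^ p.toReal := by
  rw [pNorm_eq_rpow hp, ← Real.rpow_mul (by positivity), one_div_mul_cancel hp.ne', Real.rpow_one]

theorem holderConjugate_cases {p p' : ENNReal} (h : ENNReal.HolderConjugate p p') :
    (p = 1 ∧ p' = ⊤) ∨ (p = ⊤ ∧ p' = 1) ∨ p.toReal.HolderConjugate p'.toReal := by
  have h' := h.symm
  by_cases h1 : p = ⊤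
  · refine Or.inr (Or.inl ⟨h1, ?_⟩)
    subst h1
    exact (ENNReal.HolderConjugate.unique ⊤ 1 p' : _).symm
  by_cases h2 : p' = ⊤
  · refine Or.inl ⟨?_, h2⟩
    subst h2
    exact (ENNReal.HolderConjugate.unique ⊤ 1 p : _).symm
  exact Or.inr (Or.inr (ENNReal.HolderConjugate.toReal_of_ne_top h1 h2))

theorem abs_dotProduct_le {p p' : ENNReal} (h : ENNReal.HolderConjugate p p') (u v : Fin n → ℝ) :
    |u ⬝ᵥ v| ≤ pNorm p u * pNorm p' v := by
  have h0 : |u ⬝ᵥ v| ≤ ∑ k, |u k| * |v k| := by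
    refine (Finset.abs_sum_le_sum_abs _ _).trans (le_of_eq ?_)
    simp_rw [abs_mul]
  refine h0.trans ?_
  rcases holderConjugate_cases h with ⟨rfl, rfl⟩ | ⟨rfl, rfl⟩ | hr
  · rw [pNorm_one, Finset.sum_mul]
    exact Finset.sum_le_sum fun k _ =>
      mul_le_mul_of_nonneg_left (abs_le_pNorm_top v k) (abs_nonneg _)
  · rw [pNorm_one, Finset.mul_sum]
    exact Finset.sum_le_sum fun k _ =>
      mul_le_mul_of_nonneg_right (abs_le_pNorm_top u k) (abs_nonneg _)
  · rw [pNorm_eq_rpow hr.pos, pNorm_eq_rpow hr.symm.pos]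
    exact Real.inner_le_Lp_mul_Lq_of_nonneg _ hr (fun _ _ => abs_nonneg _) fun _ _ => abs_nonneg _

/-- Log-convexity of the `ℓ_p` norms between `ℓ_1` and `ℓ_∞`. -/
theorem pNorm_le_interpolate {p : ENNReal} (hp : 1 ≤ p.toReal) (v : Fin n → ℝ) :
    pNorm p v ≤ pNorm ⊤ v ^ (1 - 1 / p.toReal) * pNorm 1 v ^ (1 / p.toReal) := by
  set P := p.toReal
  have hP : 0 < P := by linarith
  have hM : 0 ≤ pNorm ⊤ v := pNorm_nonneg le_top v
  have hS : 0 ≤ pNorm 1 v := pNorm_nonneg le_rfl v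
  rw [pNorm_eq_rpow hP]
  have h1 : ∑ k, |v k| ^ P ≤ pNorm ⊤ v ^ (P - 1) * pNorm 1 v := by
    rw [pNorm_one, Finset.mul_sum]
    refine Finset.sum_le_sum fun k _ => ?_
    have h2 : |v k| ^ P = |v k| ^ (P - 1) * |v k| := by
      rcases (abs_nonneg (v k)).eq_or_lt with h | h
      · rw [← h, Real.zero_rpow hP.ne', mul_zero]
      · rw [Real.rpow_sub_one h.ne', div_mul_cancel₀ _ h.ne']
    rw [h2]
    exact mul_le_mul_of_nonneg_right
      (Real.rpow_le_rpow (abs_nonneg _) (abs_le_pNorm_top v k) (by linarith)) (abs_nonneg _)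
  refine (Real.rpow_le_rpow (by positivity) h1 (by positivity)).trans (le_of_eq ?_)
  rw [Real.mul_rpow (by positivity) hS, ← Real.rpow_mul hM]
  congr 2
  rw [sub_mul, one_mul, mul_one_div_cancel hP.ne']

theorem pNorm_mul_pNorm_le {p p' : ENNReal} (h : ENNReal.HolderConjugate p p') (v : Fin n → ℝ) :
    pNorm p v * pNorm p' v ≤ pNorm 1 v * pNorm ⊤ v := by
  have hM : 0 ≤ pNorm ⊤ v := pNorm_nonneg le_top v
  have hS : 0 ≤ pNorm 1 v := pNorm_nonneg le_rfl v
  rcases holderConjugate_cases h with ⟨rfl, rfl⟩ | ⟨rfl, rfl⟩ | hr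
  · rfl
  · rw [mul_comm]
  · have h1 := hr.inv_add_inv_eq_one
    have e1 : 1 - 1 / p.toReal = 1 / p'.toReal := by rw [one_div, one_div]; linarith
    have e2 : 1 - 1 / p'.toReal = 1 / p.toReal := by rw [one_div, one_div]; linarith
    have a1 := pNorm_le_interpolate hr.lt.le v
    have a2 := pNorm_le_interpolate hr.symm.lt.le v
    rw [e1] at a1
    rw [e2] at a2
    refine (mul_le_mul a1 a2 (pNorm_nonneg h.symm.one_le v) (by positivity)).trans (le_of_eq ?_)
    have b1 : pNorm ⊤ v ^ (1 / p'.toReal) * pNorm ⊤ v ^ (1 / p.toReal) = pNorm ⊤ v := by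
      rw [← Real.rpow_add_of_nonneg hM (by have := hr.symm.pos; positivity)
        (by have := hr.pos; positivity), one_div, one_div, add_comm, h1, Real.rpow_one]
    have b2 : pNorm 1 v ^ (1 / p.toReal) * pNorm 1 v ^ (1 / p'.toReal) = pNorm 1 v := by
      rw [← Real.rpow_add_of_nonneg hS (by have := hr.pos; positivity)
        (by have := hr.symm.pos; positivity), one_div, one_div, h1, Real.rpow_one]
    calc _ = (pNorm ⊤ v ^ (1 / p'.toReal) * pNorm ⊤ v ^ (1 / p.toReal)) *
          (pNorm 1 v ^ (1 / p.toReal) * pNorm 1 v ^ (1 / p'.toReal)) := by ring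
      _ = _ := by rw [b1, b2, mul_comm]

end Norms

/-! ### Greedy selection for an orthonormal basis with bounded overlap -/

section Greedy

variable {ι : Type*} [Fintype ι] {n : ℕ}

/-- The non-selected indices carry no more mass than the complement of any other set that is not
larger than the selected one. -/
theorem sum_compl_le_sum_compl [DecidableEq ι] {b : ι → ℝ} (hb : ∀ i, 0 ≤ b i) {S T : Finset ι}
    (hS : ∀ i ∈ S, ∀ k ∉ S, b k ≤ b i) (hT : T.card ≤ S.card) :
    ∑ i ∈ Sᶜ, b i ≤ ∑ i ∈ Tᶜ, b i := by
  have h1 : ∑ i ∈ T \ S, b i ≤ ∑ i ∈ S \ T, b i := by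
    have hc : (T \ S).card ≤ (S \ T).card := by
      have e1 := Finset.card_sdiff_add_card_inter T S
      have e2 := Finset.card_sdiff_add_card_inter S T
      rw [Finset.inter_comm] at e2
      omega
    rcases (S \ T).eq_empty_or_nonempty with he | hne
    · rw [he] at hc ⊢
      rw [Finset.card_empty, Nat.le_zero, Finset.card_eq_zero] at hc
      rw [hc]
    · obtain ⟨i₀, hi₀, hmin⟩ := Finset.exists_min_image (S \ T) b hne
      calc ∑ i ∈ T \ S, b i ≤ (T \ S).card • b i₀ := Finset.sum_le_card_nsmul _ _ _ fun k hk =>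
            hS i₀ (Finset.mem_sdiff.1 hi₀).1 k (Finset.mem_sdiff.1 hk).2
        _ ≤ (S \ T).card • b i₀ := nsmul_le_nsmul_left (hb _) hc
        _ ≤ _ := Finset.card_nsmul_le_sum _ _ _ hmin
  have e1 : ∑ i ∈ S, b i = ∑ i ∈ S \ T, b i + ∑ i ∈ S ∩ T, b i := by
    rw [← Finset.sum_inter_add_sum_sdiff S T b, add_comm]
  have e2 : ∑ i ∈ T, b i = ∑ i ∈ T \ S, b i + ∑ i ∈ S ∩ T, b i := by
    rw [← Finset.sum_inter_add_sum_sdiff T S b, add_comm, Finset.inter_comm]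
  have e3 := Finset.sum_add_sum_compl S b
  have e4 := Finset.sum_add_sum_compl T b
  linarith

variable {v : ι → Fin n → ℝ} {N : ℕ} {D : ℝ}

/-- Analysis operator bound: with at most `N` basis vectors overlapping at each point, the
normalized inner products with a vector have `ℓ_p` norm at most `N^(1/p)` times its norm. -/
theorem sum_abs_dotProduct_div_rpow_le {p p' : ENNReal} (h : ENNReal.HolderConjugate p p')
    (hp : p ≠ ⊤) (hv : ∀ i, v i ≠ 0)
    (hN : ∀ k, ({i | v i k ≠ 0} : Finset ι).card ≤ N) (u : Fin n → ℝ) :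
    ∑ i, (|u ⬝ᵥ v i| / pNorm p' (v i)) ^ p.toReal ≤ N * pNorm p u ^ p.toReal := by
  have hP : 0 < p.toReal := ENNReal.toReal_pos (zero_lt_one.trans_le h.one_le).ne' hp
  rw [pNorm_rpow hP, Finset.mul_sum]
  have h1 : ∀ i, (|u ⬝ᵥ v i| / pNorm p' (v i)) ^ p.toReal ≤
      ∑ k, if v i k ≠ 0 then |u k| ^ p.toReal else 0 := by
    intro i
    have hpos := pNorm_pos h.symm.one_le (hv i)
    set u' : Fin n → ℝ := fun k => if v i k ≠ 0 then u k else 0 with hu'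
    have e1 : u ⬝ᵥ v i = u' ⬝ᵥ v i := by
      refine Finset.sum_congr rfl fun k _ => ?_
      simp only [hu']
      split_ifs with hk
      · rfl
      · rw [not_not.1 hk, mul_zero, mul_zero]
    have e2 := abs_dotProduct_le h u' (v i)
    rw [← e1] at e2
    refine (Real.rpow_le_rpow (by positivity) ((div_le_iff₀ hpos).2 e2) hP.le).trans ?_
    rw [pNorm_rpow hP]
    refine Finset.sum_le_sum fun k _ => ?_
    simp only [hu']
    split_ifs
    · rfl
    · rw [abs_zero, Real.zero_rpow hP.ne']
  refine (Finset.sum_le_sum fun i _ => h1 i).trans ?_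
  rw [Finset.sum_comm]
  refine Finset.sum_le_sum fun k _ => ?_
  rw [← Finset.sum_filter, Finset.sum_const, nsmul_eq_mul]
  exact mul_le_mul_of_nonneg_right (by exact_mod_cast hN k) (by positivity)

/-- Synthesis operator bound, dual to `sum_abs_dotProduct_div_rpow_le`. -/
theorem pNorm_sum_smul_rpow_le {p : ENNReal} (hP : 1 ≤ p.toReal)
    (hN : ∀ k, ({i | v i k ≠ 0} : Finset ι).card ≤ N) (T : Finset ι) (c : ι → ℝ) :
    pNorm p (∑ i ∈ T, c i • v i) ^ p.toReal ≤
      (N : ℝ) ^ (p.toReal - 1) * ∑ i ∈ T, (|c i| * pNorm p (v i)) ^ p.toReal := by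
  have hP0 : 0 < p.toReal := by linarith
  rw [pNorm_rpow hP0]
  have h1 : ∀ k, |(∑ i ∈ T, c i • v i) k| ^ p.toReal ≤
      (N : ℝ) ^ (p.toReal - 1) * ∑ i ∈ T, |c i * v i k| ^ p.toReal := by
    intro k
    simp only [Finset.sum_apply, Pi.smul_apply, smul_eq_mul]
    have e1 : ∑ i ∈ T, c i * v i k = ∑ i ∈ T with v i k ≠ 0, c i * v i k := by
      rw [Finset.sum_filter]
      refine Finset.sum_congr rfl fun i _ => ?_
      split_ifs with hk
      · rfl
      · rw [not_not.1 hk, mul_zero]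
    rw [e1]
    calc |∑ i ∈ T with v i k ≠ 0, c i * v i k| ^ p.toReal
        ≤ (∑ i ∈ T with v i k ≠ 0, |c i * v i k|) ^ p.toReal :=
          Real.rpow_le_rpow (abs_nonneg _) (Finset.abs_sum_le_sum_abs _ _) hP0.le
      _ ≤ ((T.filter fun i => v i k ≠ 0).card : ℝ) ^ (p.toReal - 1) *
            ∑ i ∈ T with v i k ≠ 0, |c i * v i k| ^ p.toReal :=
          Real.rpow_sum_le_const_mul_sum_rpow _ _ hP
      _ ≤ _ := by
          refine mul_le_mul (Real.rpow_le_rpow (by positivity) ?_ (by linarith))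
            (Finset.sum_le_sum_of_subset_of_nonneg (Finset.filter_subset _ _)
              fun _ _ _ => by positivity) (by positivity) (by positivity)
          have := (Finset.card_le_card (Finset.filter_subset_filter (fun i => v i k ≠ 0)
            (Finset.subset_univ T))).trans (hN k)
          exact_mod_cast this
  refine (Finset.sum_le_sum fun k _ => h1 k).trans (le_of_eq ?_)
  rw [← Finset.mul_sum, Finset.sum_comm]
  congr 1
  refine Finset.sum_congr rfl fun i _ => ?_
  rw [Real.mul_rpow (abs_nonneg _) (by rw [pNorm_eq_rpow hP0]; positivity), pNorm_rpow hP0,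
    Finset.mul_sum]
  refine Finset.sum_congr rfl fun k _ => ?_
  rw [abs_mul, Real.mul_rpow (abs_nonneg _) (abs_nonneg _)]

/-- The error of the greedy selection is at most `N D` times the error of any representation `z`
with no more terms, for a basis with overlap `N` and `‖v_i‖₁ ‖v_i‖_∞ ≤ D`. -/
theorem pNorm_sum_compl_le [DecidableEq ι] {p p' : ENNReal}
    (h : ENNReal.HolderConjugate p p') (hv : ∀ i, v i ≠ 0)
    (hN : ∀ k, ({i | v i k ≠ 0} : Finset ι).card ≤ N)
    (hD : ∀ i, pNorm 1 (v i) * pNorm ⊤ (v i) ≤ D) (hD0 : 0 ≤ D) {c : ι → ℝ} {u : Fin n → ℝ}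
    {S T : Finset ι}
    (hS : ∀ i ∈ S, ∀ k ∉ S, |c k| / pNorm p' (v k) ≤ |c i| / pNorm p' (v i))
    (hT : T.card ≤ S.card) (hu : ∀ i ∉ T, c i = u ⬝ᵥ v i) :
    pNorm p (∑ i ∈ Sᶜ, c i • v i) ≤ N * D * pNorm p u := by
  set a : ι → ℝ := fun i => |c i| / pNorm p' (v i) with ha
  have hpos : ∀ i, 0 < pNorm p' (v i) := fun i => pNorm_pos h.symm.one_le (hv i)
  have ha0 : ∀ i, 0 ≤ a i := fun i => div_nonneg (abs_nonneg _) (hpos i).le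
  have hu0 := pNorm_nonneg h.one_le u
  have hca : ∀ i, |c i| * pNorm p (v i) ≤ a i * D := by
    intro i
    have e : |c i| = a i * pNorm p' (v i) := (div_mul_cancel₀ _ (hpos i).ne').symm
    rw [e, mul_assoc, mul_comm (pNorm p' _)]
    exact mul_le_mul_of_nonneg_left ((pNorm_mul_pNorm_le h _).trans (hD i)) (ha0 i)
  have haT : ∀ i ∉ T, a i ≤ pNorm p u := by
    intro i hi
    rw [ha]
    simp only
    rw [hu i hi, div_le_iff₀ (hpos i)]
    exact abs_dotProduct_le h u (v i)
  by_cases hp : p = ⊤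
  · have haS : ∀ i ∉ S, a i ≤ pNorm p u := by
      intro i hi
      by_cases hiT : i ∈ T
      · -- the selected set is at least as large as `T ∋ i`, so it has a member outside `T`
        have hex : ∃ k ∈ S, k ∉ T := by
          by_contra! hc
          exact hi (Finset.eq_of_subset_of_card_le hc hT ▸ hiT)
        obtain ⟨k, hkS, hkT⟩ := hex
        exact (hS k hkS i hi).trans (haT k hkT)
      · exact haT i hiT
    subst hp
    refine pNorm_top_le (by positivity) fun k => ?_
    simp only [Finset.sum_apply, Pi.smul_apply, smul_eq_mul]
    have e1 : ∑ i ∈ Sᶜ, c i * v i k = ∑ i ∈ Sᶜ with v i k ≠ 0, c i * v i k := by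
      rw [Finset.sum_filter]
      refine Finset.sum_congr rfl fun i _ => ?_
      split_ifs with hk
      · rfl
      · rw [not_not.1 hk, mul_zero]
    rw [e1]
    calc |∑ i ∈ Sᶜ with v i k ≠ 0, c i * v i k|
        ≤ ∑ i ∈ Sᶜ with v i k ≠ 0, |c i * v i k| := Finset.abs_sum_le_sum_abs _ _
      _ ≤ ∑ i ∈ Sᶜ with v i k ≠ 0, pNorm ⊤ u * D := by
          refine Finset.sum_le_sum fun i hi => ?_
          rw [abs_mul]
          refine (mul_le_mul_of_nonneg_left (abs_le_pNorm_top _ k) (abs_nonneg _)).trans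
            ((hca i).trans (mul_le_mul_of_nonneg_right (haS i ?_) hD0))
          exact Finset.mem_compl.1 (Finset.mem_filter.1 hi).1
      _ = ((Sᶜ.filter fun i => v i k ≠ 0).card : ℝ) * (pNorm ⊤ u * D) := by
          rw [Finset.sum_const, nsmul_eq_mul]
      _ ≤ N * (pNorm ⊤ u * D) := by
          refine mul_le_mul_of_nonneg_right ?_ (by positivity)
          have := (Finset.card_le_card (Finset.filter_subset_filter (fun i => v i k ≠ 0)
            (Finset.subset_univ Sᶜ))).trans (hN k)
          exact_mod_cast this
      _ = _ := by ring
  · have hP : 1 ≤ p.toReal := by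
      have := ENNReal.toReal_mono hp h.one_le
      simpa using this
    have hP0 : 0 < p.toReal := by linarith
    have hsum : ∑ i ∈ Sᶜ, a i ^ p.toReal ≤ N * pNorm p u ^ p.toReal := by
      calc ∑ i ∈ Sᶜ, a i ^ p.toReal ≤ ∑ i ∈ Tᶜ, a i ^ p.toReal :=
            sum_compl_le_sum_compl (fun i => Real.rpow_nonneg (ha0 i) _)
              (fun i hi k hk => Real.rpow_le_rpow (ha0 k) (hS i hi k hk) hP0.le) hT
        _ = ∑ i ∈ Tᶜ, (|u ⬝ᵥ v i| / pNorm p' (v i)) ^ p.toReal := by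
            refine Finset.sum_congr rfl fun i hi => ?_
            simp only [ha]
            rw [hu i (Finset.mem_compl.1 hi)]
        _ ≤ ∑ i, (|u ⬝ᵥ v i| / pNorm p' (v i)) ^ p.toReal :=
            Finset.sum_le_sum_of_subset_of_nonneg (Finset.subset_univ _) fun i _ _ =>
              Real.rpow_nonneg (div_nonneg (abs_nonneg _) (hpos i).le) _
        _ ≤ _ := sum_abs_dotProduct_div_rpow_le h hp hv hN u
    have hmain : pNorm p (∑ i ∈ Sᶜ, c i • v i) ^ p.toReal ≤ (N * D * pNorm p u) ^ p.toReal := by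
      calc pNorm p (∑ i ∈ Sᶜ, c i • v i) ^ p.toReal
          ≤ (N : ℝ) ^ (p.toReal - 1) * ∑ i ∈ Sᶜ, (|c i| * pNorm p (v i)) ^ p.toReal :=
            pNorm_sum_smul_rpow_le hP hN _ _
        _ ≤ (N : ℝ) ^ (p.toReal - 1) * ∑ i ∈ Sᶜ, a i ^ p.toReal * D ^ p.toReal := by
            refine mul_le_mul_of_nonneg_left (Finset.sum_le_sum fun i _ => ?_) (by positivity)
            rw [← Real.mul_rpow (ha0 i) hD0]
            exact Real.rpow_le_rpow
              (mul_nonneg (abs_nonneg _) (pNorm_nonneg h.one_le _)) (hca i) hP0.le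
        _ ≤ (N : ℝ) ^ (p.toReal - 1) * (N * pNorm p u ^ p.toReal * D ^ p.toReal) := by
            rw [← Finset.sum_mul]
            gcongr
        _ = ((N : ℝ) ^ (p.toReal - 1) * N) * D ^ p.toReal * pNorm p u ^ p.toReal := by ring
        _ = _ := by
            have : (N : ℝ) ^ (p.toReal - 1) * N = (N : ℝ) ^ p.toReal := by
              rcases (Nat.cast_nonneg (α := ℝ) N).eq_or_lt with hN0 | hN0
              · rw [← hN0, Real.zero_rpow hP0.ne', mul_zero]
              · rw [Real.rpow_sub_one hN0.ne', div_mul_cancel₀ _ hN0.ne']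
            rw [this, Real.mul_rpow (by positivity) hu0, Real.mul_rpow (by positivity) hD0]
    exact (Real.rpow_le_rpow_iff (pNorm_nonneg h.one_le _) (by positivity) hP0).1 hmain

end Greedy

/-! ### The approximation ratio of the wavelet basis -/

theorem card_filter_idx_le {L M : ℕ} (P : Idx L → Prop) [DecidablePred P]
    (h : ∀ j : Fin L, ({t | P (some ⟨j, t⟩)} : Finset (Fin (2 ^ (L - 1 - (j : ℕ))))).card ≤ M) :
    ({i | P i} : Finset (Idx L)).card ≤ L * M + 1 := by
  rw [Finset.card_filter, Fintype.sum_option, Fintype.sum_sigma, add_comm]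
  refine add_le_add ?_ (by split_ifs <;> simp)
  calc _ ≤ ∑ _j : Fin L, M := Finset.sum_le_sum fun j _ => by
          rw [← Finset.card_filter]; exact h j
    _ = L * M := by simp

variable {q : ℕ}

namespace CompactWavelet

variable (W : CompactWavelet q)

/-- The arc on which a basis vector of positive scale is supported. -/
def idxArc (q L : ℕ) (j : Fin L) (t : Fin (2 ^ (L - 1 - (j : ℕ)))) : Finset (Fin (2 ^ L)) :=
  arc q L (j + 1) (2 ^ ((j : ℕ) + 1) * ((t : ℕ) : ℤ) + 2 ^ (j : ℕ) * (2 - 2 * q))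

theorem mem_idxArc {L : ℕ} {j : Fin L} {t : Fin (2 ^ (L - 1 - (j : ℕ)))} {k : Fin (2 ^ L)}
    (h : W.basis L (some ⟨j, t⟩) k ≠ 0) : k ∈ idxArc q L j t :=
  W.mem_arc_of_waveletVec_ne_zero h

theorem card_idxArc_overlap_le (hq : 1 ≤ q) {L : ℕ} (j : Fin L) (k : Fin (2 ^ L)) :
    ({t | k ∈ idxArc q L j t} : Finset (Fin (2 ^ (L - 1 - (j : ℕ))))).card ≤ 2 * q := by
  have h := card_overlap_le hq (show (j : ℕ) + 1 ≤ L by omega) (2 ^ (j : ℕ) * (2 - 2 * q : ℤ)) k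
  have e : L - ((j : ℕ) + 1) = L - 1 - (j : ℕ) := by omega
  rw [e] at h
  exact h

theorem card_basis_ne_zero_le {L : ℕ} (k : Fin (2 ^ L)) :
    ({i | W.basis L i k ≠ 0} : Finset (Idx L)).card ≤ 2 * q * L + 1 := by
  rw [mul_comm (2 * q)]
  refine card_filter_idx_le _ fun j => ?_
  refine (Finset.card_le_card fun t ht => ?_).trans (card_idxArc_overlap_le W.one_le j k)
  simp only [Finset.mem_filter, Finset.mem_univ, true_and] at ht ⊢
  exact W.mem_idxArc ht

theorem basis_ne_zero {L : ℕ} (i : Idx L) : W.basis L i ≠ 0 := by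
  intro h
  have := W.basis_dotProduct i i
  rw [h, zero_dotProduct, if_pos rfl] at this
  exact zero_ne_one this

theorem supConst_nonneg : 0 ≤ W.supConst := by
  refine Real.sSup_nonneg ?_
  rintro x ⟨L, j, t, k, -, rfl⟩
  positivity

/-- The maximum is bounded by the definition of `K`, and the sum by the Cauchy-Schwarz inequality on
the support of the unit vector `ψ_{j,t}`. -/
theorem pNorm_one_mul_pNorm_top_wavelet_le {L j : ℕ} (hj : j < L) (t : ℤ) :
    pNorm 1 (W.waveletVec L j t) * pNorm ⊤ (W.waveletVec L j t) ≤ √(2 * q) * W.supConst := by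
  set v := W.waveletVec L j t with hv
  have h2 : (0 : ℝ) < √2 ^ (j + 1) := by positivity
  have htop : pNorm ⊤ v ≤ W.supConst / √2 ^ (j + 1) := by
    refine pNorm_top_le (div_nonneg W.supConst_nonneg h2.le) fun k => ?_
    rw [le_div_iff₀ h2, mul_comm]
    exact le_csSup W.bddAbove_scaledValues ⟨L, j, t, k, hj, rfl⟩
  have hone : pNorm 1 v ≤ √(2 * q) * √2 ^ (j + 1) := by
    have h0 : 0 ≤ pNorm 1 v := pNorm_nonneg le_rfl v
    refine abs_le_of_sq_le_sq' ?_ (by positivity) |>.2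
    have e1 : pNorm 1 v = ∑ k ∈ arc q L (j + 1) (2 ^ (j + 1) * t + 2 ^ j * (2 - 2 * q)), |v k| := by
      rw [pNorm_one]
      symm
      refine Finset.sum_subset (Finset.subset_univ _) fun k _ hk => ?_
      by_contra hc
      exact hk (W.mem_arc_of_waveletVec_ne_zero (abs_ne_zero.1 hc))
    have e2 : ∑ k, |v k| ^ 2 = 1 := by
      have := W.waveletVec_dotProduct hj t t
      rw [sub_self, if_pos (dvd_zero _)] at this
      rw [← this]
      refine Finset.sum_congr rfl fun k _ => ?_
      rw [sq_abs, pow_two]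
    rw [mul_pow, Real.sq_sqrt (by positivity), ← pow_mul, mul_comm (j + 1), pow_mul,
      Real.sq_sqrt (by norm_num), e1]
    calc _ ≤ (_ : ℝ) * ∑ k ∈ arc q L (j + 1) (2 ^ (j + 1) * t + 2 ^ j * (2 - 2 * q)), |v k| ^ 2 :=
          sq_sum_le_card_mul_sum_sq
      _ ≤ (2 * q * 2 ^ (j + 1)) * 1 := by
          refine mul_le_mul (by exact_mod_cast card_arc_le W.one_le _) ?_ (by positivity)
            (by positivity)
          rw [← e2]
          exact Finset.sum_le_sum_of_subset_of_nonneg (Finset.subset_univ _)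
            fun _ _ _ => by positivity
      _ = _ := mul_one _
  calc pNorm 1 v * pNorm ⊤ v ≤ (√(2 * q) * √2 ^ (j + 1)) * (W.supConst / √2 ^ (j + 1)) :=
        mul_le_mul hone htop (pNorm_nonneg le_top v) (by positivity)
    _ = _ := by field_simp

theorem pNorm_one_mul_pNorm_top_basis_le {L : ℕ} (hL : 1 ≤ L) (i : Idx L) :
    pNorm 1 (W.basis L i) * pNorm ⊤ (W.basis L i) ≤ √(2 * q) * W.supConst := by
  match i with
  | some ⟨j, t⟩ => exact W.pNorm_one_mul_pNorm_top_wavelet_le j.2 _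
  | none =>
    -- the coarsest vector is constant, and any unit vector has `1 = ‖v‖₂² ≤ ‖v‖₁ ‖v‖_∞`
    refine le_trans ?_ (W.pNorm_one_mul_pNorm_top_wavelet_le (show 0 < L by omega) 0)
    have e1 : (1 : ℝ) ≤ pNorm 1 (W.waveletVec L 0 0) * pNorm ⊤ (W.waveletVec L 0 0) := by
      have h1 := W.waveletVec_dotProduct (show 0 < L by omega) 0 0
      rw [sub_self, if_pos (dvd_zero _)] at h1
      have h2 := abs_dotProduct_le ENNReal.HolderConjugate.one_top (W.waveletVec L 0 0)
        (W.waveletVec L 0 0)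
      rwa [h1, abs_one] at h2
    refine le_trans ?_ e1
    have e2 : pNorm 1 (W.basis L none) = 2 ^ L * (√2)⁻¹ ^ L := by
      rw [pNorm_one]
      simp only [basis, scalingVec_top]
      rw [Finset.sum_const, Finset.card_univ, Fintype.card_fin, nsmul_eq_mul,
        abs_of_nonneg (by positivity)]
      push_cast
      ring
    have e3 : pNorm ⊤ (W.basis L none) ≤ (√2)⁻¹ ^ L := by
      refine pNorm_top_le (by positivity) fun k => ?_
      simp only [basis, scalingVec_top]
      rw [abs_of_nonneg (by positivity)]
    calc _ ≤ 2 ^ L * (√2)⁻¹ ^ L * (√2)⁻¹ ^ L := by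
          rw [e2]; exact mul_le_mul_of_nonneg_left e3 (by positivity)
      _ = (2 * ((√2)⁻¹ * (√2)⁻¹)) ^ L := by rw [mul_pow, mul_pow]; ring
      _ ≤ 1 := by
          rw [← mul_inv, Real.mul_self_sqrt (by norm_num)]; norm_num

/-- The factor is the product of the overlap `2qL + 1` and of the bound on `‖ψ_i‖_1 ‖ψ_i‖_∞`. -/
theorem greedy_approximation {L : ℕ} (hL : 1 ≤ L) {p p' : ENNReal}
    (h : ENNReal.HolderConjugate p p') {B : ℕ} {f : Fin (2 ^ L) → ℝ} {S : Finset (Idx L)}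
    (hS : IsGreedySelection W p' B f S) {z : Idx L → ℝ}
    (hz : (Finset.univ.filter fun i => z i ≠ 0).card ≤ B) :
    pNorm p (f - ∑ i ∈ S, W.coeff f i • W.basis L i) ≤
      5 * W.supConst * (q : ℝ) ^ (3 / 2 : ℝ) * (L : ℝ) *
        pNorm p (f - ∑ i, z i • W.basis L i) := by
  set u := f - ∑ i, z i • W.basis L i with hu
  set E := pNorm p u
  have hE : 0 ≤ E := pNorm_nonneg h.one_le _
  have hK := W.supConst_nonneg
  have e1 : f - ∑ i ∈ S, W.coeff f i • W.basis L i = ∑ i ∈ Sᶜ, W.coeff f i • W.basis L i := by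
    have h1 := W.sum_coeff_smul_basis f
    rw [← Finset.sum_add_sum_compl S] at h1
    exact sub_eq_of_eq_add' h1.symm
  have hcard : (Finset.univ.filter fun i => z i ≠ 0).card ≤ S.card := by
    rw [hS.1]
    refine le_min hz ((Finset.card_le_univ _).trans (card_idx L).le)
  rw [e1]
  refine (pNorm_sum_compl_le (T := Finset.univ.filter fun i => z i ≠ 0) (u := u) h
    (fun i => W.basis_ne_zero i) W.card_basis_ne_zero_le (W.pNorm_one_mul_pNorm_top_basis_le hL)
    (by positivity) hS.2 hcard ?_).trans ?_
  · intro i hi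
    have hzi : z i = 0 := by simpa using hi
    have h1 := W.coeff_sum_smul z i
    rw [hzi, coeff] at h1
    rw [hu, sub_dotProduct, h1, sub_zero, coeff]
  · refine mul_le_mul_of_nonneg_right ?_ hE
    have hq : (1 : ℝ) ≤ q := by exact_mod_cast W.one_le
    have hL' : (1 : ℝ) ≤ L := by exact_mod_cast hL
    have e2 : (q : ℝ) ^ (3 / 2 : ℝ) = q * √q := by
      rw [Real.sqrt_eq_rpow, ← Real.rpow_one_add' (by linarith) (by norm_num)]
      norm_num
    have e3 : √(2 * q) ≤ 3 / 2 * √(q : ℝ) := by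
      rw [Real.sqrt_mul (by norm_num)]
      refine mul_le_mul_of_nonneg_right ?_ (Real.sqrt_nonneg _)
      rw [Real.sqrt_le_left (by norm_num)]; norm_num
    have e4 : ((2 * q * L + 1 : ℕ) : ℝ) ≤ 3 * (q * L) := by
      push_cast
      nlinarith
    calc ((2 * q * L + 1 : ℕ) : ℝ) * (√(2 * q) * W.supConst)
        ≤ 3 * (q * L) * (3 / 2 * √(q : ℝ) * W.supConst) := by gcongr
      _ = 9 / 2 * (W.supConst * (q * √q) * L) := by ring
      _ ≤ 5 * (W.supConst * (q * √q) * L) :=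
          mul_le_mul_of_nonneg_right (by norm_num) (by positivity)
      _ = _ := by rw [e2]; ring

end CompactWavelet

/-! ### Basis vectors as sums over paths of the cascade -/

/-- Splitting off the last digit in base `Q`. -/
theorem sum_range_mul_eq (F : ℕ → ℕ → ℝ) (Q M : ℕ) :
    ∑ x ∈ Finset.range (Q * M), F (x % Q) (x / Q) =
      ∑ d ∈ Finset.range Q, ∑ y ∈ Finset.range M, F d y := by
  induction M with
  | zero => simp
  | succ M ih =>
    rw [mul_add_one, Finset.sum_range_add, ih]
    simp_rw [Finset.sum_range_succ]
    rw [Finset.sum_add_distrib]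
    congr 1
    refine Finset.sum_congr rfl fun d hd => ?_
    have hd' := Finset.mem_range.1 hd
    rw [Nat.mul_add_mod, Nat.mod_eq_of_lt hd', Nat.mul_add_div (by omega),
      Nat.div_eq_of_lt hd', add_zero]

theorem sum_Icc_eq_sum_range (q : ℕ) (a b : ℤ) (hab : b = a + 2 * q - 1) (F : ℤ → ℝ) :
    ∑ m ∈ Finset.Icc a b, F m = ∑ d ∈ Finset.range (2 * q), F (a + d) := by
  refine Finset.sum_nbij' (fun m => (m - a).toNat) (fun d => a + (d : ℤ)) ?_ ?_ ?_ ?_ ?_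
  · intro m hm; rw [Finset.mem_Icc] at hm; rw [Finset.mem_range]; omega
  · intro d hd; rw [Finset.mem_range] at hd; rw [Finset.mem_Icc]; omega
  · intro m hm; rw [Finset.mem_Icc] at hm; omega
  · intro d _; omega
  · intro m hm
    rw [Finset.mem_Icc] at hm
    congr 1
    omega

namespace CompactWavelet

variable {q : ℕ} (W : CompactWavelet q)

/-- One step down the cascade along a path: `(y, s, a)` are the remaining digits (base `2q`) of the
path, the current position modulo `n` and the product of the taps met so far. -/
def pathStep (n : ℕ) (s : ℕ × ℕ × ℝ) : ℕ × ℕ × ℝ :=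
  (s.1 / (2 * q), (2 * s.2.1 + s.1 % (2 * q)) % n, s.2.2 * W.h ((s.1 % (2 * q) : ℕ) : ℤ))

/-- The product of taps along a path, if the path ends at `κ`. -/
def pathValue (κ : ℕ) (s : ℕ × ℕ × ℝ) : ℝ := if s.2.1 = κ then s.2.2 else 0

/-- Summing over the `j` remaining digits unfolds the recursion of the cascade. -/
theorem sum_pathStep {L : ℕ} (κ : Fin (2 ^ L)) (j : ℕ) (hj : j ≤ L) (pos : ℕ) (hpos : pos < 2 ^ L)
    (wt : ℝ) :
    ∑ y ∈ Finset.range ((2 * q) ^ j), pathValue κ ((W.pathStep (2 ^ L))^[j] (y, pos, wt)) =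
      wt * W.scalingVec L j pos κ := by
  induction j generalizing pos wt with
  | zero =>
    simp only [pow_zero, Finset.range_one, Function.iterate_zero, id, Finset.sum_singleton,
      pathValue, scalingVec, mul_ite, mul_one, mul_zero]
    refine if_congr ?_ rfl rfl
    rw [Int.emod_eq_of_lt (by positivity) (by exact_mod_cast hpos)]
    norm_cast
    exact eq_comm
  | succ j ih =>
    simp only [Function.iterate_succ_apply]
    rw [pow_succ']
    refine (sum_range_mul_eq (fun d y => pathValue κ
      ((W.pathStep (2 ^ L))^[j] (y, (2 * pos + d) % 2 ^ L, wt * W.h (d : ℕ)))) _ _).trans ?_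
    simp only [scalingVec, Finset.sum_apply, Pi.smul_apply, smul_eq_mul]
    rw [sum_Icc_eq_sum_range q 0 _ (by ring), Finset.mul_sum]
    refine Finset.sum_congr rfl fun d _ => ?_
    rw [ih (by omega) _ (Nat.mod_lt _ (by positivity))]
    have e : W.scalingVec L j (((2 * pos + d) % 2 ^ L : ℕ) : ℤ) =
        W.scalingVec L j (2 * pos + (0 + d : ℤ)) := by
      refine W.scalingVec_congr (by omega) ?_
      push_cast
      rw [zero_add]
      exact (Int.mod_modEq _ _).of_dvd (pow_dvd_pow 2 (by omega))
    rw [e, zero_add, mul_assoc]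

/-- The start of a path below `ψ_{j+1,t}`: the first tap is one of the mirror filter. The positions
are shifted by `2qn` in order to stay non-negative. -/
def pathInit (n t x : ℕ) : ℕ × ℕ × ℝ :=
  (x / (2 * q), (2 * t + x % (2 * q) + 2 + 2 * q * n - 2 * q) % n,
    1 * mirror W.h (2 - 2 * q + ((x % (2 * q) : ℕ) : ℤ)))

/-- The contribution of the path with digits `x` to the entry `κ` of `ψ_{j+1,t}`. -/
def pathTerm (n j t κ x : ℕ) : ℝ :=
  pathValue κ ((W.pathStep n)^[j] (W.pathInit n t x))

/-- A wavelet entry is the sum of the contributions of all paths. -/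
theorem sum_pathTerm {L j : ℕ} (hj : j < L) (t : ℕ) (κ : Fin (2 ^ L)) :
    ∑ x ∈ Finset.range ((2 * q) ^ (j + 1)), W.pathTerm (2 ^ L) j t κ x = W.waveletVec L j t κ := by
  simp only [pathTerm, pathInit]
  rw [pow_succ']
  refine (sum_range_mul_eq (fun d y => pathValue κ
    ((W.pathStep (2 ^ L))^[j] (y, (2 * t + d + 2 + 2 * q * 2 ^ L - 2 * q) % 2 ^ L,
      1 * mirror W.h (2 - 2 * q + (d : ℕ))))) _ _).trans ?_
  simp only [waveletVec, Finset.sum_apply, Pi.smul_apply, smul_eq_mul]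
  rw [sum_Icc_eq_sum_range q _ _ (by ring)]
  refine Finset.sum_congr rfl fun d _ => ?_
  rw [W.sum_pathStep κ j hj.le _ (Nat.mod_lt _ (by positivity)), one_mul]
  congr 1
  refine congrFun (W.scalingVec_congr hj.le ?_) κ
  have hle : 2 * q ≤ 2 * t + d + 2 + 2 * q * 2 ^ L :=
    le_trans (Nat.le_mul_of_pos_right _ (by positivity)) (Nat.le_add_left _ _)
  push_cast [Nat.cast_sub hle]
  refine ((Int.mod_modEq _ _).of_dvd (pow_dvd_pow 2 (by omega))).trans ?_
  refine Int.modEq_iff_dvd.2 ?_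
  rw [show (2 * (t : ℤ) + (2 - 2 * q + d)) - (2 * t + d + 2 + 2 * q * 2 ^ L - 2 * q) =
    2 ^ L * (-(2 * q)) by ring]
  exact (pow_dvd_pow 2 (by omega)).mul_right _

end CompactWavelet

/-! ### Execution of programs -/

/-- The integer cell with a fixed address. -/
abbrev nc (a : ℕ) : NatExpr := .cell (.lit a)

/-- The real cell with a fixed address. -/
abbrev rc (a : ℕ) : RealExpr := .cell (.lit a)

namespace Config

/-- Write an integer, without the restrictions of `storeNat`. -/
def putNat (σ : Config) (a v : ℕ) : Config := { σ with nat := Function.update σ.nat a v }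

/-- Write a real number, without the restriction of `storeReal`. -/
def putReal (σ : Config) (a : ℕ) (v : ℝ) : Config :=
  { σ with real := Function.update σ.real a v }

variable (σ : Config) (a b x : ℕ) (y : ℝ)

@[simp] theorem putNat_nat : (σ.putNat a x).nat b = if b = a then x else σ.nat b :=
  Function.update_apply _ _ _ _

@[simp] theorem putNat_real : (σ.putNat a x).real b = σ.real b := rfl

@[simp] theorem putNat_input : (σ.putNat a x).input = σ.input := rfl

@[simp] theorem putNat_output : (σ.putNat a x).output = σ.output := rfl

@[simp] theorem putReal_real : (σ.putReal a y).real b = if b = a then y else σ.real b :=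
  Function.update_apply _ _ _ _

@[simp] theorem putReal_nat : (σ.putReal a y).nat b = σ.nat b := rfl

@[simp] theorem putReal_input : (σ.putReal a y).input = σ.input := rfl

@[simp] theorem putReal_output : (σ.putReal a y).output = σ.output := rfl

variable {σ} in
theorem eq_of {τ : Config} (h1 : ∀ a, σ.nat a = τ.nat a) (h2 : ∀ a, σ.real a = τ.real a)
    (h3 : σ.input = τ.input) (h4 : σ.output = τ.output) : σ = τ := by
  cases σ
  cases τ
  simp only [mk.injEq]
  exact ⟨funext h1, funext h2, h3, h4⟩

end Config

section Exec

variable {S w : ℕ} {σ : Config}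

/-- The rule for loops: an invariant that holds at the start and is preserved by each round holds at
the end. -/
theorem exec_loop {I : ℕ → Config → Prop} {k : NatExpr} {P : Program} {N : ℕ} (hN : k.eval σ = N)
    (h0 : I 0 σ) (hs : ∀ i < N, ∀ τ, I i τ → I (i + 1) (P.exec S w τ)) :
    I N ((Program.loop k P).exec S w σ) := by
  rw [Program.exec, hN]
  clear hN
  induction N with
  | zero => exact h0
  | succ N ih =>
    rw [Function.iterate_succ_apply']
    exact hs N (by omega) _ (ih fun i hi => hs i (by omega))

/-- Sequential composition of a list of programs. -/
def block : List Program → Program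
  | [] => .skip
  | P :: l => .seq P (block l)

theorem exec_block_nil : (block []).exec S w σ = σ := rfl

theorem exec_block_cons (P : Program) (l : List Program) :
    (block (P :: l)).exec S w σ = (block l).exec S w (P.exec S w σ) := rfl

theorem exec_setNat {a v : NatExpr} {a₀ v₀ : ℕ} (ha : a.eval σ = a₀) (hv : v.eval σ = v₀)
    (haS : a₀ < S) (hvw : v₀ < 2 ^ w) :
    (Program.setNat a v).exec S w σ = σ.putNat a₀ v₀ := by
  rw [Program.exec, ha, hv, Config.storeNat, if_pos haS, Nat.mod_eq_of_lt hvw]; rfl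

theorem exec_setReal {a : NatExpr} {v : RealExpr} {a₀ : ℕ} {v₀ : ℝ} (ha : a.eval σ = a₀)
    (hv : v.eval σ = v₀) (haS : a₀ < S) :
    (Program.setReal a v).exec S w σ = σ.putReal a₀ v₀ := by
  rw [Program.exec, ha, hv, Config.storeReal, if_pos haS]; rfl

theorem exec_ifNat {x y : NatExpr} {P Q : Program} {x₀ y₀ : ℕ} (hx : x.eval σ = x₀)
    (hy : y.eval σ = y₀) :
    (Program.ifNat x y P Q).exec S w σ = if x₀ ≤ y₀ then P.exec S w σ else Q.exec S w σ := by
  rw [Program.exec, hx, hy]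

theorem exec_ifReal {x y : RealExpr} {P Q : Program} {x₀ y₀ : ℝ} (hx : x.eval σ = x₀)
    (hy : y.eval σ = y₀) :
    (Program.ifReal x y P Q).exec S w σ = if x₀ ≤ y₀ then P.exec S w σ else Q.exec S w σ := by
  rw [Program.exec, hx, hy]

theorem exec_ifNat_setReal {x y a : NatExpr} {v : RealExpr} {x₀ y₀ a₀ : ℕ} {v₀ o : ℝ}
    (hx : x.eval σ = x₀) (hy : y.eval σ = y₀) (ha : a.eval σ = a₀) (hv : v.eval σ = v₀)
    (ho : σ.real a₀ = o) (haS : a₀ < S) : (Program.ifNat x y (.setReal a v) .skip).exec S w σ =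
      σ.putReal a₀ (if x₀ ≤ y₀ then v₀ else o) := by
  rw [exec_ifNat hx hy, ← ho]
  split_ifs
  · exact exec_setReal ha hv haS
  · rw [Config.putReal, Function.update_eq_self]; rfl

theorem exec_ifReal_setReal {x y : RealExpr} {a : NatExpr} {v : RealExpr} {x₀ y₀ : ℝ} {a₀ : ℕ}
    {v₀ o : ℝ} (hx : x.eval σ = x₀) (hy : y.eval σ = y₀) (ha : a.eval σ = a₀) (hv : v.eval σ = v₀)
    (ho : σ.real a₀ = o) (haS : a₀ < S) : (Program.ifReal x y (.setReal a v) .skip).exec S w σ =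
      σ.putReal a₀ (if x₀ ≤ y₀ then v₀ else o) := by
  rw [exec_ifReal hx hy, ← ho]
  split_ifs
  · exact exec_setReal ha hv haS
  · rw [Config.putReal, Function.update_eq_self]; rfl

/-- A program that uses the integer cells `2, …, u - 1` and the real cells `1, …, v - 1` as
scratch space may turn `σ` into `τ`. -/
structure Keep (u v : ℕ) (σ τ : Config) : Prop where
  nat : ∀ a, a < 2 ∨ u ≤ a → τ.nat a = σ.nat a
  real : ∀ a, a < 1 ∨ v ≤ a → τ.real a = σ.real a
  input : τ.input = σ.input
  output : τ.output = σ.output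

theorem Keep.trans {u v : ℕ} {σ τ ρ : Config} (h : Keep u v σ τ) (h' : Keep u v τ ρ) :
    Keep u v σ ρ :=
  ⟨fun a ha => (h'.nat a ha).trans (h.nat a ha), fun a ha => (h'.real a ha).trans (h.real a ha),
    h'.input.trans h.input, h'.output.trans h.output⟩

theorem Keep.mono {u v u' v' : ℕ} {σ τ : Config} (h : Keep u v σ τ) (hu : u ≤ u') (hv : v ≤ v') :
    Keep u' v' σ τ :=
  ⟨fun a ha => h.nat a (by omega), fun a ha => h.real a (by omega), h.input, h.output⟩

theorem Keep.putNat {u v a x : ℕ} (h2 : 2 ≤ a) (hu : a < u) :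
    Keep u v σ (σ.putNat a x) :=
  ⟨fun b hb => Function.update_of_ne (by omega) _ _, fun _ _ => rfl, rfl, rfl⟩

theorem Keep.putReal {u v a : ℕ} {x : ℝ} (h1 : 1 ≤ a) (hv : a < v) :
    Keep u v σ (σ.putReal a x) :=
  ⟨fun _ _ => rfl, fun b hb => Function.update_of_ne (by omega) _ _, rfl, rfl⟩

end Exec

/-! ### A program for the entries of the basis vectors -/

/-- The length `n = 2^L`, the parameter `B` and the machine are such that all addresses and integers
used below are available. -/
structure Setup (q L B S w : ℕ) : Prop where
  one_le_q : 1 ≤ q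
  one_le_L : 1 ≤ L
  space : 2 * (B + 6 * q * L + 2) + 18 ≤ S
  lt_n : 2 ^ L < 2 ^ w
  lt_paths : (2 * q) ^ L < 2 ^ w
  lt_B : B < 2 ^ w

theorem Setup.le_S {q L B S w : ℕ} (hs : Setup q L B S w) : 18 ≤ S :=
  le_trans (by omega) hs.space

/-- Multiply the real cell `2` by `a d`, where `d` is the last digit (base `2q`) of the integer
cell `4`, provided that `d < M`. -/
def mulTap (q : ℕ) (a : ℕ → ℝ) : ℕ → Program
  | 0 => .skip
  | m + 1 => .ifNat (.lit m) (.mod (nc 4) (.lit (2 * q)))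
      (.setReal (.lit 2) (.mul (rc 2) (.lit (a m)))) (mulTap q a m)

theorem exec_mulTap {q : ℕ} {a : ℕ → ℝ} {S w : ℕ} {σ : Config} (hS : 18 ≤ S) {M : ℕ}
    (hM : σ.nat 4 % (2 * q) < M) : (mulTap q a M).exec S w σ =
      σ.putReal 2 (σ.real 2 * a (σ.nat 4 % (2 * q))) := by
  induction M with
  | zero => omega
  | succ M ih =>
    rw [mulTap, exec_ifNat (x₀ := M) (y₀ := σ.nat 4 % (2 * q)) rfl rfl]
    split_ifs with h
    · have e : σ.nat 4 % (2 * q) = M := by omega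
      rw [exec_setReal (a₀ := 2) (v₀ := σ.real 2 * a M) rfl rfl (by omega), e]
    · exact ih (by omega)

namespace CompactWavelet

variable {q : ℕ} (W : CompactWavelet q)

/-- The body of the loop that runs down a path: one `pathStep` on the cells `4`, `5` and the real
cell `2`. -/
def stepProg : Program := block [
  .setNat (.lit 5) (.mod (.add (.mul (.lit 2) (nc 5)) (.mod (nc 4) (.lit (2 * q)))) (nc 0)),
  mulTap q (fun d => W.h (d : ℤ)) (2 * q),
  .setNat (.lit 4) (.div (nc 4) (.lit (2 * q)))]

/-- Run down the path with the digits in the cell `3`, below the wavelet vector whose scale and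
position are in the cells `7` and `8`. -/
def pathProg : Program := block [
  .setNat (.lit 4) (nc 3),
  .setNat (.lit 5) (.mod (.sub (.add (.add (.add (.mul (.lit 2) (nc 8))
    (.mod (nc 4) (.lit (2 * q)))) (.lit 2)) (.mul (.lit (2 * q)) (nc 0))) (.lit (2 * q))) (nc 0)),
  .setReal (.lit 2) (.lit 1),
  mulTap q (fun d => mirror W.h (2 - 2 * q + (d : ℤ))) (2 * q),
  .setNat (.lit 4) (.div (nc 4) (.lit (2 * q))),
  .loop (.sub (nc 7) (.lit 1)) W.stepProg]

/-- The body of the loop of `entryProg`: add the contribution of one path. -/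
def entryBody : Program := block [
  W.pathProg,
  .ifNat (.add (.sub (nc 5) (nc 6)) (.sub (nc 6) (nc 5))) (.lit 0)
    (.setReal (.lit 1) (.add (rc 1) (rc 2))) .skip,
  .setNat (.lit 3) (.add (nc 3) (.lit 1))]

/-- Compute the entry at the point in cell `6` of the basis vector whose code is in the cells `7`
and `8`, into the real cell `1`, as a sum over all paths of the cascade. -/
def entryProg : Program :=
  .ifNat (nc 7) (.lit 0) (.setReal (.lit 1) (rc 11)) (block [
    .setReal (.lit 1) (.lit 0),
    .setNat (.lit 2) (.lit 1),
    .loop (nc 7) (.setNat (.lit 2) (.mul (.lit (2 * q)) (nc 2))),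
    .setNat (.lit 3) (.lit 0),
    .loop (nc 2) W.entryBody])

/-- The configuration `σ`, with the state `s` of a path in its scratch cells. -/
def pathConfig (σ : Config) (s : ℕ × ℕ × ℝ) : Config :=
  ((σ.putNat 4 s.1).putNat 5 s.2.1).putReal 2 s.2.2

variable {L B S w : ℕ} (hs : Setup q L B S w) {σ : Config}
include hs

theorem exec_stepProg (hn : σ.nat 0 = 2 ^ L) (s : ℕ × ℕ × ℝ) (h1 : s.1 < 2 ^ w) :
    W.stepProg.exec S w (pathConfig σ s) = pathConfig σ (W.pathStep (2 ^ L) s) := by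
  have hS := hs.le_S
  have hq := hs.one_le_q
  have hmod : ∀ x, x % 2 ^ L < 2 ^ w := fun x =>
    (Nat.mod_lt _ (by positivity)).trans hs.lt_n
  rw [stepProg, exec_block_cons,
    exec_setNat (a₀ := 5) (v₀ := (2 * s.2.1 + s.1 % (2 * q)) % 2 ^ L) rfl
      (by simp [NatExpr.eval, pathConfig, hn]) (by omega) (hmod _),
    exec_block_cons, exec_mulTap hS (Nat.mod_lt _ (by omega)), exec_block_cons,
    exec_setNat (a₀ := 4) (v₀ := s.1 / (2 * q)) rfl
      (by simp [NatExpr.eval, pathConfig]) (by omega) ((Nat.div_le_self _ _).trans_lt h1),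
    exec_block_nil]
  refine Config.eq_of (fun a => ?_) (fun a => ?_) rfl rfl
  · simp only [pathConfig, pathStep, Config.putNat_nat, Config.putReal_nat]
    grind
  · simp only [pathConfig, pathStep, Config.putNat_nat, Config.putReal_nat, Config.putReal_real,
      Config.putNat_real]
    grind

theorem exec_pathProg {j t x : ℕ} (hn : σ.nat 0 = 2 ^ L) (h7 : σ.nat 7 = j + 1) (h8 : σ.nat 8 = t)
    (h3 : σ.nat 3 = x) (hx : x < 2 ^ w) :
    W.pathProg.exec S w σ =
      pathConfig σ ((W.pathStep (2 ^ L))^[j] (W.pathInit (2 ^ L) t x)) := by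
  have hS := hs.le_S
  have hq := hs.one_le_q
  have hmod : ∀ x, x % 2 ^ L < 2 ^ w := fun x =>
    (Nat.mod_lt _ (by positivity)).trans hs.lt_n
  rw [pathProg, exec_block_cons, exec_setNat (a₀ := 4) (v₀ := x) rfl
      (show (nc 3).eval σ = x from h3) (by omega) hx, exec_block_cons,
    exec_setNat (a₀ := 5) (v₀ := (2 * t + x % (2 * q) + 2 + 2 * q * 2 ^ L - 2 * q) % 2 ^ L) rfl
      (by simp [NatExpr.eval, hn, h8]) (by omega) (hmod _), exec_block_cons,
    exec_setReal (a₀ := 2) (v₀ := 1) rfl rfl (by omega), exec_block_cons,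
    exec_mulTap hS (Nat.mod_lt _ (by omega)), exec_block_cons,
    exec_setNat (a₀ := 4) (v₀ := x / (2 * q)) rfl
      (by simp [NatExpr.eval]) (by omega) ((Nat.div_le_self _ _).trans_lt hx), exec_block_cons,
    exec_block_nil]
  have e : ∀ τ : Config, τ = pathConfig σ (W.pathInit (2 ^ L) t x) →
      (Program.loop ((nc 7).sub (NatExpr.lit 1)) W.stepProg).exec S w τ =
        pathConfig σ ((W.pathStep (2 ^ L))^[j] (W.pathInit (2 ^ L) t x)) := by
    rintro τ rfl
    refine (exec_loop (I := fun i ρ =>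
      ρ = pathConfig σ ((W.pathStep (2 ^ L))^[i] (W.pathInit (2 ^ L) t x)) ∧
        ((W.pathStep (2 ^ L))^[i] (W.pathInit (2 ^ L) t x)).1 < 2 ^ w) (N := j) ?_ ?_ ?_).1
    · simp [NatExpr.eval, pathConfig, h7]
    · exact ⟨rfl, (Nat.div_le_self _ _).trans_lt hx⟩
    · rintro i _ ρ ⟨rfl, hi⟩
      rw [Function.iterate_succ_apply']
      exact ⟨W.exec_stepProg hs hn _ hi, (Nat.div_le_self _ _).trans_lt hi⟩
  refine e _ (Config.eq_of (fun a => ?_) (fun a => ?_) rfl rfl)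
  · simp only [pathConfig, pathInit, Config.putNat_nat, Config.putReal_nat]
    grind
  · simp only [pathConfig, pathInit, Config.putNat_nat, Config.putReal_nat, Config.putReal_real,
      Config.putNat_real]
    grind

theorem exec_entryProg (hn : σ.nat 0 = 2 ^ L) (hC : σ.real 11 = (√2)⁻¹ ^ L) {i : Idx L}
    (h7 : σ.nat 7 = (code i).1) (h8 : σ.nat 8 = (code i).2) {κ : Fin (2 ^ L)} (h6 : σ.nat 6 = κ) :
    Keep 6 3 σ (W.entryProg.exec S w σ) ∧ (W.entryProg.exec S w σ).real 1 = W.basis L i κ := by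
  have hS := hs.le_S
  have hq := hs.one_le_q
  match i with
  | none =>
    rw [entryProg, exec_ifNat (show (nc 7).eval σ = 0 from h7) (y₀ := 0) rfl, if_pos le_rfl,
      exec_setReal (a₀ := 1) (v₀ := (√2)⁻¹ ^ L) rfl
        (show (rc 11).eval σ = _ from hC) (by omega)]
    refine ⟨Keep.putReal le_rfl (by omega), ?_⟩
    simp [basis, scalingVec_top]
  | some ⟨j, t⟩ =>
    simp only [code] at h7 h8
    have hpow : ∀ m ≤ L, (2 * q) ^ m < 2 ^ w := fun m hm =>
      (Nat.pow_le_pow_right (by omega) hm).trans_lt hs.lt_paths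
    have h1w : 1 < 2 ^ w := by simpa using hpow 0 (by omega)
    rw [entryProg, exec_ifNat (show (nc 7).eval σ = (j : ℕ) + 1 from h7) (y₀ := 0) rfl,
      if_neg (by omega), exec_block_cons,
      exec_setReal (a₀ := 1) (v₀ := 0) rfl rfl (by omega), exec_block_cons,
      exec_setNat (a₀ := 2) (v₀ := 1) rfl rfl (by omega) h1w, exec_block_cons]
    have hp := exec_loop (S := S) (w := w) (σ := (σ.putReal 1 0).putNat 2 1)
      (I := fun m ρ => Keep 6 3 σ ρ ∧ ρ.nat 2 = (2 * q) ^ m ∧ ρ.real 1 = 0)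
      (k := nc 7) (P := .setNat (.lit 2) (.mul (.lit (2 * q)) (nc 2))) (N := (j : ℕ) + 1)
      (by simp [NatExpr.eval, h7])
      ⟨(Keep.putReal le_rfl (by omega)).trans (Keep.putNat (by omega) (by omega)), by simp,
        by simp⟩
      (by
        rintro m hm ρ ⟨hk, h2, h1⟩
        rw [exec_setNat (a₀ := 2) (v₀ := (2 * q) ^ (m + 1)) rfl
          (by simp [NatExpr.eval, pow_succ', h2]) (by omega) (hpow _ (by omega))]
        exact ⟨hk.trans (Keep.putNat (by omega) (by omega)), by simp, by simp [h1]⟩)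
    obtain ⟨pk, p2, p1⟩ := hp
    set τ := (Program.loop (nc 7) _).exec S w _ with hτ
    rw [exec_block_cons, exec_setNat (a₀ := 3) (v₀ := 0) rfl rfl (by omega) (by omega),
      exec_block_cons, exec_block_nil]
    have hl := exec_loop (S := S) (w := w) (σ := τ.putNat 3 0)
      (I := fun x ρ => Keep 6 3 σ ρ ∧ ρ.nat 3 = x ∧
        ρ.real 1 = ∑ y ∈ Finset.range x, W.pathTerm (2 ^ L) j t κ y)
      (k := nc 2) (P := W.entryBody) (N := (2 * q) ^ ((j : ℕ) + 1))
      (by simp [NatExpr.eval, p2])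
      ⟨pk.trans (Keep.putNat (by omega) (by omega)), by simp, by simp [p1]⟩ ?_
    · refine ⟨hl.1, hl.2.2.trans ?_⟩
      rw [W.sum_pathTerm j.2]
      rfl
    · rintro x hx ρ ⟨hk, h3, h1⟩
      have hxw : x + 1 < 2 ^ w := lt_of_le_of_lt hx (hpow _ (by omega))
      rw [entryBody, exec_block_cons, W.exec_pathProg hs ((hk.nat 0 (by omega)).trans hn)
        ((hk.nat 7 (by omega)).trans h7) ((hk.nat 8 (by omega)).trans h8) h3 (by omega)]
      set s := (W.pathStep (2 ^ L))^[(j : ℕ)] (W.pathInit (2 ^ L) t x) with hsdef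
      have hk2 : Keep 6 3 ρ (pathConfig ρ s) :=
        ((Keep.putNat (by omega) (by omega)).trans (Keep.putNat (by omega) (by omega))).trans
          (Keep.putReal (by omega) (by omega))
      have h6' : ρ.nat 6 = κ := (hk.nat 6 (by omega)).trans h6
      rw [exec_block_cons, exec_ifNat_setReal
          (x₀ := (s.2.1 - (κ : ℕ)) + ((κ : ℕ) - s.2.1)) (y₀ := 0) (a₀ := 1)
          (v₀ := ρ.real 1 + s.2.2) (by simp [NatExpr.eval, pathConfig, h6']) rfl rfl
          (by simp [RealExpr.eval, NatExpr.eval, pathConfig]) (o := ρ.real 1)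
          (by simp [pathConfig]) (by omega),
        exec_block_cons, exec_setNat (a₀ := 3) (v₀ := x + 1) rfl
          (by simp [NatExpr.eval, pathConfig, h3]) (by omega) hxw, exec_block_nil]
      refine ⟨((hk.trans hk2).trans (Keep.putReal le_rfl (by omega))).trans
        (Keep.putNat (by omega) (by omega)), by simp, ?_⟩
      rw [Finset.sum_range_succ, ← h1, pathTerm, ← hsdef, pathValue]
      simp only [Config.putNat_real, Config.putReal_real, if_true, pathConfig]
      by_cases hc : s.2.1 = κ
      · rw [if_pos (by omega), if_pos hc]
      · rw [if_neg (by omega), if_neg hc, add_zero]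

end CompactWavelet

/-! ### A program for the profile of a basis vector -/

/-- A vector of length `n` as a function on `ℕ`, extended by `0`. -/
def ext {n : ℕ} (v : Fin n → ℝ) (k : ℕ) : ℝ := if h : k < n then v ⟨k, h⟩ else 0

theorem ext_coe {n : ℕ} (v : Fin n → ℝ) (k : Fin n) : ext v k = v k := by simp [ext]

theorem ext_of_le {n : ℕ} (v : Fin n → ℝ) {k : ℕ} (hk : n ≤ k) : ext v k = 0 := by
  simp [ext, hk]

/-- The vector vanishes from the point `m` on. -/
def Finished {n : ℕ} (v : Fin n → ℝ) (m : ℕ) : Prop := ∀ k, m ≤ k → ext v k = 0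

/-- How a program decides between the cases `p' = ∞` and `p' < ∞`, given `1 / p`. -/
theorem toReal_inv_cases {p p' : ENNReal} (h : ENNReal.HolderConjugate p p') :
    (1 ≤ p⁻¹.toReal ∧ p' = ⊤) ∨
      (¬ 1 ≤ p⁻¹.toReal ∧ 0 < p'.toReal ∧ 1 - p⁻¹.toReal = 1 / p'.toReal) := by
  rcases holderConjugate_cases h with ⟨rfl, rfl⟩ | ⟨rfl, rfl⟩ | hr
  · exact Or.inl ⟨by simp, rfl⟩
  · exact Or.inr (by simp)
  · refine Or.inr ⟨?_, hr.symm.pos, ?_⟩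
    · rw [ENNReal.toReal_inv, not_le]
      exact inv_lt_one_of_one_lt₀ hr.lt
    · rw [ENNReal.toReal_inv, one_div, ← hr.inv_add_inv_eq_one]; ring

namespace CompactWavelet

variable {q : ℕ} (W : CompactWavelet q)

/-- The body of the loop of `scanProg`. -/
def scanBody : Program := block [
  W.entryProg,
  .ifNat (.add (nc 6) (.lit 1)) (nc 13)
    (.setReal (.lit 3) (.add (rc 3) (.mul (rc 1) (rc 1)))) .skip,
  .ifNat (.add (nc 13) (.lit 1)) (nc 6)
    (.setReal (.lit 4) (.add (rc 4) (.mul (rc 1) (rc 1)))) .skip,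
  .ifNat (.add (.sub (nc 6) (nc 13)) (.sub (nc 13) (nc 6))) (.lit 0)
    (.setReal (.lit 5) (rc 1)) .skip,
  .ifReal (rc 1) (.lit 0) (.setReal (.lit 1) (.sub (.lit 0) (rc 1))) .skip,
  .setReal (.lit 6) (.add (rc 6) (.pow (rc 1) (.div (.lit 1) (.sub (.lit 1) (rc 0))))),
  .ifReal (rc 7) (rc 1) (.setReal (.lit 7) (rc 1)) .skip,
  .setNat (.lit 6) (.add (nc 6) (.lit 1))]

/-- Run through all entries of the basis vector `v` with the code in the cells `7` and `8`. With `k`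
the content of cell `13`, the real cells `3` and `4` receive the sums of the squares of the entries
before and after `k`, the real cell `5` receives the entry at `k`, and the real cell `8` the norm
`‖v‖_{p'}`. -/
def scanProg : Program := block [
  .setReal (.lit 3) (.lit 0), .setReal (.lit 4) (.lit 0), .setReal (.lit 5) (.lit 0),
  .setReal (.lit 6) (.lit 0), .setReal (.lit 7) (.lit 0), .setNat (.lit 6) (.lit 0),
  .loop (nc 0) W.scanBody,
  .ifReal (.lit 1) (rc 0) (.setReal (.lit 8) (rc 7))
    (.setReal (.lit 8) (.pow (rc 6) (.sub (.lit 1) (rc 0))))]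

/-- The invariant of the loop of `scanProg`, after `m` entries. -/
structure ScanInv {n : ℕ} (v : Fin n → ℝ) (k : ℕ) (e : ℝ) (σ : Config) (m : ℕ) (ρ : Config) :
    Prop where
  keep : Keep 7 8 σ ρ
  pos : ρ.nat 6 = m
  before : ρ.real 3 = ∑ i ∈ Finset.range m, if i + 1 ≤ k then ext v i * ext v i else 0
  after : ρ.real 4 = ∑ i ∈ Finset.range m, if k + 1 ≤ i then ext v i * ext v i else 0
  current : ρ.real 5 = if k < m then ext v k else 0
  powers : ρ.real 6 = ∑ i ∈ Finset.range m, |ext v i| ^ e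
  le_max : ∀ i < m, |ext v i| ≤ ρ.real 7
  max_eq : ρ.real 7 = 0 ∨ ∃ i < m, ρ.real 7 = |ext v i|

variable {L B S w : ℕ} (hs : Setup q L B S w) {σ : Config}
include hs

theorem exec_scanBody (hn : σ.nat 0 = 2 ^ L) (hC : σ.real 11 = (√2)⁻¹ ^ L) {i : Idx L}
    (h7 : σ.nat 7 = (code i).1) (h8 : σ.nat 8 = (code i).2) {k : ℕ} (hk : σ.nat 13 = k) {m : ℕ}
    (hm : m < 2 ^ L) {ρ : Config}
    (hI : ScanInv (W.basis L i) k (1 / (1 - σ.real 0)) σ m ρ) :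
    ScanInv (W.basis L i) k (1 / (1 - σ.real 0)) σ (m + 1) (W.scanBody.exec S w ρ) := by
  have hS := hs.le_S
  have hw := hs.lt_n
  set v := W.basis L i with hv
  obtain ⟨hkeep, h6, hI3, hI4, hI5, hI6, hI7, hI7'⟩ := hI
  obtain ⟨ke, he⟩ := W.exec_entryProg hs (σ := ρ) (i := i) (κ := ⟨m, hm⟩)
    ((hkeep.nat 0 (by omega)).trans hn) ((hkeep.real 11 (by omega)).trans hC)
    ((hkeep.nat 7 (by omega)).trans h7) ((hkeep.nat 8 (by omega)).trans h8) h6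
  rw [← hv, ← ext_coe v] at he
  simp only at he
  rw [scanBody, exec_block_cons]
  set τ := W.entryProg.exec S w ρ with hτ
  have t6 : τ.nat 6 = m := (ke.nat 6 (by omega)).trans h6
  have t13 : τ.nat 13 = k := (ke.nat 13 (by omega)).trans ((hkeep.nat 13 (by omega)).trans hk)
  have t0 : τ.real 0 = σ.real 0 := (ke.real 0 (by omega)).trans (hkeep.real 0 (by omega))
  have t3 := ke.real 3 (by omega)
  have t4 := ke.real 4 (by omega)
  have t5 := ke.real 5 (by omega)
  have t6r := ke.real 6 (by omega)
  have t7 := ke.real 7 (by omega)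
  have habs : (if ext v m ≤ 0 then 0 - ext v m else ext v m) = |ext v m| := by
    split_ifs with h
    · rw [abs_of_nonpos h, zero_sub]
    · rw [abs_of_pos (not_le.1 h)]
  rw [exec_block_cons, exec_ifNat_setReal (x₀ := m + 1) (y₀ := k) (a₀ := 3)
      (v₀ := τ.real 3 + ext v m * ext v m) (o := τ.real 3) (by simp [NatExpr.eval, t6])
      (by simp [NatExpr.eval, t13]) rfl (by simp [NatExpr.eval, RealExpr.eval, he]) rfl (by omega),
    exec_block_cons, exec_ifNat_setReal (x₀ := k + 1) (y₀ := m) (a₀ := 4)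
      (v₀ := τ.real 4 + ext v m * ext v m) (o := τ.real 4) (by simp [NatExpr.eval, t13])
      (by simp [NatExpr.eval, t6]) rfl (by simp [NatExpr.eval, RealExpr.eval, he]) (by simp)
      (by omega),
    exec_block_cons, exec_ifNat_setReal (x₀ := (m - k) + (k - m)) (y₀ := 0) (a₀ := 5)
      (v₀ := ext v m) (o := τ.real 5) (by simp [NatExpr.eval, t13, t6]) rfl
      rfl (by simp [NatExpr.eval, RealExpr.eval, he]) (by simp) (by omega),
    exec_block_cons, exec_ifReal_setReal (x₀ := ext v m) (y₀ := 0) (a₀ := 1)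
      (v₀ := 0 - ext v m) (o := ext v m) (by simp [NatExpr.eval, RealExpr.eval, he]) rfl
      rfl (by simp [NatExpr.eval, RealExpr.eval, he]) (by simp [he]) (by omega), habs,
    exec_block_cons, exec_setReal (a₀ := 6)
      (v₀ := τ.real 6 + |ext v m| ^ (1 / (1 - σ.real 0))) rfl
      (by simp [NatExpr.eval, RealExpr.eval, t0]) (by omega),
    exec_block_cons, exec_ifReal_setReal (x₀ := τ.real 7) (y₀ := |ext v m|) (a₀ := 7)
      (v₀ := |ext v m|) (o := τ.real 7) (by simp [NatExpr.eval, RealExpr.eval])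
      (by simp [NatExpr.eval, RealExpr.eval])
      rfl (by simp [NatExpr.eval, RealExpr.eval]) (by simp) (by omega),
    exec_block_cons, exec_setNat (a₀ := 6) (v₀ := m + 1) rfl
      (by simp [NatExpr.eval, t6]) (by omega) (by omega), exec_block_nil]
  constructor
  · refine (hkeep.trans (ke.mono (by omega) (by omega))).trans ?_
    refine ((((((Keep.putReal ?_ ?_).trans (Keep.putReal ?_ ?_)).trans (Keep.putReal ?_ ?_)).trans
      (Keep.putReal ?_ ?_)).trans (Keep.putReal ?_ ?_)).trans (Keep.putReal ?_ ?_)).trans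
      (Keep.putNat ?_ ?_) <;> omega
  · simp
  · rw [Finset.sum_range_succ, ← hI3, ← t3]
    simp only [Config.putNat_real, Config.putReal_real, Nat.reduceEqDiff,
      if_false, if_true]
    split_ifs <;> simp
  · rw [Finset.sum_range_succ, ← hI4, ← t4]
    simp only [Config.putNat_real, Config.putReal_real, Nat.reduceEqDiff,
      if_false, if_true]
    split_ifs <;> simp
  · simp only [Config.putNat_real, Config.putReal_real, Nat.reduceEqDiff,
      if_false, if_true, t5, hI5]
    by_cases hkm : k = m
    · subst hkm; simp
    · rw [if_neg (by omega)]
      exact if_congr (by omega) rfl rfl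
  · rw [Finset.sum_range_succ, ← hI6, ← t6r]
    simp
  · intro i hi
    simp only [Config.putNat_real, Config.putReal_real, if_true, t7]
    rcases Nat.lt_succ_iff_lt_or_eq.1 hi with h | rfl
    · have := hI7 i h
      split_ifs with hc
      · exact this.trans hc
      · exact this
    · split_ifs with hc
      · exact le_rfl
      · exact (not_le.1 hc).le
  · simp only [Config.putNat_real, Config.putReal_real, if_true, t7]
    split_ifs with hc
    · exact Or.inr ⟨m, by omega, rfl⟩
    · rcases hI7' with h | ⟨i, hi, h⟩
      · exact Or.inl h
      · exact Or.inr ⟨i, by omega, h⟩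

/-- The squares of the entries before the point `k` have sum zero exactly if the vector vanishes
there, and likewise for those after `k`. -/
theorem exec_scanProg {p p' : ENNReal} (hpp : ENNReal.HolderConjugate p p')
    (hn : σ.nat 0 = 2 ^ L) (hp : σ.real 0 = p⁻¹.toReal) (hC : σ.real 11 = (√2)⁻¹ ^ L) {i : Idx L}
    (h7 : σ.nat 7 = (code i).1) (h8 : σ.nat 8 = (code i).2) {k : ℕ} (hk : σ.nat 13 = k)
    (hkn : k < 2 ^ L) :
    Keep 7 9 σ (W.scanProg.exec S w σ) ∧
      ((W.scanProg.exec S w σ).real 3 ≤ 0 ↔ ∀ j < k, ext (W.basis L i) j = 0) ∧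
      ((W.scanProg.exec S w σ).real 4 ≤ 0 ↔ Finished (W.basis L i) (k + 1)) ∧
      (W.scanProg.exec S w σ).real 5 = ext (W.basis L i) k ∧
      (W.scanProg.exec S w σ).real 8 = pNorm p' (W.basis L i) := by
  have hS := hs.le_S
  rw [scanProg, exec_block_cons, exec_setReal (a₀ := 3) (v₀ := 0) rfl rfl (by omega),
    exec_block_cons, exec_setReal (a₀ := 4) (v₀ := 0) rfl rfl (by omega),
    exec_block_cons, exec_setReal (a₀ := 5) (v₀ := 0) rfl rfl (by omega),
    exec_block_cons, exec_setReal (a₀ := 6) (v₀ := 0) rfl rfl (by omega),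
    exec_block_cons, exec_setReal (a₀ := 7) (v₀ := 0) rfl rfl (by omega),
    exec_block_cons, exec_setNat (a₀ := 6) (v₀ := 0) rfl rfl (by omega) (by positivity),
    exec_block_cons]
  set τ₀ : Config := Config.putNat _ 6 0
  have k0 : Keep 7 8 σ τ₀ := by
    refine (((((Keep.putReal ?_ ?_).trans (Keep.putReal ?_ ?_)).trans (Keep.putReal ?_ ?_)).trans
      (Keep.putReal ?_ ?_)).trans (Keep.putReal ?_ ?_)).trans (Keep.putNat ?_ ?_) <;> omega
  have hl := exec_loop (S := S) (w := w) (σ := τ₀)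
    (I := ScanInv (W.basis L i) k (1 / (1 - σ.real 0)) σ) (k := nc 0) (P := W.scanBody)
    (N := 2 ^ L) ((k0.nat 0 (by omega)).trans hn)
    ⟨k0, by simp [τ₀], by simp [τ₀], by simp [τ₀], by simp [τ₀], by simp [τ₀],
      fun _ h => absurd h (by omega), by simp [τ₀]⟩
    (fun m hm ρ hI => W.exec_scanBody hs hn hC h7 h8 hk hm hI)
  set ρ := (Program.loop (nc 0) W.scanBody).exec S w τ₀ with hρ
  obtain ⟨hkeep, -, r3, r4, r5, r6, r7, r7'⟩ := hl
  set v := W.basis L i with hv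
  have r0 : ρ.real 0 = p⁻¹.toReal := (hkeep.real 0 (by omega)).trans hp
  have hnorm : (if 1 ≤ p⁻¹.toReal then ρ.real 7 else ρ.real 6 ^ (1 - p⁻¹.toReal)) = pNorm p' v := by
    rcases toReal_inv_cases hpp with ⟨h1, rfl⟩ | ⟨h1, h2, h3⟩
    · rw [if_pos h1]
      refine le_antisymm ?_ ?_
      · rcases r7' with h | ⟨j, hj, h⟩
        · rw [h]; exact pNorm_nonneg le_top v
        · rw [h]
          exact (ext_coe v ⟨j, hj⟩) ▸ abs_le_pNorm_top v ⟨j, hj⟩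
      · refine pNorm_top_le ((abs_nonneg _).trans (r7 k hkn)) fun j => ?_
        rw [← ext_coe v]
        exact r7 j j.2
    · rw [if_neg h1, pNorm_eq_rpow h2, r6, hp, h3, one_div_one_div, Finset.sum_range]
      simp_rw [ext_coe]
  have hfin : (block [Program.ifReal (.lit 1) (rc 0) (.setReal (.lit 8) (rc 7))
      (.setReal (.lit 8) (.pow (rc 6) (.sub (.lit 1) (rc 0))))]).exec S w ρ =
      ρ.putReal 8 (pNorm p' v) := by
    rw [exec_block_cons, exec_ifReal (x₀ := 1) rfl (show (rc 0).eval ρ = _ from r0), ← hnorm]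
    split_ifs
    · rw [exec_setReal (a₀ := 8) (v₀ := ρ.real 7) rfl rfl (by omega), exec_block_nil]
    · rw [exec_setReal (a₀ := 8) (v₀ := ρ.real 6 ^ (1 - p⁻¹.toReal)) rfl
        (by simp [RealExpr.eval, NatExpr.eval, r0]) (by omega), exec_block_nil]
  rw [hfin]
  have hsq : ∀ (P : ℕ → Prop) [DecidablePred P],
      ((∑ j ∈ Finset.range (2 ^ L), if P j then ext v j * ext v j else 0) ≤ 0 ↔
        ∀ j < 2 ^ L, P j → ext v j = 0) := by
    intro P _
    have hnn : ∀ j ∈ Finset.range (2 ^ L), 0 ≤ (if P j then ext v j * ext v j else 0) := by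
      intro j _
      split_ifs
      · exact mul_self_nonneg _
      · exact le_rfl
    rw [(Finset.sum_nonneg hnn).ge_iff_eq', Finset.sum_eq_zero_iff_of_nonneg hnn]
    refine forall_congr' fun j => ?_
    rw [Finset.mem_range]
    refine imp_congr_right fun _ => ?_
    simp
  refine ⟨(hkeep.mono le_rfl (by omega)).trans (Keep.putReal (by omega) (by omega)), ?_, ?_, ?_, ?_⟩
  · rw [Config.putReal_real, if_neg (by omega), r3, hsq]
    exact ⟨fun h j hj => h j (by omega) hj, fun h j _ hj => h j hj⟩
  · rw [Config.putReal_real, if_neg (by omega), r4, hsq]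
    refine ⟨fun h j hj => ?_, fun h j _ hj => h j hj⟩
    by_cases hjn : j < 2 ^ L
    · exact h j hjn hj
    · exact ext_of_le v (by omega)
  · rw [Config.putReal_real, if_neg (by omega), r5, if_pos hkn]
  · simp

end CompactWavelet

/-! ### The pool of partial coefficients -/

theorem code_lt {L : ℕ} (i : Idx L) : (code i).1 < 2 ^ L ∧ (code i).2 < 2 ^ L := by
  match i with
  | none => simp [code]
  | some ⟨j, t⟩ =>
    refine ⟨lt_of_le_of_lt (show (j : ℕ) + 1 ≤ L from j.2) L.lt_two_pow_self, ?_⟩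
    exact t.2.trans_le (Nat.pow_le_pow_right (by norm_num) (by omega))

theorem code_injective (L : ℕ) : Function.Injective (code (L := L)) := by
  intro i i' h
  match i, i' with
  | none, none => rfl
  | none, some ⟨j, t⟩ => simp [code] at h
  | some ⟨j, t⟩, none => simp [code] at h
  | some ⟨j, t⟩, some ⟨j', t'⟩ =>
    simp only [code, Prod.mk.injEq, add_left_inj] at h
    obtain ⟨h1, h2⟩ := h
    obtain rfl := Fin.ext h1
    obtain rfl := Fin.ext h2
    rfl

/-- The contribution of the first `m` entries of `f` to `⟨f, v⟩`. -/
def partialSum {n : ℕ} (f v : Fin n → ℝ) (m : ℕ) : ℝ :=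
  ∑ k ∈ Finset.range m, ext f k * ext v k

/-- The memory holds `N` records: record `r` consists of the code of the index `e r` and of the real
number `acc r`. The integer cells `0`, `1`, `13`, `14`, `15` contain `n`, `B`, the current point
`k`, `N` and `L`, and the real cells `0`, `10`, `11` contain `1 / p`, the current entry `y` of the
stream and the value of the coarsest scaling vector. -/
structure Pool {L : ℕ} (B : ℕ) (p : ENNReal) (k : ℕ) (y : ℝ) (inp : List ℝ) (N : ℕ) (e : ℕ → Idx L)
    (acc : ℕ → ℝ) (σ : Config) : Prop where
  nat_n : σ.nat 0 = 2 ^ L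
  nat_B : σ.nat 1 = B
  nat_k : σ.nat 13 = k
  nat_N : σ.nat 14 = N
  nat_L : σ.nat 15 = L
  real_p : σ.real 0 = p⁻¹.toReal
  real_y : σ.real 10 = y
  real_C : σ.real 11 = (√2)⁻¹ ^ L
  scale : ∀ r < N, σ.nat (16 + 2 * r) = (code (e r)).1
  pos : ∀ r < N, σ.nat (17 + 2 * r) = (code (e r)).2
  sum : ∀ r < N, σ.real (16 + r) = acc r
  input : σ.input = inp
  output : σ.output = []

/-- The integer cell number `a + 2 r`, where `r` is the content of cell `b`. -/
abbrev recNat (a b : ℕ) : NatExpr := .cell (.add (.lit a) (.mul (.lit 2) (nc b)))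

/-- The real cell number `16 + r`, where `r` is the content of the integer cell `b`. -/
abbrev recReal (b : ℕ) : RealExpr := .cell (.add (.lit 16) (nc b))

namespace Pool

variable {L B : ℕ} {p : ENNReal} {k : ℕ} {y : ℝ} {inp : List ℝ} {N : ℕ} {e : ℕ → Idx L}
  {acc : ℕ → ℝ} {σ τ : Config}

theorem keep (h : Pool B p k y inp N e acc σ) (hk : Keep 13 10 σ τ) :
    Pool B p k y inp N e acc τ where
  nat_n := (hk.nat _ (by omega)).trans h.nat_n
  nat_B := (hk.nat _ (by omega)).trans h.nat_B
  nat_k := (hk.nat _ (by omega)).trans h.nat_k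
  nat_N := (hk.nat _ (by omega)).trans h.nat_N
  nat_L := (hk.nat _ (by omega)).trans h.nat_L
  real_p := (hk.real _ (by omega)).trans h.real_p
  real_y := (hk.real _ (by omega)).trans h.real_y
  real_C := (hk.real _ (by omega)).trans h.real_C
  scale r hr := (hk.nat _ (by omega)).trans (h.scale r hr)
  pos r hr := (hk.nat _ (by omega)).trans (h.pos r hr)
  sum r hr := (hk.real _ (by omega)).trans (h.sum r hr)
  input := hk.input.trans h.input
  output := hk.output.trans h.output

theorem congr (h : Pool B p k y inp N e acc σ) {acc' : ℕ → ℝ} (ha : ∀ r < N, acc r = acc' r) :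
    Pool B p k y inp N e acc' σ :=
  { h with sum := fun r hr => (h.sum r hr).trans (ha r hr) }

theorem putReal (h : Pool B p k y inp N e acc σ) (r : ℕ) (x : ℝ) :
    Pool B p k y inp N e (Function.update acc r x) (σ.putReal (16 + r) x) where
  nat_n := h.nat_n
  nat_B := h.nat_B
  nat_k := h.nat_k
  nat_N := h.nat_N
  nat_L := h.nat_L
  real_p := by rw [Config.putReal_real, if_neg (by omega), h.real_p]
  real_y := by rw [Config.putReal_real, if_neg (by omega), h.real_y]
  real_C := by rw [Config.putReal_real, if_neg (by omega), h.real_C]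
  scale := h.scale
  pos := h.pos
  sum r' hr' := by
    rw [Config.putReal_real, Function.update_apply, h.sum r' hr']
    exact if_congr (by omega) rfl rfl
  input := h.input
  output := h.output

end Pool

namespace CompactWavelet

variable {q : ℕ} (W : CompactWavelet q)

/-- Load the code of the record whose number is in the cell `9` and examine its basis vector. -/
def loadProg : Program := block [
  .setNat (.lit 7) (recNat 16 9), .setNat (.lit 8) (recNat 17 9), W.scanProg]

/-- Add the contribution of the current entry of the stream to one record. -/
def updateBody : Program := block [
  W.loadProg,
  .setReal (.add (.lit 16) (nc 9)) (.add (recReal 9) (.mul (rc 10) (rc 5))),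
  .setNat (.lit 9) (.add (nc 9) (.lit 1))]

/-- Add the contribution of the current entry of the stream to all records. -/
def updateProg : Program := block [.setNat (.lit 9) (.lit 0), .loop (nc 14) W.updateBody]

/-- Append a record for the code in the cells `7` and `8`. -/
def appendProg : Program := block [
  .setNat (.add (.lit 16) (.mul (.lit 2) (nc 14))) (nc 7),
  .setNat (.add (.lit 17) (.mul (.lit 2) (nc 14))) (nc 8),
  .setReal (.add (.lit 16) (nc 14)) (.mul (rc 10) (rc 5)),
  .setNat (.lit 14) (.add (nc 14) (.lit 1))]

/-- Append a record for the code in the cells `7` and `8`, if the current point is the first one at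
which the basis vector does not vanish. -/
def offerProg : Program := block [
  W.scanProg,
  .ifReal (rc 3) (.lit 0) (.ifReal (.mul (rc 5) (rc 5)) (.lit 0) .skip appendProg) .skip]

/-- `offerProg` for all positions of the scale in cell `7`, the number of which is in cell `12`. -/
def offerScaleProg : Program := block [
  .setNat (.lit 8) (.lit 0),
  .loop (nc 12) (block [W.offerProg, .setNat (.lit 8) (.add (nc 8) (.lit 1))]),
  .setNat (.lit 12) (.div (nc 12) (.lit 2)),
  .setNat (.lit 7) (.add (nc 7) (.lit 1))]

/-- `offerProg` for all basis vectors. -/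
def offerAllProg : Program := block [
  .setNat (.lit 7) (.lit 0), .setNat (.lit 8) (.lit 0), W.offerProg,
  .setNat (.lit 7) (.lit 1), .setNat (.lit 12) (.div (nc 0) (.lit 2)),
  .loop (nc 15) W.offerScaleProg]

/-- The point `k` is the first one at which the basis vector `i` does not vanish. -/
def StartsAt (L k : ℕ) (i : Idx L) : Prop :=
  (∀ j < k, ext (W.basis L i) j = 0) ∧ ext (W.basis L i) k ≠ 0

open Classical in
/-- The indices with the property `D` of the basis vectors that start at `k`. -/
def starting (L k : ℕ) (D : Idx L → Prop) : Finset (Idx L) := {i | W.StartsAt L k i ∧ D i}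

theorem mem_starting {L k : ℕ} {D : Idx L → Prop} {i : Idx L} :
    i ∈ W.starting L k D ↔ W.StartsAt L k i ∧ D i := by simp [starting]

/-- The memory holds precisely the indices in `K`, each with its partial coefficient after `m`
entries of the stream. -/
def Holds {L : ℕ} (f : Fin (2 ^ L) → ℝ) (B : ℕ) (p : ENNReal) (k : ℕ) (y : ℝ) (inp : List ℝ) (m : ℕ)
    (K : Finset (Idx L)) (σ : Config) : Prop :=
  ∃ (N : ℕ) (e : ℕ → Idx L),
    Pool B p k y inp N e (fun r => partialSum f (W.basis L (e r)) m) σ ∧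
      Set.InjOn e (Finset.range N) ∧ (Finset.range N).image e = K

variable {W} in
theorem Holds.keep {L B : ℕ} {f : Fin (2 ^ L) → ℝ} {p : ENNReal} {k m : ℕ} {y : ℝ}
    {inp : List ℝ} {K : Finset (Idx L)} {σ τ : Config} (h : W.Holds f B p k y inp m K σ)
    (hk : Keep 13 10 σ τ) : W.Holds f B p k y inp m K τ := by
  obtain ⟨N, e, h1, h2, h3⟩ := h
  exact ⟨N, e, h1.keep hk, h2, h3⟩

variable {W} in
theorem Holds.nat_eq {L B : ℕ} {f : Fin (2 ^ L) → ℝ} {p : ENNReal} {k m : ℕ} {y : ℝ}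
    {inp : List ℝ} {K : Finset (Idx L)} {σ : Config} (h : W.Holds f B p k y inp m K σ) :
    σ.nat 0 = 2 ^ L ∧ σ.nat 15 = L := by
  obtain ⟨N, e, h1, -, -⟩ := h
  exact ⟨h1.nat_n, h1.nat_L⟩

variable {L B S w : ℕ} (hs : Setup q L B S w) {p p' : ENNReal}
  (hpp : ENNReal.HolderConjugate p p') {k : ℕ} (hk : k < 2 ^ L) {y : ℝ} {inp : List ℝ}
  {σ : Config}
include hs hpp hk

theorem exec_loadProg {N : ℕ} {e : ℕ → Idx L} {acc : ℕ → ℝ} (h : Pool B p k y inp N e acc σ)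
    {r : ℕ} (hr : r < N) (h9 : σ.nat 9 = r) :
    Keep 9 9 σ (W.loadProg.exec S w σ) ∧
      ((W.loadProg.exec S w σ).real 4 ≤ 0 ↔ Finished (W.basis L (e r)) (k + 1)) ∧
      (W.loadProg.exec S w σ).real 5 = ext (W.basis L (e r)) k ∧
      (W.loadProg.exec S w σ).real 8 = pNorm p' (W.basis L (e r)) := by
  have hS := hs.le_S
  have hn := hs.lt_n
  obtain ⟨c1, c2⟩ := code_lt (e r)
  rw [loadProg, exec_block_cons, exec_setNat (a₀ := 7) (v₀ := (code (e r)).1) rfl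
      (by simp [NatExpr.eval, h9, h.scale r hr]) (by omega) (by omega), exec_block_cons,
    exec_setNat (a₀ := 8) (v₀ := (code (e r)).2) rfl
      (by simp only [NatExpr.eval, Config.putNat_nat]
          rw [if_neg (by omega), if_neg (by omega), h9, h.pos r hr]) (by omega) (by omega),
    exec_block_cons, exec_block_nil]
  have k0 : Keep 9 9 σ ((σ.putNat 7 (code (e r)).1).putNat 8 (code (e r)).2) :=
    (Keep.putNat (by omega) (by omega)).trans (Keep.putNat (by omega) (by omega))
  obtain ⟨s1, -, s3, s4, s5⟩ := W.exec_scanProg hs hpp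
    (σ := (σ.putNat 7 (code (e r)).1).putNat 8 (code (e r)).2) (by simp [h.nat_n])
    (by simp [h.real_p]) (by simp [h.real_C]) (i := e r) (by simp) (by simp) (k := k)
    (by simp [h.nat_k]) hk
  exact ⟨k0.trans (s1.mono (by omega) le_rfl), s3, s4, s5⟩

theorem exec_updateProg {N : ℕ} (hN : N ≤ B + 6 * q * L + 2) {e : ℕ → Idx L} {acc : ℕ → ℝ}
    (hNw : N < 2 ^ w) (h : Pool B p k y inp N e acc σ) :
    Pool B p k y inp N e (fun r => acc r + y * ext (W.basis L (e r)) k)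
      (W.updateProg.exec S w σ) := by
  have hS := hs.le_S
  have hsp := hs.space
  rw [updateProg, exec_block_cons, exec_setNat (a₀ := 9) (v₀ := 0) rfl rfl (by omega)
    (by positivity), exec_block_cons, exec_block_nil]
  have hl := exec_loop (S := S) (w := w) (σ := σ.putNat 9 0) (k := nc 14) (P := W.updateBody)
    (N := N) (I := fun m τ => Pool B p k y inp N e
      (fun r => if r < m then acc r + y * ext (W.basis L (e r)) k else acc r) τ ∧ τ.nat 9 = m)
    (by simp [NatExpr.eval, h.nat_N])
    ⟨(h.keep (Keep.putNat (by omega) (by omega))).congr fun r _ => by simp, by simp⟩ ?_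
  · exact hl.1.congr fun r hr => if_pos hr
  · rintro r hr τ ⟨hτ, h9⟩
    obtain ⟨l1, -, l3, -⟩ := W.exec_loadProg hs hpp hk hτ hr h9
    rw [updateBody, exec_block_cons]
    set ρ := W.loadProg.exec S w τ
    have hρ := hτ.keep (l1.mono (by omega) (by omega))
    have h9' : ρ.nat 9 = r := (l1.nat 9 (by omega)).trans h9
    rw [exec_block_cons, exec_setReal (a₀ := 16 + r)
        (v₀ := acc r + y * ext (W.basis L (e r)) k) (by simp [NatExpr.eval, h9'])
        (by simp only [RealExpr.eval, NatExpr.eval, h9', hρ.real_y, l3, hρ.sum r hr]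
            rw [if_neg (lt_irrefl r)]) (by omega),
      exec_block_cons, exec_setNat (a₀ := 9) (v₀ := r + 1) rfl
        (by simp [NatExpr.eval, h9']) (by omega) (by omega), exec_block_nil]
    refine ⟨((hρ.putReal r _).keep (Keep.putNat (by omega) (by omega))).congr fun r' _ => ?_,
      by simp⟩
    rw [Function.update_apply]
    by_cases h1 : r' = r
    · subst h1; simp
    · rw [if_neg h1]
      exact if_congr (by omega) rfl rfl

/-- A record is appended for the index in the cells `7` and `8` if and only if its vector starts at
the current point; its partial coefficient then consists of one term. -/
theorem exec_offerProg {N : ℕ} {e : ℕ → Idx L} {acc : ℕ → ℝ} (h : Pool B p k y inp N e acc σ)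
    {i : Idx L} (h7 : σ.nat 7 = (code i).1) (h8 : σ.nat 8 = (code i).2)
    (hcap : W.StartsAt L k i → N < B + 6 * q * L + 2) (hNw : W.StartsAt L k i → N + 1 < 2 ^ w) :
    ((W.StartsAt L k i → Pool B p k y inp (N + 1) (Function.update e N i)
        (Function.update acc N (y * ext (W.basis L i) k)) (W.offerProg.exec S w σ)) ∧
      (¬ W.StartsAt L k i → Pool B p k y inp N e acc (W.offerProg.exec S w σ))) ∧
    (W.offerProg.exec S w σ).nat 7 = σ.nat 7 ∧ (W.offerProg.exec S w σ).nat 8 = σ.nat 8 ∧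
      (W.offerProg.exec S w σ).nat 12 = σ.nat 12 := by
  have hS := hs.le_S
  have hn := hs.lt_n
  have hsp := hs.space
  obtain ⟨c1, c2⟩ := code_lt i
  obtain ⟨s1, s2, -, s4, -⟩ := W.exec_scanProg hs hpp h.nat_n h.real_p h.real_C h7 h8 h.nat_k hk
  rw [offerProg, exec_block_cons, exec_block_cons, exec_block_nil]
  set ρ := W.scanProg.exec S w σ
  have hρ := h.keep (s1.mono (by omega) (by omega))
  have e7 : ρ.nat 7 = σ.nat 7 := s1.nat 7 (by omega)
  have e8 : ρ.nat 8 = σ.nat 8 := s1.nat 8 (by omega)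
  have e12 : ρ.nat 12 = σ.nat 12 := s1.nat 12 (by omega)
  have hsq : ext (W.basis L i) k * ext (W.basis L i) k ≤ 0 ↔ ext (W.basis L i) k = 0 := by
    rw [(mul_self_nonneg _).ge_iff_eq', mul_self_eq_zero]
  rw [exec_ifReal (show (rc 3).eval ρ = ρ.real 3 from rfl) (y₀ := 0) rfl,
    exec_ifReal (x₀ := ext (W.basis L i) k * ext (W.basis L i) k) (y₀ := 0)
      (by simp [RealExpr.eval, NatExpr.eval, s4]) rfl]
  by_cases hst : W.StartsAt L k i
  · rw [if_pos (s2.2 hst.1), if_neg (fun hc => hst.2 (hsq.1 hc))]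
    have hc := hcap hst
    rw [appendProg, exec_block_cons, exec_setNat (a₀ := 16 + 2 * N) (v₀ := (code i).1)
        (by simp [NatExpr.eval, hρ.nat_N])
        (by simp [NatExpr.eval, e7, h7]) (by omega) (by omega), exec_block_cons,
      exec_setNat (a₀ := 17 + 2 * N) (v₀ := (code i).2)
        (by simp only [NatExpr.eval, Config.putNat_nat]
            rw [if_neg (by omega), hρ.nat_N])
        (by simp only [NatExpr.eval, Config.putNat_nat]
            rw [if_neg (by omega), e8, h8]) (by omega) (by omega), exec_block_cons,
      exec_setReal (a₀ := 16 + N) (v₀ := y * ext (W.basis L i) k)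
        (by simp only [NatExpr.eval, Config.putNat_nat]
            rw [if_neg (by omega), if_neg (by omega), hρ.nat_N])
        (by simp [RealExpr.eval, NatExpr.eval, hρ.real_y, s4]) (by omega), exec_block_cons,
      exec_setNat (a₀ := 14) (v₀ := N + 1) rfl
        (by simp only [NatExpr.eval, Config.putNat_nat, Config.putReal_nat]
            rw [if_neg (by omega), if_neg (by omega), hρ.nat_N]) (by omega) (hNw hst),
      exec_block_nil]
    refine ⟨⟨fun _ => ?_, fun hc => absurd hst hc⟩, ?_, ?_, ?_⟩
    · constructor
      · simp only [Config.putNat_nat, Config.putReal_nat]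
        rw [if_neg (by omega), if_neg (by omega), if_neg (by omega), hρ.nat_n]
      · simp only [Config.putNat_nat, Config.putReal_nat]
        rw [if_neg (by omega), if_neg (by omega), if_neg (by omega), hρ.nat_B]
      · simp only [Config.putNat_nat, Config.putReal_nat]
        rw [if_neg (by omega), if_neg (by omega), if_neg (by omega), hρ.nat_k]
      · simp
      · simp only [Config.putNat_nat, Config.putReal_nat]
        rw [if_neg (by omega), if_neg (by omega), if_neg (by omega), hρ.nat_L]
      · simp only [Config.putNat_real, Config.putReal_real]
        rw [if_neg (by omega), hρ.real_p]
      · simp only [Config.putNat_real, Config.putReal_real]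
        rw [if_neg (by omega), hρ.real_y]
      · simp only [Config.putNat_real, Config.putReal_real]
        rw [if_neg (by omega), hρ.real_C]
      · intro r hr
        simp only [Config.putNat_nat, Config.putReal_nat, Function.update_apply]
        rw [if_neg (by omega), if_neg (by omega)]
        by_cases h1 : r = N
        · subst h1; simp
        · rw [if_neg (by omega), if_neg h1, hρ.scale r (by omega)]
      · intro r hr
        simp only [Config.putNat_nat, Config.putReal_nat, Function.update_apply]
        rw [if_neg (by omega)]
        by_cases h1 : r = N
        · subst h1; simp
        · rw [if_neg (by omega), if_neg (by omega), if_neg h1, hρ.pos r (by omega)]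
      · intro r hr
        simp only [Config.putNat_real, Config.putReal_real, Function.update_apply]
        by_cases h1 : r = N
        · subst h1; simp
        · rw [if_neg (by omega), if_neg h1, hρ.sum r (by omega)]
      · exact hρ.input
      · exact hρ.output
    all_goals
      simp only [Config.putNat_nat, Config.putReal_nat]
      rw [if_neg (by omega), if_neg (by omega), if_neg (by omega)]
      assumption
  · have e0 : (if ρ.real 3 ≤ 0 then
        if ext (W.basis L i) k * ext (W.basis L i) k ≤ 0 then Program.skip.exec S w ρ
          else appendProg.exec S w ρ
        else Program.skip.exec S w ρ) = ρ := by
      split_ifs with h1 h2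
      · rfl
      · exact absurd ⟨s2.1 h1, fun hc => h2 (hsq.2 hc)⟩ hst
      · rfl
    rw [e0]
    exact ⟨⟨fun hc => absurd hc hst, fun _ => hρ⟩, e7, e8, e12⟩

theorem holds_updateProg {f : Fin (2 ^ L) → ℝ} (hy : y = ext f k) {K : Finset (Idx L)}
    (hK : K.card ≤ B + 6 * q * L + 2) (h : W.Holds f B p k y inp k K σ) :
    W.Holds f B p k y inp (k + 1) K (W.updateProg.exec S w σ) := by
  obtain ⟨N, e, h1, h2, h3⟩ := h
  have hN : N = K.card := by rw [← h3, Finset.card_image_of_injOn h2, Finset.card_range]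
  have hNL : K.card ≤ 2 ^ L := (Finset.card_le_univ K).trans (card_idx L).le
  refine ⟨N, e, (W.exec_updateProg hs hpp hk (hN ▸ hK) (by have := hs.lt_n; omega) h1).congr
    fun r _ => ?_, h2, h3⟩
  rw [partialSum, partialSum, Finset.sum_range_succ, hy]

open Classical in
/-- A vector that starts at the current point has no earlier contributions, so a record opened now
holds its complete partial coefficient. -/
theorem holds_offerProg {f : Fin (2 ^ L) → ℝ} (hy : y = ext f k) {K : Finset (Idx L)} {i : Idx L}
    (hcap : W.StartsAt L k i → K.card < B + 6 * q * L + 2 ∧ i ∉ K)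
    (h7 : σ.nat 7 = (code i).1) (h8 : σ.nat 8 = (code i).2)
    (h : W.Holds f B p k y inp (k + 1) K σ) :
    W.Holds f B p k y inp (k + 1) (if W.StartsAt L k i then insert i K else K)
      (W.offerProg.exec S w σ) ∧
    (W.offerProg.exec S w σ).nat 7 = σ.nat 7 ∧ (W.offerProg.exec S w σ).nat 8 = σ.nat 8 ∧
      (W.offerProg.exec S w σ).nat 12 = σ.nat 12 := by
  obtain ⟨N, e, h1, h2, h3⟩ := h
  have hN : N = K.card := by rw [← h3, Finset.card_image_of_injOn h2, Finset.card_range]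
  have hNw : W.StartsAt L k i → N + 1 < 2 ^ w := by
    intro hst
    have hc : (insert i K).card ≤ 2 ^ L := (Finset.card_le_univ _).trans (card_idx L).le
    rw [Finset.card_insert_of_notMem (hcap hst).2] at hc
    have := hs.lt_n
    omega
  obtain ⟨⟨a1, a2⟩, a3⟩ := W.exec_offerProg hs hpp hk h1 h7 h8
    (fun hst => hN ▸ (hcap hst).1) hNw
  refine ⟨?_, a3⟩
  split_ifs with hst
  · have hne : ∀ r < N, Function.update e N i r = e r := fun r hr =>
      Function.update_of_ne (by omega) _ _
    have himg : (Finset.range N).image (Function.update e N i) = K := by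
      rw [← h3]
      refine Finset.image_congr ?_
      intro r hr
      exact hne r (by simpa using hr)
    refine ⟨N + 1, Function.update e N i, (a1 hst).congr fun r hr => ?_, ?_, ?_⟩
    · by_cases hrN : r = N
      · subst hrN
        rw [Function.update_self, Function.update_self, partialSum, Finset.sum_range_succ, hy,
          Finset.sum_eq_zero, zero_add]
        intro j hj
        rw [hst.1 j (Finset.mem_range.1 hj), mul_zero]
      · rw [Function.update_of_ne hrN, Function.update_of_ne hrN]
    · rw [Finset.coe_range, Set.Iio_add_one_eq_Iic, ← Set.Iio_insert, Set.injOn_insert (by simp)]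
      refine ⟨fun a ha b hb hab => ?_, ?_⟩
      · rw [hne a ha, hne b hb] at hab
        exact h2 (by simpa using ha) (by simpa using hb) hab
      · rintro ⟨r, hr, hri⟩
        rw [Function.update_self] at hri
        refine (hcap hst).2 ?_
        rw [← himg]
        exact Finset.mem_image.2 ⟨r, by simpa using hr, hri⟩
    · rw [Finset.range_add_one, Finset.image_insert, himg, Function.update_self]
  · exact ⟨N, e, a2 hst, h2, h3⟩

open Classical in
/-- Offering one more index: the memory changes from `K ∪ {StartsAt, D}` to `K ∪ {StartsAt, D'}`,
where `D'` holds for the offered index and for those with `D`. -/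
theorem holds_offerProg_union {f : Fin (2 ^ L) → ℝ} (hy : y = ext f k) {K : Finset (Idx L)}
    {i : Idx L} {D D' : Idx L → Prop} (hD : ∀ i', D' i' ↔ D i' ∨ i' = i) (hi : ¬ D i)
    (hK : ∀ i ∈ K, ¬ W.StartsAt L k i)
    (hcap : (K ∪ W.starting L k (fun _ => True)).card ≤ B + 6 * q * L + 2)
    (h7 : σ.nat 7 = (code i).1) (h8 : σ.nat 8 = (code i).2)
    (h : W.Holds f B p k y inp (k + 1) (K ∪ W.starting L k D) σ) :
    W.Holds f B p k y inp (k + 1) (K ∪ W.starting L k D') (W.offerProg.exec S w σ) ∧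
    (W.offerProg.exec S w σ).nat 7 = σ.nat 7 ∧ (W.offerProg.exec S w σ).nat 8 = σ.nat 8 ∧
      (W.offerProg.exec S w σ).nat 12 = σ.nat 12 := by
  have hnot : W.StartsAt L k i → i ∉ K ∪ W.starting L k D := by
    intro hst hc
    rcases Finset.mem_union.1 hc with h1 | h1
    · exact hK i h1 hst
    · exact hi (W.mem_starting.1 h1).2
  have hmain := W.holds_offerProg hs hpp hk hy (i := i) (fun hst => ⟨?_, hnot hst⟩) h7 h8 h
  · convert hmain using 2
    ext i'
    split_ifs with hst
    · simp only [Finset.mem_union, mem_starting,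
        Finset.mem_insert, hD]
      constructor
      · rintro (h1 | ⟨h1, h2 | h2⟩)
        · exact Or.inr (Or.inl h1)
        · exact Or.inr (Or.inr ⟨h1, h2⟩)
        · exact Or.inl h2
      · rintro (rfl | h1 | ⟨h1, h2⟩)
        · exact Or.inr ⟨hst, Or.inr rfl⟩
        · exact Or.inl h1
        · exact Or.inr ⟨h1, Or.inl h2⟩
    · simp only [Finset.mem_union, mem_starting, hD]
      refine or_congr_right (and_congr_right fun h1 => ⟨fun h2 => h2.resolve_right ?_, Or.inl⟩)
      rintro rfl
      exact hst h1
  · refine (Finset.card_lt_card ⟨?_, fun hsub => hnot hst (hsub ?_)⟩).trans_le hcap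
    · exact Finset.union_subset_union_right fun i' hi' => by
        rw [mem_starting] at hi' ⊢
        exact ⟨hi'.1, trivial⟩
    · exact Finset.mem_union_right _ (W.mem_starting.2 ⟨hst, trivial⟩)

open Classical in
theorem holds_offerAllProg {f : Fin (2 ^ L) → ℝ} (hy : y = ext f k) {K : Finset (Idx L)}
    (hK : ∀ i ∈ K, ¬ W.StartsAt L k i)
    (hcap : (K ∪ W.starting L k (fun _ => True)).card ≤ B + 6 * q * L + 2)
    (h : W.Holds f B p k y inp (k + 1) K σ) :
    W.Holds f B p k y inp (k + 1) (K ∪ W.starting L k (fun _ => True))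
      (W.offerAllProg.exec S w σ) := by
  have hS := hs.le_S
  have hn := hs.lt_n
  have hL := hs.one_le_L
  have hLn : L < 2 ^ L := L.lt_two_pow_self
  rw [offerAllProg, exec_block_cons, exec_setNat (a₀ := 7) (v₀ := 0) rfl rfl (by omega)
    (by positivity), exec_block_cons, exec_setNat (a₀ := 8) (v₀ := 0) rfl rfl (by omega)
    (by positivity), exec_block_cons]
  have h0 := W.holds_offerProg_union hs hpp hk hy (K := K) (i := none)
    (σ := (σ.putNat 7 0).putNat 8 0) (D := fun _ => False) (D' := fun i => (code i).1 ≤ 0)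
    (fun i' => by
      rw [false_or]
      match i' with
      | none => simp [code]
      | some ⟨j, t⟩ => simp [code])
    (fun hc => hc) hK hcap rfl rfl
    (by
      have e0 : K ∪ W.starting L k (fun _ => False) = K := by simp [starting]
      rw [e0]
      exact h.keep ((Keep.putNat (by omega) (by omega)).trans (Keep.putNat (by omega) (by omega))))
  obtain ⟨h0, -, -⟩ := h0
  set τ := W.offerProg.exec S w ((σ.putNat 7 0).putNat 8 0)
  rw [exec_block_cons, exec_setNat (a₀ := 7) (v₀ := 1) rfl rfl (by omega) (by omega),
    exec_block_cons, exec_setNat (a₀ := 12) (v₀ := 2 ^ (L - 1)) rfl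
      (by
        simp only [NatExpr.eval, Config.putNat_nat]
        rw [if_neg (by omega), h0.nat_eq.1, ← Nat.pow_div hL (by norm_num), pow_one]) (by omega)
      ((Nat.pow_le_pow_right (by norm_num) (by omega)).trans_lt hn),
    exec_block_cons, exec_block_nil]
  have hl := exec_loop (S := S) (w := w) (σ := (τ.putNat 7 1).putNat 12 (2 ^ (L - 1)))
    (k := nc 15) (P := W.offerScaleProg) (N := L)
    (I := fun J ρ => W.Holds f B p k y inp (k + 1)
      (K ∪ W.starting L k (fun i => (code i).1 ≤ J)) ρ ∧ ρ.nat 7 = J + 1 ∧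
        ρ.nat 12 = 2 ^ (L - 1) / 2 ^ J)
    (by simp [NatExpr.eval, h0.nat_eq.2])
    ⟨h0.keep ((Keep.putNat (by omega) (by omega)).trans (Keep.putNat (by omega) (by omega))),
      by simp, by simp⟩ ?_
  · have e1 : W.starting L k (fun i => (code i).1 ≤ L) =
        W.starting L k (fun _ => True) := by
      ext i
      simp only [mem_starting, and_true, and_iff_left_iff_imp]
      intro _
      match i with
      | none => simp [code]
      | some ⟨j, t⟩ => exact j.2
    rw [← e1]
    exact hl.1
  · rintro J hJ ρ ⟨h1, h7, h12⟩
    have hcnt : 2 ^ (L - 1) / 2 ^ J = 2 ^ (L - 1 - J) :=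
      Nat.pow_div (by omega) (by norm_num)
    rw [offerScaleProg, exec_block_cons, exec_setNat (a₀ := 8) (v₀ := 0) rfl rfl (by omega)
      (by positivity), exec_block_cons]
    have hl2 := exec_loop (S := S) (w := w) (σ := ρ.putNat 8 0) (k := nc 12)
      (P := block [W.offerProg, .setNat (.lit 8) (.add (nc 8) (.lit 1))]) (N := 2 ^ (L - 1 - J))
      (I := fun T ρ => W.Holds f B p k y inp (k + 1)
        (K ∪ W.starting L k (fun i => ((code i).1 ≤ J ∨ (code i).1 = J + 1 ∧ (code i).2 < T))) ρ ∧
          ρ.nat 7 = J + 1 ∧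
          ρ.nat 12 = 2 ^ (L - 1) / 2 ^ J ∧ ρ.nat 8 = T)
      (by simp [NatExpr.eval, h12, hcnt])
      ⟨by simpa using h1.keep (Keep.putNat (by omega) (by omega)), by simp [h7], by simp [h12],
        by simp⟩ ?_
    · obtain ⟨l1, l2, l3, -⟩ := hl2
      set ρ₂ := (Program.loop (nc 12) _).exec S w (ρ.putNat 8 0)
      rw [exec_block_cons, exec_setNat (a₀ := 12) (v₀ := 2 ^ (L - 1) / 2 ^ (J + 1)) rfl
          (by simp [NatExpr.eval, l3, Nat.div_div_eq_div_mul, pow_succ]) (by omega)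
          ((Nat.div_le_self _ _).trans_lt
            ((Nat.pow_le_pow_right (by norm_num) (by omega)).trans_lt hn)),
        exec_block_cons, exec_setNat (a₀ := 7) (v₀ := J + 1 + 1) rfl
          (by simp [NatExpr.eval, l2]) (by omega) (by omega), exec_block_nil]
      refine ⟨?_, by simp, by simp⟩
      have e1 : W.starting L k (fun i => (code i).1 ≤ J + 1) =
          W.starting L k (fun i => ((code i).1 ≤ J ∨
            (code i).1 = J + 1 ∧ (code i).2 < 2 ^ (L - 1 - J))) := by
        ext i
        simp only [mem_starting, and_congr_right_iff]
        intro _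
        match i with
        | none => simp [code]
        | some ⟨j, t⟩ =>
          simp only [code]
          have ht := t.2
          constructor
          · intro hj
            by_cases hjJ : (j : ℕ) = J
            · refine Or.inr ⟨by omega, ?_⟩
              rw [← hjJ]; exact ht
            · exact Or.inl (by omega)
          · omega
      rw [e1]
      exact l1.keep ((Keep.putNat (by omega) (by omega)).trans (Keep.putNat (by omega) (by omega)))
    · rintro T hT ρ₂ ⟨l1, l2, l3, l4⟩
      have hTn : T + 1 < 2 ^ w := lt_of_le_of_lt hT
        ((Nat.pow_le_pow_right (by norm_num) (by omega)).trans_lt hn)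
      obtain ⟨o1, o2, o3, o4⟩ := W.holds_offerProg_union hs hpp hk hy (K := K)
        (i := some ⟨⟨J, hJ⟩, ⟨T, hT⟩⟩) (σ := ρ₂)
        (D := fun i => (code i).1 ≤ J ∨ (code i).1 = J + 1 ∧ (code i).2 < T)
        (D' := fun i => (code i).1 ≤ J ∨ (code i).1 = J + 1 ∧ (code i).2 < T + 1)
        (fun i' => by
          rw [← (code_injective L).eq_iff, Prod.ext_iff]
          simp only [code]
          omega)
        (by simp [code]) hK hcap l2 l4 l1
      rw [exec_block_cons, exec_block_cons, exec_setNat (a₀ := 8) (v₀ := T + 1) rfl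
        (by simp [NatExpr.eval, o3, l4]) (by omega) hTn, exec_block_nil]
      exact ⟨o1.keep (Keep.putNat (by omega) (by omega)), by simp [o2, l2], by simp [o4, l3],
        by simp⟩

end CompactWavelet

/-! ### Pruning the pool -/

/-- Remove the record whose number is in cell `11`: the last record takes its place. -/
def removeProg : Program := block [
  .setNat (.lit 14) (.sub (nc 14) (.lit 1)),
  .setNat (.add (.lit 16) (.mul (.lit 2) (nc 11))) (recNat 16 14),
  .setNat (.add (.lit 17) (.mul (.lit 2) (nc 11))) (recNat 17 14),
  .setReal (.add (.lit 16) (nc 11)) (recReal 14)]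

/-- Make the record in cell `9`, with the score in the real cell `1`, the one to be removed. -/
def takeProg : Program := block [.setReal (.lit 9) (rc 1), .setNat (.lit 11) (nc 9)]

/-- Count the record in cell `9` as finished, and compare its score `|acc| / ‖v‖_{p'}` with the
least score found so far. -/
def candidateProg : Program := block [
  .setReal (.lit 1) (recReal 9),
  .ifReal (rc 1) (.lit 0) (.setReal (.lit 1) (.sub (.lit 0) (rc 1))) .skip,
  .setReal (.lit 1) (.div (rc 1) (rc 8)),
  .ifNat (nc 10) (.lit 0) takeProg (.ifReal (rc 1) (rc 9) takeProg .skip),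
  .setNat (.lit 10) (.add (nc 10) (.lit 1))]

theorem exec_candidateProg {S w : ℕ} {σ : Config} (hS : 18 ≤ S) {r c : ℕ} (h9 : σ.nat 9 = r)
    (h10 : σ.nat 10 = c) (hr : r < 2 ^ w) (hc : c + 1 < 2 ^ w) {x s : ℝ}
    (hx : σ.real (16 + r) = x) (hs : s = |x| / σ.real 8) :
    Keep 12 10 σ (candidateProg.exec S w σ) ∧ (candidateProg.exec S w σ).nat 9 = r ∧
      (candidateProg.exec S w σ).nat 10 = c + 1 ∧
      ((c ≤ 0 ∨ s ≤ σ.real 9) → (candidateProg.exec S w σ).nat 11 = r ∧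
        (candidateProg.exec S w σ).real 9 = s) ∧
      (¬ (c ≤ 0 ∨ s ≤ σ.real 9) → (candidateProg.exec S w σ).nat 11 = σ.nat 11 ∧
        (candidateProg.exec S w σ).real 9 = σ.real 9) := by
  have habs : (if x ≤ 0 then 0 - x else x) = |x| := by
    split_ifs with h
    · rw [abs_of_nonpos h, zero_sub]
    · rw [abs_of_pos (not_le.1 h)]
  rw [candidateProg, exec_block_cons, exec_setReal (a₀ := 1) (v₀ := x) rfl
      (by simp [RealExpr.eval, NatExpr.eval, h9, hx]) (by omega), exec_block_cons,
    exec_ifReal_setReal (x₀ := x) (y₀ := 0) (a₀ := 1) (v₀ := 0 - x) (o := x)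
      (by simp [RealExpr.eval, NatExpr.eval]) rfl rfl (by simp [RealExpr.eval, NatExpr.eval])
      (by simp) (by omega), habs, exec_block_cons,
    exec_setReal (a₀ := 1) (v₀ := s) rfl
      (by simp [RealExpr.eval, NatExpr.eval, hs]) (by omega), exec_block_cons]
  set τ : Config := ((σ.putReal 1 x).putReal 1 |x|).putReal 1 s with hτ
  have k0 : Keep 12 10 σ τ :=
    ((Keep.putReal (by omega) (by omega)).trans (Keep.putReal (by omega) (by omega))).trans
      (Keep.putReal (by omega) (by omega))
  have t9 : τ.nat 9 = r := h9
  have t10 : τ.nat 10 = c := h10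
  have t1 : τ.real 1 = s := by simp [hτ]
  have t9r : τ.real 9 = σ.real 9 := by simp [hτ]
  have htake : takeProg.exec S w τ = (τ.putReal 9 s).putNat 11 r := by
    rw [takeProg, exec_block_cons, exec_setReal (a₀ := 9) (v₀ := s) rfl
      (by simp [RealExpr.eval, NatExpr.eval, t1]) (by omega), exec_block_cons,
      exec_setNat (a₀ := 11) (v₀ := r) rfl (by simp [NatExpr.eval, t9]) (by omega) hr,
      exec_block_nil]
  have hsel : (Program.ifNat (nc 10) (.lit 0) takeProg
      (.ifReal (rc 1) (rc 9) takeProg .skip)).exec S w τ =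
      if c ≤ 0 ∨ s ≤ σ.real 9 then (τ.putReal 9 s).putNat 11 r else τ := by
    rw [exec_ifNat (show (nc 10).eval τ = c from t10) (y₀ := 0) rfl,
      exec_ifReal (show (rc 1).eval τ = s from t1) (show (rc 9).eval τ = σ.real 9 from t9r),
      htake]
    by_cases h1 : c ≤ 0
    · rw [if_pos h1, if_pos (Or.inl h1)]
    · rw [if_neg h1]
      exact if_congr (by tauto) rfl rfl
  rw [hsel, exec_block_cons]
  split_ifs with hcase
  · rw [exec_setNat (a₀ := 10) (v₀ := c + 1) rfl (by simp [NatExpr.eval, t10]) (by omega) hc,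
      exec_block_nil]
    exact ⟨((k0.trans (Keep.putReal (by omega) (by omega))).trans
      (Keep.putNat (by omega) (by omega))).trans (Keep.putNat (by omega) (by omega)),
      by simp [t9], by simp, fun _ => ⟨by simp, by simp⟩, fun h => absurd hcase h⟩
  · rw [exec_setNat (a₀ := 10) (v₀ := c + 1) rfl (by simp [NatExpr.eval, t10]) (by omega) hc,
      exec_block_nil]
    exact ⟨k0.trans (Keep.putNat (by omega) (by omega)),
      by simp [t9], by simp, fun h => absurd h hcase, fun _ => ⟨by simp [hτ], by simp [t9r]⟩⟩

theorem Pool.exec_removeProg {L B : ℕ} {p : ENNReal} {k : ℕ} {y : ℝ} {inp : List ℝ} {N : ℕ}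
    {e : ℕ → Idx L} {acc : ℕ → ℝ} {σ : Config} (h : Pool B p k y inp (N + 1) e acc σ)
    {S w b : ℕ} (h11 : σ.nat 11 = b) (hb : b < N + 1) (hS : 2 * N + 18 ≤ S) (hN : N < 2 ^ w)
    (hw : 2 ^ L < 2 ^ w) :
    Pool B p k y inp N (Function.update e b (e N)) (Function.update acc b (acc N))
      (removeProg.exec S w σ) := by
  obtain ⟨c1, c2⟩ := code_lt (e N)
  rw [removeProg, exec_block_cons, exec_setNat (a₀ := 14) (v₀ := N) rfl
      (by simp [NatExpr.eval, h.nat_N]) (by omega) hN, exec_block_cons,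
    exec_setNat (a₀ := 16 + 2 * b) (v₀ := (code (e N)).1)
      (by simp [NatExpr.eval, h11])
      (by simp only [NatExpr.eval, Config.putNat_nat, if_true]
          rw [if_neg (by omega), h.scale N (by omega)]) (by omega) (by omega), exec_block_cons,
    exec_setNat (a₀ := 17 + 2 * b) (v₀ := (code (e N)).2)
      (by simp only [NatExpr.eval, Config.putNat_nat]
          rw [if_neg (by omega), if_neg (by omega), h11])
      (by simp only [NatExpr.eval, Config.putNat_nat, if_true]
          rw [if_neg (show ¬ 14 = 16 + 2 * b by omega), if_neg (by omega), if_neg (by omega),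
            h.pos N (by omega)]) (by omega) (by omega), exec_block_cons,
    exec_setReal (a₀ := 16 + b) (v₀ := acc N)
      (by simp only [NatExpr.eval, Config.putNat_nat]
          rw [if_neg (by omega), if_neg (by omega), if_neg (by omega), h11])
      (by simp only [NatExpr.eval, RealExpr.eval, Config.putNat_nat, Config.putNat_real, if_true]
          rw [if_neg (by omega), if_neg (by omega), h.sum N (by omega)]) (by omega),
    exec_block_nil]
  constructor
  · simp only [Config.putNat_nat, Config.putReal_nat]
    rw [if_neg (by omega), if_neg (by omega), if_neg (by omega), h.nat_n]
  · simp only [Config.putNat_nat, Config.putReal_nat]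
    rw [if_neg (by omega), if_neg (by omega), if_neg (by omega), h.nat_B]
  · simp only [Config.putNat_nat, Config.putReal_nat]
    rw [if_neg (by omega), if_neg (by omega), if_neg (by omega), h.nat_k]
  · simp only [Config.putNat_nat, Config.putReal_nat, if_true]
    rw [if_neg (by omega), if_neg (by omega)]
  · simp only [Config.putNat_nat, Config.putReal_nat]
    rw [if_neg (by omega), if_neg (by omega), if_neg (by omega), h.nat_L]
  · simp only [Config.putNat_real, Config.putReal_real]
    rw [if_neg (by omega), h.real_p]
  · simp only [Config.putNat_real, Config.putReal_real]
    rw [if_neg (by omega), h.real_y]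
  · simp only [Config.putNat_real, Config.putReal_real]
    rw [if_neg (by omega), h.real_C]
  · intro r hr
    simp only [Config.putNat_nat, Config.putReal_nat, Function.update_apply]
    rw [if_neg (by omega)]
    by_cases h1 : r = b
    · subst h1; simp
    · rw [if_neg (by omega), if_neg (by omega), if_neg h1, h.scale r (by omega)]
  · intro r hr
    simp only [Config.putNat_nat, Config.putReal_nat, Function.update_apply]
    by_cases h1 : r = b
    · subst h1; simp
    · rw [if_neg (by omega), if_neg (by omega), if_neg (by omega), if_neg h1, h.pos r (by omega)]
  · intro r hr
    simp only [Config.putNat_real, Config.putReal_real, Function.update_apply]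
    by_cases h1 : r = b
    · subst h1; simp
    · rw [if_neg (by omega), if_neg h1, h.sum r (by omega)]
  · exact h.input
  · exact h.output

namespace CompactWavelet

variable {q : ℕ} (W : CompactWavelet q)

/-- One step of the search through the records. -/
def pruneBody : Program := block [
  W.loadProg, .ifReal (rc 4) (.lit 0) candidateProg .skip, .setNat (.lit 9) (.add (nc 9) (.lit 1))]

/-- If more than `B` of the vectors in memory vanish beyond the current point, then remove one of
these with the least score. -/
def pruneProg : Program := block [
  .setNat (.lit 9) (.lit 0), .setNat (.lit 10) (.lit 0), .setNat (.lit 11) (.lit 0),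
  .loop (nc 14) W.pruneBody, .ifNat (nc 10) (nc 1) .skip removeProg]

/-- The score of an index: the absolute value of its partial coefficient after `m` entries of the
stream, divided by the norm of the basis vector. -/
def score {L : ℕ} (p' : ENNReal) (f : Fin (2 ^ L) → ℝ) (m : ℕ) (i : Idx L) : ℝ :=
  |partialSum f (W.basis L i) m| / pNorm p' (W.basis L i)

open Classical in
/-- The indices in `K` of the basis vectors that vanish from the point `m` on. -/
def finishedIn {L : ℕ} (m : ℕ) (K : Finset (Idx L)) : Finset (Idx L) :=
  K.filter fun i => Finished (W.basis L i) m

theorem mem_finishedIn {L m : ℕ} {K : Finset (Idx L)} {i : Idx L} :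
    i ∈ W.finishedIn m K ↔ i ∈ K ∧ Finished (W.basis L i) m := by simp [finishedIn]

/-- The invariant of the search: among the first `r` records, `c` belong to basis vectors that are
finished, and cell `11` contains the number of one of these with the least score. -/
structure SearchInv {L : ℕ} (m : ℕ) (e : ℕ → Idx L) (sc : ℕ → ℝ) (r : ℕ) (σ : Config) : Prop where
  pos : σ.nat 9 = r
  count : σ.nat 10 = (W.finishedIn m ((Finset.range r).image e)).card
  best_lt : σ.nat 10 ≠ 0 → σ.nat 11 < r
  best_finished : σ.nat 10 ≠ 0 → Finished (W.basis L (e (σ.nat 11))) m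
  best_eq : σ.nat 10 ≠ 0 → σ.real 9 = sc (σ.nat 11)
  best_le : σ.nat 10 ≠ 0 → ∀ s < r, Finished (W.basis L (e s)) m → sc (σ.nat 11) ≤ sc s

variable {L B S w : ℕ} (hs : Setup q L B S w) {p p' : ENNReal}
  (hpp : ENNReal.HolderConjugate p p') {k : ℕ} (hk : k < 2 ^ L) {y : ℝ} {inp : List ℝ}
  {σ : Config}
include hs hpp hk

theorem exec_pruneBody {N : ℕ} {e : ℕ → Idx L} {acc : ℕ → ℝ}
    (hinj : Set.InjOn e (Finset.range N)) (hN : N < 2 ^ w) (h : Pool B p k y inp N e acc σ)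
    {r : ℕ} (hr : r < N)
    (hI : W.SearchInv (k + 1) e (fun r => |acc r| / pNorm p' (W.basis L (e r))) r σ) :
    Pool B p k y inp N e acc (W.pruneBody.exec S w σ) ∧
      W.SearchInv (k + 1) e (fun r => |acc r| / pNorm p' (W.basis L (e r))) (r + 1)
        (W.pruneBody.exec S w σ) := by
  classical
  have hS := hs.le_S
  obtain ⟨h9, h10, hlt, hfin, heq, hle⟩ := hI
  obtain ⟨l1, l2, -, l4⟩ := W.exec_loadProg hs hpp hk h hr h9
  rw [pruneBody, exec_block_cons, exec_block_cons]
  set ρ := W.loadProg.exec S w σ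
  have hρ := h.keep (l1.mono (by omega) (by omega))
  have e9 : ρ.nat 9 = r := (l1.nat 9 (by omega)).trans h9
  have e10 : ρ.nat 10 = σ.nat 10 := l1.nat 10 (by omega)
  have e11 : ρ.nat 11 = σ.nat 11 := l1.nat 11 (by omega)
  have e9r : ρ.real 9 = σ.real 9 := l1.real 9 (by omega)
  have hcount : W.finishedIn (k + 1) ((Finset.range (r + 1)).image e) =
      if Finished (W.basis L (e r)) (k + 1) then
        insert (e r) (W.finishedIn (k + 1) ((Finset.range r).image e))
      else W.finishedIn (k + 1) ((Finset.range r).image e) := by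
    rw [Finset.range_add_one, Finset.image_insert, finishedIn, Finset.filter_insert]
    rfl
  have hnew : e r ∉ W.finishedIn (k + 1) ((Finset.range r).image e) := by
    rw [mem_finishedIn, Finset.mem_image]
    rintro ⟨⟨s, hs, he⟩, -⟩
    rw [Finset.mem_range] at hs
    have := hinj (by simp; omega) (by simp; omega) he
    omega
  have hcr : σ.nat 10 ≤ r := by
    rw [h10]
    refine (Finset.card_le_card (Finset.filter_subset _ _)).trans ?_
    exact Finset.card_image_le.trans (by simp)
  rw [exec_ifReal (show (rc 4).eval ρ = ρ.real 4 from rfl) (y₀ := 0) rfl]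
  by_cases hf : Finished (W.basis L (e r)) (k + 1)
  · rw [if_pos (l2.2 hf)]
    obtain ⟨c1, c2, c3, c4, c5⟩ := exec_candidateProg (S := S) (w := w) hS e9 e10 (by omega)
      (by omega) (hρ.sum r hr) (s := |acc r| / pNorm p' (W.basis L (e r))) (by rw [l4])
    rw [e9r, e11] at c5
    rw [e9r] at c4
    set τ := candidateProg.exec S w ρ
    rw [exec_block_cons, exec_setNat (a₀ := 9) (v₀ := r + 1) rfl (by simp [NatExpr.eval, c2])
      (by omega) (by omega), exec_block_nil]
    refine ⟨(hρ.keep (c1.mono (by omega) le_rfl)).keep (Keep.putNat (by omega) (by omega)), ?_⟩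
    rw [if_pos hf] at hcount
    by_cases hcase : σ.nat 10 ≤ 0 ∨ |acc r| / pNorm p' (W.basis L (e r)) ≤ σ.real 9
    · obtain ⟨d1, d2⟩ := c4 hcase
      refine ⟨by simp, ?_, fun _ => ?_, fun _ => ?_, fun _ => ?_, fun _ s hsr hsf => ?_⟩
      · rw [hcount, Finset.card_insert_of_notMem hnew, ← h10]
        simp [c3]
      · simp [d1]
      · simpa [d1] using hf
      · simp [d1, d2]
      · simp only [Config.putNat_nat, Nat.reduceEqDiff, if_false, d1]
        rcases Nat.lt_succ_iff_lt_or_eq.1 hsr with h1 | rfl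
        · have h0 : σ.nat 10 ≠ 0 := by
            rw [h10]
            refine (Finset.card_pos.2 ⟨e s, ?_⟩).ne'
            exact W.mem_finishedIn.2 ⟨Finset.mem_image_of_mem _ (Finset.mem_range.2 h1), hsf⟩
          have h2 := hcase.resolve_left (by omega)
          rw [heq h0] at h2
          exact h2.trans (hle h0 s h1 hsf)
        · exact le_rfl
    · obtain ⟨d1, d2⟩ := c5 hcase
      rw [not_or] at hcase
      have h0 : σ.nat 10 ≠ 0 := by omega
      refine ⟨by simp, ?_, fun _ => ?_, fun _ => ?_, fun _ => ?_, fun _ s hsr hsf => ?_⟩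
      · rw [hcount, Finset.card_insert_of_notMem hnew, ← h10]
        simp [c3]
      · simpa [d1] using (hlt h0).trans (Nat.lt_succ_self r)
      · simpa [d1] using hfin h0
      · simpa [d1, d2] using heq h0
      · simp only [Config.putNat_nat, Nat.reduceEqDiff, if_false, d1]
        rcases Nat.lt_succ_iff_lt_or_eq.1 hsr with h1 | rfl
        · exact hle h0 s h1 hsf
        · rw [← heq h0]
          exact (not_le.1 hcase.2).le
  · rw [if_neg fun hc => hf (l2.1 hc), Program.exec]
    rw [exec_block_cons, exec_setNat (a₀ := 9) (v₀ := r + 1) rfl (by simp [NatExpr.eval, e9])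
      (by omega) (by omega), exec_block_nil]
    refine ⟨hρ.keep (Keep.putNat (by omega) (by omega)), ?_⟩
    rw [if_neg hf] at hcount
    refine ⟨by simp, ?_, fun h0 => ?_, fun h0 => ?_, fun h0 => ?_, fun h0 s hsr hsf => ?_⟩
    · rw [hcount, ← h10]
      simp [e10]
    all_goals
      simp only [Config.putNat_nat, Nat.reduceEqDiff, if_false, e10] at h0
      simp only [Config.putNat_nat, Config.putNat_real, Nat.reduceEqDiff, if_false, e11, e9r]
    · exact (hlt h0).trans (Nat.lt_succ_self r)
    · exact hfin h0
    · exact heq h0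
    · rcases Nat.lt_succ_iff_lt_or_eq.1 hsr with h1 | rfl
      · exact hle h0 s h1 hsf
      · exact absurd hsf hf

/-- One round of pruning removes an index with the least score among the finished ones, provided
that there are more than `B` of these. -/
theorem holds_pruneProg {f : Fin (2 ^ L) → ℝ} {K : Finset (Idx L)}
    (hK : K.card ≤ B + 6 * q * L + 2)
    (h : W.Holds f B p k y inp (k + 1) K σ) :
    ((W.finishedIn (k + 1) K).card ≤ B ∧
      W.Holds f B p k y inp (k + 1) K (W.pruneProg.exec S w σ)) ∨
    (B < (W.finishedIn (k + 1) K).card ∧ ∃ i ∈ W.finishedIn (k + 1) K,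
      (∀ i' ∈ W.finishedIn (k + 1) K, W.score p' f (k + 1) i ≤ W.score p' f (k + 1) i') ∧
      W.Holds f B p k y inp (k + 1) (K.erase i) (W.pruneProg.exec S w σ)) := by
  have hS := hs.le_S
  have hsp := hs.space
  have hn := hs.lt_n
  obtain ⟨N, e, h1, h2, h3⟩ := h
  have hN : N = K.card := by rw [← h3, Finset.card_image_of_injOn h2, Finset.card_range]
  have hNL : K.card ≤ 2 ^ L := (Finset.card_le_univ K).trans (card_idx L).le
  rw [pruneProg, exec_block_cons, exec_setNat (a₀ := 9) (v₀ := 0) rfl rfl (by omega)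
    (by positivity), exec_block_cons, exec_setNat (a₀ := 10) (v₀ := 0) rfl rfl (by omega)
    (by positivity), exec_block_cons, exec_setNat (a₀ := 11) (v₀ := 0) rfl rfl (by omega)
    (by positivity), exec_block_cons, exec_block_cons, exec_block_nil]
  set τ : Config := ((σ.putNat 9 0).putNat 10 0).putNat 11 0 with hτ
  have hpool : Pool B p k y inp N e (fun r => partialSum f (W.basis L (e r)) (k + 1)) τ :=
    h1.keep (((Keep.putNat (by omega) (by omega)).trans (Keep.putNat (by omega) (by omega))).trans
      (Keep.putNat (by omega) (by omega)))
  have hl := exec_loop (S := S) (w := w) (σ := τ) (k := nc 14) (P := W.pruneBody) (N := N)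
    (I := fun r ρ => Pool B p k y inp N e (fun r => partialSum f (W.basis L (e r)) (k + 1)) ρ ∧
      W.SearchInv (k + 1) e (fun r => W.score p' f (k + 1) (e r)) r ρ) hpool.nat_N
    ⟨hpool, by simp [hτ], by simp [hτ, finishedIn], fun hc => absurd (by simp [hτ]) hc,
      fun hc => absurd (by simp [hτ]) hc, fun hc => absurd (by simp [hτ]) hc,
      fun hc => absurd (by simp [hτ]) hc⟩
    (fun r hr ρ hρ => W.exec_pruneBody hs hpp hk h2 (by omega) hρ.1 hr hρ.2)
  set ρ := (Program.loop (nc 14) W.pruneBody).exec S w τ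
  obtain ⟨hρ, -, h10, hlt, hfin, -, hle⟩ := hl
  rw [h3] at h10
  rw [exec_ifNat (show (nc 10).eval ρ = _ from h10) (show (nc 1).eval ρ = B from hρ.nat_B)]
  split_ifs with hB
  · exact Or.inl ⟨hB, N, e, hρ, h2, h3⟩
  · have h0 : ρ.nat 10 ≠ 0 := by omega
    have hb := hlt h0
    set b := ρ.nat 11 with hbdef
    obtain ⟨M, rfl⟩ : ∃ M, N = M + 1 := ⟨N - 1, by omega⟩
    refine Or.inr ⟨by omega, e b, ?_, ?_, M, Function.update e b (e M),
      (hρ.exec_removeProg hbdef.symm hb (by omega) (by omega) hn).congr ?_, ?_, ?_⟩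
    · rw [mem_finishedIn, ← h3]
      exact ⟨Finset.mem_image_of_mem _ (Finset.mem_range.2 hb), hfin h0⟩
    · intro i' hi'
      rw [mem_finishedIn, ← h3, Finset.mem_image] at hi'
      obtain ⟨⟨s, hs, rfl⟩, hf⟩ := hi'
      exact hle h0 s (Finset.mem_range.1 hs) hf
    · intro r _
      rw [Function.update_apply, Function.update_apply]
      split_ifs <;> rfl
    · intro r hr s hs' hrs
      simp only [Finset.coe_range, Set.mem_Iio] at hr hs'
      rw [Function.update_apply, Function.update_apply] at hrs
      have hi : ∀ a c, a < M + 1 → c < M + 1 → e a = e c → a = c := fun a c ha hc hac =>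
        h2 (by simpa using ha) (by simpa using hc) hac
      split_ifs at hrs with c1 c2 c2
      · omega
      · have := hi _ _ (by omega) (by omega) hrs; omega
      · have := hi _ _ (by omega) (by omega) hrs; omega
      · exact hi _ _ (by omega) (by omega) hrs
    · have hi : ∀ a c, a < M + 1 → c < M + 1 → e a = e c → a = c := fun a c ha hc hac =>
        h2 (by simpa using ha) (by simpa using hc) hac
      ext i
      rw [← h3]
      simp only [Finset.mem_image, Finset.mem_range, Finset.mem_erase, Function.update_apply]
      constructor
      · rintro ⟨r, hr, rfl⟩
        split_ifs with c1
        · refine ⟨fun hc => ?_, M, by omega, rfl⟩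
          have := hi _ _ (by omega) (by omega) hc; omega
        · refine ⟨fun hc => ?_, r, by omega, rfl⟩
          exact c1 (hi _ _ (by omega) (by omega) hc)
      · rintro ⟨hne, r, hr, rfl⟩
        by_cases hrM : r = M
        · subst hrM
          refine ⟨b, ?_, by simp⟩
          have : b ≠ r := fun hc => hne (by rw [hc])
          omega
        · refine ⟨r, by omega, if_neg fun hc => hne (by rw [hc])⟩

end CompactWavelet

/-! ### The selection kept in memory -/

theorem Finished.mono {n : ℕ} {v : Fin n → ℝ} {m m' : ℕ} (h : Finished v m) (hm : m ≤ m') :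
    Finished v m' := fun k hk => h k (hm.trans hk)

theorem partialSum_eq_dotProduct {n : ℕ} (f v : Fin n → ℝ) {m : ℕ} (hm : m ≤ n)
    (hv : Finished v m) : partialSum f v m = f ⬝ᵥ v := by
  have h : partialSum f v n = f ⬝ᵥ v := by
    rw [partialSum, Finset.sum_range, dotProduct]
    simp_rw [ext_coe]
  rw [← h, partialSum, partialSum]
  refine Finset.sum_subset (Finset.range_subset_range.2 hm) fun k _ hk => ?_
  rw [hv k (by simpa using hk), mul_zero]

namespace CompactWavelet

variable {q : ℕ} (W : CompactWavelet q)

/-- The basis vector `i` does not vanish on the first `m` points. -/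
def Started (L m : ℕ) (i : Idx L) : Prop := ∃ j < m, ext (W.basis L i) j ≠ 0

theorem started_succ {L m : ℕ} {i : Idx L} :
    W.Started L (m + 1) i ↔ W.Started L m i ∨ W.StartsAt L m i := by
  constructor
  · rintro ⟨j, hj, h⟩
    by_cases hs : W.Started L m i
    · exact Or.inl hs
    · have h0 : ∀ j < m, ext (W.basis L i) j = 0 := by
        intro j hj
        by_contra hc
        exact hs ⟨j, hj, hc⟩
      obtain rfl : j = m := by
        by_contra hc
        exact h (h0 j (by omega))
      exact Or.inr ⟨h0, h⟩
  · rintro (⟨j, hj, h⟩ | h)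
    · exact ⟨j, by omega, h⟩
    · exact ⟨m, by omega, h.2⟩

theorem not_startsAt_of_started {L m : ℕ} {i : Idx L} (h : W.Started L m i) :
    ¬ W.StartsAt L m i := by
  obtain ⟨j, hj, h⟩ := h
  exact fun hs => h (hs.1 j hj)

open Classical in
/-- Only `O(q log n)` basis vectors have begun but not ended at a given point: the supports wrap
around the cycle, so that such a vector may also be one that covers the point `0`. -/
theorem card_active_le {L m : ℕ} (hm : m < 2 ^ L) :
    ({i | W.Started L m i ∧ ¬ Finished (W.basis L i) m} : Finset (Idx L)).card
      ≤ 4 * q * L + 1 := by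
  rw [mul_comm (4 * q)]
  refine card_filter_idx_le _ fun j => ?_
  have hsub : ({t | W.Started L m (some ⟨j, t⟩) ∧ ¬ Finished (W.basis L (some ⟨j, t⟩)) m} :
      Finset (Fin (2 ^ (L - 1 - (j : ℕ))))) ⊆
      ({t | ⟨m, hm⟩ ∈ idxArc q L j t} : Finset _) ∪
        ({t | ⟨0, by positivity⟩ ∈ idxArc q L j t} : Finset _) := by
    intro t ht
    simp only [Finset.mem_filter, Finset.mem_univ, true_and, Finset.mem_union] at ht ⊢
    obtain ⟨⟨a, ha, ha'⟩, hb⟩ := ht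
    simp only [Finished, not_forall] at hb
    obtain ⟨b, hb, hb'⟩ := hb
    have hbn : b < 2 ^ L := by
      by_contra hc
      exact hb' (ext_of_le _ (by omega))
    have ha2 := W.mem_idxArc (fun hc => ha' ((ext_coe _ ⟨a, by omega⟩).trans hc))
    have hb2 := W.mem_idxArc (fun hc => hb' ((ext_coe _ ⟨b, hbn⟩).trans hc))
    exact mem_arc_or_zero_mem_arc (k := ⟨m, hm⟩) (by simpa using ha.le) (by simpa using hb) ha2 hb2
  refine (Finset.card_le_card hsub).trans ((Finset.card_union_le _ _).trans ?_)
  have h1 := card_idxArc_overlap_le W.one_le j ⟨m, hm⟩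
  have h2 := card_idxArc_overlap_le W.one_le j ⟨0, by positivity⟩
  omega

theorem card_starting_le {L m : ℕ} (hm : m < 2 ^ L) :
    (W.starting L m fun _ => True).card ≤ 2 * q * L + 1 := by
  refine (Finset.card_le_card fun i hi => ?_).trans (W.card_basis_ne_zero_le ⟨m, hm⟩)
  rw [mem_starting] at hi
  rw [Finset.mem_filter]
  exact ⟨Finset.mem_univ _, fun hc => hi.1.2 ((ext_coe _ ⟨m, hm⟩).trans hc)⟩

/-- The quantity by which the greedy selection orders the indices. -/
def finalScore {L : ℕ} (p' : ENNReal) (f : Fin (2 ^ L) → ℝ) (i : Idx L) : ℝ :=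
  |W.coeff f i| / pNorm p' (W.basis L i)

/-- The partial coefficient of a vector whose support has been read is its coefficient. -/
theorem score_eq_finalScore {L m : ℕ} (hm : m ≤ 2 ^ L) (p' : ENNReal) (f : Fin (2 ^ L) → ℝ)
    {i : Idx L} (hi : Finished (W.basis L i) m) : W.score p' f m i = W.finalScore p' f i := by
  rw [score, finalScore, partialSum_eq_dotProduct _ _ hm hi, coeff]

open Classical in
/-- The indices in `K` that are finished at `m` and beat the index `i`. -/
def beating {L : ℕ} (p' : ENNReal) (f : Fin (2 ^ L) → ℝ) (m : ℕ) (K : Finset (Idx L)) (i : Idx L) :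
    Finset (Idx L) :=
  (W.finishedIn m K).filter fun i' => W.finalScore p' f i ≤ W.finalScore p' f i'

theorem mem_beating {L m : ℕ} {p' : ENNReal} {f : Fin (2 ^ L) → ℝ} {K : Finset (Idx L)}
    {i i' : Idx L} : i' ∈ W.beating p' f m K i ↔
      (i' ∈ K ∧ Finished (W.basis L i') m) ∧ W.finalScore p' f i ≤ W.finalScore p' f i' := by
  rw [beating, Finset.mem_filter, mem_finishedIn]

/-- The invariant of the stream: at `m`, the set `K` consists of indices of vectors that have
started, and every other such index is dispensable, as it is finished and beaten by at least `B`
finished indices in `K`. -/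
structure Candidates {L : ℕ} (p' : ENNReal) (f : Fin (2 ^ L) → ℝ) (B m : ℕ) (K : Finset (Idx L)) :
    Prop where
  started : ∀ i ∈ K, W.Started L m i
  finished : ∀ i, W.Started L m i → i ∉ K → Finished (W.basis L i) m
  beaten : ∀ i, W.Started L m i → i ∉ K → B ≤ (W.beating p' f m K i).card

variable {L B m : ℕ} {p' : ENNReal} {f : Fin (2 ^ L) → ℝ} {K : Finset (Idx L)}

variable {W}

/-- The memory never holds more than `B` finished, `4qL + 1` unfinished and `2qL + 1` new indices.
-/
theorem Candidates.card_union_starting_le (h : W.Candidates p' f B m K)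
    (hB : (W.finishedIn m K).card ≤ B) (hm : m < 2 ^ L) :
    (K ∪ W.starting L m fun _ => True).card ≤ B + 6 * q * L + 2 := by
  classical
  have h1 : K ⊆ W.finishedIn m K ∪
      ({i | W.Started L m i ∧ ¬ Finished (W.basis L i) m} : Finset (Idx L)) := by
    intro i hi
    rw [Finset.mem_union, mem_finishedIn, Finset.mem_filter]
    by_cases hf : Finished (W.basis L i) m
    · exact Or.inl ⟨hi, hf⟩
    · exact Or.inr ⟨Finset.mem_univ _, h.started i hi, hf⟩
  have h2 := (Finset.card_le_card h1).trans (Finset.card_union_le _ _)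
  have h3 := W.card_active_le hm
  have h4 := W.card_starting_le hm
  have h5 := Finset.card_union_le K (W.starting L m fun _ => True)
  linarith

theorem Candidates.union_starting (h : W.Candidates p' f B m K) :
    W.Candidates p' f B (m + 1) (K ∪ W.starting L m fun _ => True) := by
  have hold : ∀ i, W.Started L (m + 1) i → (i ∉ K ∪ W.starting L m fun _ => True) →
      W.Started L m i ∧ i ∉ K := by
    intro i hi hiK
    rw [Finset.mem_union, mem_starting, not_or] at hiK
    exact ⟨(W.started_succ.1 hi).resolve_right fun hc => hiK.2 ⟨hc, trivial⟩, hiK.1⟩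
  refine ⟨fun i hi => ?_, fun i hi hiK => ?_, fun i hi hiK => ?_⟩
  · rw [started_succ]
    rcases Finset.mem_union.1 hi with h1 | h1
    · exact Or.inl (h.started i h1)
    · exact Or.inr (W.mem_starting.1 h1).1
  · obtain ⟨h1, h2⟩ := hold i hi hiK
    exact (h.finished i h1 h2).mono (by omega)
  · obtain ⟨h1, h2⟩ := hold i hi hiK
    refine (h.beaten i h1 h2).trans (Finset.card_le_card fun i' hi' => ?_)
    rw [mem_beating] at hi' ⊢
    exact ⟨⟨Finset.mem_union_left _ hi'.1.1, hi'.1.2.mono (by omega)⟩, hi'.2⟩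

/-- Of more than `B` finished indices, one with the least score is dispensable; the indices that it
beats are beaten by all finished ones. -/
theorem Candidates.erase (h : W.Candidates p' f B m K) (hB : B < (W.finishedIn m K).card)
    {i : Idx L} (hi : i ∈ W.finishedIn m K)
    (hmin : ∀ i' ∈ W.finishedIn m K, W.finalScore p' f i ≤ W.finalScore p' f i') :
    W.Candidates p' f B m (K.erase i) := by
  have hall : B ≤ ((W.finishedIn m K).erase i).card := by
    rw [Finset.card_erase_of_mem hi]
    omega
  refine ⟨fun i' hi' => h.started i' (Finset.mem_of_mem_erase hi'), fun i' hi' hiK => ?_,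
    fun i' hi' hiK => ?_⟩
  · by_cases hii : i' = i
    · subst hii
      exact (W.mem_finishedIn.1 hi).2
    · exact h.finished i' hi' fun hc => hiK (Finset.mem_erase.2 ⟨hii, hc⟩)
  · by_cases hle : W.finalScore p' f i' ≤ W.finalScore p' f i
    · refine hall.trans (Finset.card_le_card fun a ha => ?_)
      rw [Finset.mem_erase] at ha
      have ha' := W.mem_finishedIn.1 ha.2
      exact W.mem_beating.2 ⟨⟨Finset.mem_erase.2 ⟨ha.1, ha'.1⟩, ha'.2⟩, hle.trans (hmin a ha.2)⟩
    · have hii : i' ≠ i := fun hc => hle (by rw [hc])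
      refine (h.beaten i' hi' fun hc => hiK (Finset.mem_erase.2 ⟨hii, hc⟩)).trans
        (Finset.card_le_card fun a ha => ?_)
      rw [mem_beating] at ha ⊢
      refine ⟨⟨Finset.mem_erase.2 ⟨?_, ha.1.1⟩, ha.1.2⟩, ha.2⟩
      rintro rfl
      exact hle ha.2

/-- At the end of the stream all vectors have started and are finished, so the set is greedy. -/
theorem Candidates.isGreedySelection (h : W.Candidates p' f B (2 ^ L) K)
    (hB : (W.finishedIn (2 ^ L) K).card ≤ B) : IsGreedySelection W p' B f K := by
  have hfin : ∀ i : Idx L, Finished (W.basis L i) (2 ^ L) := fun i k hk => ext_of_le _ hk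
  have hst : ∀ i : Idx L, W.Started L (2 ^ L) i := by
    intro i
    obtain ⟨k, hk⟩ := Function.ne_iff.1 (W.basis_ne_zero i)
    exact ⟨k, k.2, by rwa [ext_coe]⟩
  have hK : W.finishedIn (2 ^ L) K = K := by
    ext i
    rw [mem_finishedIn, and_iff_left (hfin i)]
  rw [hK] at hB
  have hle : K.card ≤ 2 ^ L := (Finset.card_le_univ K).trans (card_idx L).le
  have hsub : ∀ i, W.beating p' f (2 ^ L) K i ⊆ K := fun i a ha => (W.mem_beating.1 ha).1.1
  refine ⟨?_, fun i hi k hk => ?_⟩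
  · by_cases hall : K = Finset.univ
    · have hc : K.card = 2 ^ L := by rw [hall, Finset.card_univ, card_idx]
      omega
    · obtain ⟨i, hi⟩ : ∃ i, i ∉ K := by
        by_contra! hc
        exact hall (Finset.eq_univ_of_forall hc)
      have := (h.beaten i (hst i) hi).trans (Finset.card_le_card (hsub i))
      omega
  · have heq := Finset.eq_of_subset_of_card_le (hsub k) (hB.trans (h.beaten k (hst k) hk))
    rw [← heq] at hi
    exact (W.mem_beating.1 hi).2

end CompactWavelet

/-! ### The streaming program -/

/-- Compute `L` and the value of the coarsest scaling vector: `n` tests of whether the power of `2`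
in cell `12` can be doubled. -/
def initProg : Program := block [
  .setReal (.lit 11) (.lit 1), .setNat (.lit 12) (.lit 1),
  .loop (nc 0) (.ifNat (.mul (.lit 2) (nc 12)) (nc 0) (block [
    .setNat (.lit 12) (.mul (.lit 2) (nc 12)), .setNat (.lit 15) (.add (nc 15) (.lit 1)),
    .setReal (.lit 11) (.mul (rc 11) (.lit (√2)⁻¹))]) .skip)]

/-- Write all records on the output. -/
def outputProg : Program := block [
  .setNat (.lit 9) (.lit 0),
  .loop (nc 14) (block [
    .emit (recNat 16 9) (recNat 17 9) (recReal 9), .setNat (.lit 9) (.add (nc 9) (.lit 1))])]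

theorem drop_ofFn {n : ℕ} (f : Fin n → ℝ) {m : ℕ} (hm : m < n) :
    (List.ofFn f).drop m = ext f m :: (List.ofFn f).drop (m + 1) := by
  rw [List.drop_eq_getElem_cons (by simpa using hm), List.getElem_ofFn, ext, dif_pos hm]

namespace CompactWavelet

variable {q : ℕ} (W : CompactWavelet q)

/-- Process one item of the stream. -/
def itemProg : Program := block [
  .read (.lit 10), W.updateProg, W.offerAllProg, .loop (nc 0) W.pruneProg,
  .setNat (.lit 13) (.add (nc 13) (.lit 1))]

/-- The streaming program for the greedy selection. The integer cells `2, …, 12` and the real cells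
`1, …, 9` are scratch space; `Pool` describes the rest of the memory. -/
def selectProg : Program := block [initProg, .loop (nc 0) W.itemProg, outputProg]

variable {L B S w : ℕ} (hs : Setup q L B S w) {p p' : ENNReal} {f : Fin (2 ^ L) → ℝ}
include hs

theorem holds_initProg : W.Holds f B p 0 0 (List.ofFn f) 0 ∅
    (initProg.exec S w (Config.start B p f)) := by
  have hS := hs.le_S
  have hn := hs.lt_n
  have hLn : L < 2 ^ L := L.lt_two_pow_self
  rw [initProg, exec_block_cons, exec_setReal (a₀ := 11) (v₀ := 1) rfl rfl (by omega),
    exec_block_cons, exec_setNat (a₀ := 12) (v₀ := 1) rfl rfl (by omega) (by omega),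
    exec_block_cons, exec_block_nil]
  have hl := exec_loop (S := S) (w := w)
    (σ := ((Config.start B p f).putReal 11 1).putNat 12 1) (k := nc 0)
    (P := .ifNat (.mul (.lit 2) (nc 12)) (nc 0) (block [
      .setNat (.lit 12) (.mul (.lit 2) (nc 12)), .setNat (.lit 15) (.add (nc 15) (.lit 1)),
      .setReal (.lit 11) (.mul (rc 11) (.lit (√2)⁻¹))]) .skip) (N := 2 ^ L)
    (I := fun m τ => τ.nat 12 = 2 ^ min m L ∧ τ.nat 15 = min m L ∧
      τ.real 11 = (√2)⁻¹ ^ min m L ∧ τ.nat 0 = 2 ^ L ∧ τ.nat 1 = B ∧ τ.nat 13 = 0 ∧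
        τ.nat 14 = 0 ∧ τ.real 0 = p⁻¹.toReal ∧ τ.real 10 = 0 ∧ τ.input = List.ofFn f ∧
        τ.output = [])
    (by simp [NatExpr.eval, Config.start]) (by simp [Config.start]) ?_
  · obtain ⟨-, h15, h11, h0, h1, h13, h14, r0, r10, hi, ho⟩ := hl
    rw [min_eq_right hLn.le] at h15 h11
    exact ⟨0, fun _ => none, ⟨h0, h1, h13, h14, h15, r0, r10, h11, fun r hr => absurd hr (by omega),
      fun r hr => absurd hr (by omega), fun r hr => absurd hr (by omega), hi, ho⟩, by simp, by simp⟩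
  · rintro m - τ ⟨h12, h15, h11, h0, hr⟩
    rw [exec_ifNat (x₀ := 2 * 2 ^ min m L) (y₀ := 2 ^ L) (by simp [NatExpr.eval, h12])
      (by simp [NatExpr.eval, h0])]
    have hcond : 2 * 2 ^ min m L ≤ 2 ^ L ↔ m < L := by
      rw [← pow_succ', Nat.pow_le_pow_iff_right (by omega)]
      omega
    by_cases hm : m < L
    · have e0 : min m L = m := by omega
      have e1 : min (m + 1) L = m + 1 := by omega
      have hp : 2 ^ (m + 1) < 2 ^ w := (Nat.pow_le_pow_right (by omega) hm).trans_lt hn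
      rw [e0] at h12 h15 h11
      rw [if_pos (hcond.2 hm), exec_block_cons, exec_setNat (a₀ := 12) (v₀ := 2 ^ (m + 1)) rfl
          (by simp [NatExpr.eval, h12, pow_succ']) (by omega) hp, exec_block_cons,
        exec_setNat (a₀ := 15) (v₀ := m + 1) rfl (by simp [NatExpr.eval, h15]) (by omega)
          (by omega), exec_block_cons,
        exec_setReal (a₀ := 11) (v₀ := (√2)⁻¹ ^ (m + 1)) rfl
          (by simp [RealExpr.eval, NatExpr.eval, h11, pow_succ]) (by omega), exec_block_nil, e1]
      simpa [h0] using hr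
    · have e1 : min (m + 1) L = min m L := by omega
      rw [if_neg fun hc => hm (hcond.1 hc), e1]
      exact ⟨h12, h15, h11, h0, hr⟩

theorem output_outputProg {K : Finset (Idx L)} {y : ℝ} {inp : List ℝ} {σ : Config}
    (hKB : K.card ≤ B) (h : W.Holds f B p (2 ^ L) y inp (2 ^ L) K σ) :
    ∃ l : List (Idx L), l.Nodup ∧ l.toFinset = K ∧
      (outputProg.exec S w σ).output = l.map fun i => (code i, W.coeff f i) := by
  have hS := hs.le_S
  have hB := hs.lt_B
  obtain ⟨N, e, h1, h2, h3⟩ := h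
  have hN : N = K.card := by rw [← h3, Finset.card_image_of_injOn h2, Finset.card_range]
  refine ⟨(List.range N).map e, ?_, ?_, ?_⟩
  · refine List.Nodup.map_on (fun a ha b hb hab => ?_) List.nodup_range
    exact h2 (by simpa using ha) (by simpa using hb) hab
  · ext i
    rw [← h3]
    simp
  · rw [outputProg, exec_block_cons, exec_setNat (a₀ := 9) (v₀ := 0) rfl rfl (by omega)
      (by positivity), exec_block_cons, exec_block_nil]
    have hl := exec_loop (S := S) (w := w) (σ := σ.putNat 9 0) (k := nc 14)
      (P := block [.emit (recNat 16 9) (recNat 17 9) (recReal 9),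
        .setNat (.lit 9) (.add (nc 9) (.lit 1))]) (N := N)
      (I := fun r τ => τ.nat 9 = r ∧ (∀ a, 16 ≤ a → τ.nat a = σ.nat a) ∧ τ.real = σ.real ∧
        τ.output = ((List.range r).map e).map fun i => (code i, W.coeff f i))
      (by simp [NatExpr.eval, h1.nat_N])
      ⟨by simp, fun a ha => by rw [Config.putNat_nat, if_neg (by omega)], rfl,
        by simp [h1.output]⟩ ?_
    · exact hl.2.2.2
    · rintro r hr τ ⟨h9, hnat, hreal, hout⟩
      have hemit : (Program.emit (recNat 16 9) (recNat 17 9) (recReal 9)).exec S w τ =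
          { τ with output := τ.output ++ [(code (e r), W.coeff f (e r))] } := by
        have hsum : σ.real (16 + r) = W.coeff f (e r) := (h1.sum r hr).trans
          (partialSum_eq_dotProduct _ _ le_rfl fun k hk => ext_of_le _ hk)
        simp only [Program.exec, NatExpr.eval, RealExpr.eval, h9, hreal]
        rw [hnat _ (by omega), hnat _ (by omega), h1.scale r hr, h1.pos r hr, hsum]
      rw [exec_block_cons, hemit, exec_block_cons, exec_setNat (a₀ := 9) (v₀ := r + 1) rfl
        (by simp [NatExpr.eval, h9]) (by omega) (by omega), exec_block_nil]
      refine ⟨by simp, fun a ha => ?_, hreal, ?_⟩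
      · rw [Config.putNat_nat, if_neg (by omega)]
        exact hnat a ha
      · simp [hout, List.range_succ]

/-- Since there are only `n` indices, `n` rounds of pruning leave at most `B` finished ones. -/
theorem exec_pruneLoop (hpp : ENNReal.HolderConjugate p p') {k : ℕ} (hk : k < 2 ^ L) {y : ℝ}
    {inp : List ℝ} {σ : Config} {K : Finset (Idx L)} (hK : K.card ≤ B + 6 * q * L + 2)
    (hc : W.Candidates p' f B (k + 1) K) (h : W.Holds f B p k y inp (k + 1) K σ) :
    ∃ K' : Finset (Idx L), W.Candidates p' f B (k + 1) K' ∧ (W.finishedIn (k + 1) K').card ≤ B ∧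
      W.Holds f B p k y inp (k + 1) K' ((Program.loop (nc 0) W.pruneProg).exec S w σ) := by
  have hcard : ∀ K : Finset (Idx L), (W.finishedIn (k + 1) K).card ≤ 2 ^ L := fun K =>
    (Finset.card_le_univ _).trans (card_idx L).le
  have hl := exec_loop (S := S) (w := w) (σ := σ) (k := nc 0) (P := W.pruneProg) (N := 2 ^ L)
    (I := fun t τ => ∃ K' : Finset (Idx L), W.Candidates p' f B (k + 1) K' ∧
      K'.card ≤ B + 6 * q * L + 2 ∧
      ((W.finishedIn (k + 1) K').card ≤ B ∨ (W.finishedIn (k + 1) K').card + t ≤ 2 ^ L) ∧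
      W.Holds f B p k y inp (k + 1) K' τ)
    (by simp [NatExpr.eval, h.nat_eq.1]) ⟨K, hc, hK, Or.inr (hcard K), h⟩ ?_
  · obtain ⟨K', h1, -, h3, h4⟩ := hl
    exact ⟨K', h1, by omega, h4⟩
  · rintro t - τ ⟨K', h1, h2, h3, h4⟩
    rcases W.holds_pruneProg hs hpp hk h2 h4 with ⟨g1, g2⟩ | ⟨g1, i, g2, g3, g4⟩
    · exact ⟨K', h1, h2, Or.inl g1, g2⟩
    · have hi := W.mem_finishedIn.1 g2
      refine ⟨K'.erase i, h1.erase g1 g2 fun i' hi' => ?_,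
        (Finset.card_le_card (Finset.erase_subset _ _)).trans h2, ?_, g4⟩
      · have := g3 i' hi'
        rwa [W.score_eq_finalScore hk p' f hi.2,
          W.score_eq_finalScore hk p' f (W.mem_finishedIn.1 hi').2] at this
      · have hlt : (W.finishedIn (k + 1) (K'.erase i)).card < (W.finishedIn (k + 1) K').card := by
          refine Finset.card_lt_card ⟨fun a ha => ?_, fun hsub => ?_⟩
          · rw [mem_finishedIn] at ha ⊢
            exact ⟨Finset.mem_of_mem_erase ha.1, ha.2⟩
          · exact Finset.notMem_erase i K' (W.mem_finishedIn.1 (hsub g2)).1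
        omega

theorem exec_itemProg (hpp : ENNReal.HolderConjugate p p') {m : ℕ} (hm : m < 2 ^ L) {y : ℝ}
    {σ : Config} {K : Finset (Idx L)} (hc : W.Candidates p' f B m K)
    (hB : (W.finishedIn m K).card ≤ B)
    (h : W.Holds f B p m y ((List.ofFn f).drop m) m K σ) :
    ∃ (K' : Finset (Idx L)) (y' : ℝ), W.Candidates p' f B (m + 1) K' ∧
      (W.finishedIn (m + 1) K').card ≤ B ∧
      W.Holds f B p (m + 1) y' ((List.ofFn f).drop (m + 1)) (m + 1) K'
        (W.itemProg.exec S w σ) := by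
  have hS := hs.le_S
  have hn := hs.lt_n
  have hread : W.Holds f B p m (ext f m) ((List.ofFn f).drop (m + 1)) m K
      ((Program.read (.lit 10)).exec S w σ) := by
    obtain ⟨N, e, h1, h2, h3⟩ := h
    have e0 : (Program.read (.lit 10)).exec S w σ =
        { σ.putReal 10 (ext f m) with input := (List.ofFn f).drop (m + 1) } := by
      simp only [Program.exec, h1.input, NatExpr.eval]
      rw [drop_ofFn f hm, Config.storeReal, if_pos (by omega)]
      rfl
    rw [e0]
    have hreal : ∀ a, a ≠ 10 → (σ.putReal 10 (ext f m)).real a = σ.real a := fun a ha => by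
      rw [Config.putReal_real, if_neg ha]
    exact ⟨N, e, ⟨h1.nat_n, h1.nat_B, h1.nat_k, h1.nat_N, h1.nat_L,
      (hreal _ (by omega)).trans h1.real_p, by simp, (hreal _ (by omega)).trans h1.real_C,
      h1.scale, h1.pos, fun r hr => (hreal _ (by omega)).trans (h1.sum r hr), rfl, h1.output⟩,
      h2, h3⟩
  have hcap := hc.card_union_starting_le hB hm
  have hupd := W.holds_updateProg hs hpp hm rfl
    ((Finset.card_le_card Finset.subset_union_left).trans hcap) hread
  have hoff := W.holds_offerAllProg hs hpp hm rfl
    (fun i hi => W.not_startsAt_of_started (hc.started i hi)) hcap hupd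
  obtain ⟨K', c1, c2, N, e, h1, h2, h3⟩ :=
    W.exec_pruneLoop hs hpp hm hcap hc.union_starting hoff
  refine ⟨K', ext f m, c1, c2, N, e, ?_, h2, h3⟩
  rw [itemProg, exec_block_cons, exec_block_cons, exec_block_cons, exec_block_cons,
    exec_block_cons, exec_setNat (a₀ := 13) (v₀ := m + 1) rfl (by simp [NatExpr.eval, h1.nat_k])
      (by omega) (by omega), exec_block_nil]
  have hnat : ∀ (τ : Config) (a : ℕ), a ≠ 13 → (τ.putNat 13 (m + 1)).nat a = τ.nat a :=
    fun τ a ha => by rw [Config.putNat_nat, if_neg ha]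
  exact ⟨(hnat _ _ (by omega)).trans h1.nat_n, (hnat _ _ (by omega)).trans h1.nat_B, by simp,
    (hnat _ _ (by omega)).trans h1.nat_N, (hnat _ _ (by omega)).trans h1.nat_L, h1.real_p,
    h1.real_y, h1.real_C, fun r hr => (hnat _ _ (by omega)).trans (h1.scale r hr),
    fun r hr => (hnat _ _ (by omega)).trans (h1.pos r hr), h1.sum, h1.input, h1.output⟩

theorem output_selectProg (hpp : ENNReal.HolderConjugate p p') (f : Fin (2 ^ L) → ℝ) :
    ∃ l : List (Idx L), l.Nodup ∧ IsGreedySelection W p' B f l.toFinset ∧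
      (W.selectProg.exec S w (Config.start B p f)).output =
        l.map fun i => (code i, W.coeff f i) := by
  have hinit := W.holds_initProg hs (p := p) (f := f)
  have hl := exec_loop (S := S) (w := w) (σ := initProg.exec S w (Config.start B p f)) (k := nc 0)
    (P := W.itemProg) (N := 2 ^ L)
    (I := fun m τ => ∃ (K : Finset (Idx L)) (y : ℝ), W.Candidates p' f B m K ∧
      (W.finishedIn m K).card ≤ B ∧ W.Holds f B p m y ((List.ofFn f).drop m) m K τ)
    (by simp [NatExpr.eval, hinit.nat_eq.1])
    ⟨∅, 0, ⟨by simp, fun i hi => absurd hi (by simp [Started]),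
      fun i hi => absurd hi (by simp [Started])⟩, by simp [finishedIn], by simpa using hinit⟩
    (fun m hm τ ⟨K, y, h1, h2, h3⟩ => W.exec_itemProg hs hpp hm h1 h2 h3)
  obtain ⟨K, y, h1, h2, h3⟩ := hl
  have hg := h1.isGreedySelection h2
  obtain ⟨l, l1, rfl, l3⟩ := W.output_outputProg hs (hg.1.le.trans (min_le_left _ _)) h3
  exact ⟨l, l1, hg, l3⟩

end CompactWavelet

/-- The constant in the space bound: `B + 6qL + 2` records of two integers, and `18` further cells;
the words must also hold the numbers of the `(2q)^L ≤ 2^(2qL)` paths. -/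
theorem Setup.of_one_le {q L B : ℕ} (hq : 1 ≤ q) (hL : 1 ≤ L) :
    Setup q L B ((12 * q + 22) * (B + L)) ((12 * q + 22) * (L + Nat.size B)) where
  one_le_q := hq
  one_le_L := hL
  space := by nlinarith
  lt_n := Nat.pow_lt_pow_right (by norm_num) (by nlinarith)
  lt_paths := by
    calc (2 * q) ^ L ≤ (2 ^ (2 * q)) ^ L := Nat.pow_le_pow_left (Nat.lt_two_pow_self).le _
      _ = 2 ^ (2 * q * L) := (pow_mul _ _ _).symm
      _ < _ := Nat.pow_lt_pow_right (by norm_num) (by nlinarith)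
  lt_B := (Nat.lt_size_self B).trans_le (Nat.pow_le_pow_right (by norm_num) (by nlinarith))

end GreedyWavelet
end

theorem mainTheorem1 :
    ∃ C : ℝ, ∀ q : ℕ, ∃ c : ℕ, ∀ W : GreedyWavelet.CompactWavelet q,
      -- the constant of the wavelet is finite
      BddAbove W.scaledValues ∧
      -- every greedy selection is an `O(q^(3/2) log n)` approximation, `n = 2 ^ L`
      (∀ L : ℕ, 1 ≤ L → ∀ p p' : ENNReal, ENNReal.HolderConjugate p p' →
        ∀ (B : ℕ) (f : Fin (2 ^ L) → ℝ) (S : Finset (GreedyWavelet.Idx L)),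
          GreedyWavelet.IsGreedySelection W p' B f S →
          ∀ z : GreedyWavelet.Idx L → ℝ, (Finset.univ.filter fun i => z i ≠ 0).card ≤ B →
            GreedyWavelet.pNorm p (f - ∑ i ∈ S, W.coeff f i • W.basis L i) ≤
              C * W.supConst * (q : ℝ) ^ (3 / 2 : ℝ) * (L : ℝ) *
                GreedyWavelet.pNorm p (f - ∑ i, z i • W.basis L i)) ∧
      -- one program makes a greedy selection in one pass and `O(B + log n)` words of space
      ∃ P : GreedyWavelet.Program,
        ∀ L : ℕ, 1 ≤ L → ∀ p p' : ENNReal, ENNReal.HolderConjugate p p' →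
          ∀ (B : ℕ) (f : Fin (2 ^ L) → ℝ),
            ∃ l : List (GreedyWavelet.Idx L), l.Nodup ∧
              GreedyWavelet.IsGreedySelection W p' B f l.toFinset ∧
              (P.exec (c * (B + L)) (c * (L + Nat.size B))
                (GreedyWavelet.Config.start B p f)).output =
                l.map fun i => (GreedyWavelet.code i, W.coeff f i) := by
  refine ⟨5, fun q => ⟨12 * q + 22, fun W => ⟨W.bddAbove_scaledValues, ?_, W.selectProg, ?_⟩⟩⟩
  · intro L hL p p' h B f S hS z hz
    exact W.greedy_approximation hL h hS hz
  · intro L hL p p' h B f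
    exact W.output_selectProg (GreedyWavelet.Setup.of_one_le W.one_le hL) h f
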